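/- Let $(M,g)$ be a globally hyperbolic spacetime (time-oriented, signature $(-,+,\dots,+)$), with volume measure $d\mathrm{Vol}_g$, and let $V_0,V_1$ be complex vector bundles of finite rank over $M$ with fibrewise non-degenerate hermitian forms. For such a bundle $V$ let $\Gamma(M;V)$, $\Gamma_c(M;V)$ be the smooth, resp. compactly supported smooth, sections and $(u|v)_V=\int_M (u(x),v(x))_V\,d\mathrm{Vol}_g$; adjoints $A^*$ are formal adjoints. A differential operator $D$ on $V$ is Green hyperbolic if $D$ and $D^*$ have retarded and advanced propagators $G^\pm:\Gamma_c\to\Gamma$, i.e. two-sided inverses with $\operatorname{supp}G^\pm u\subset J^\pm(\operatorname{supp}u)$; then $G_D:=G_D^+-G_D^-$. **Two-point functions.** Let $V=\bigoplus_{i\in I}V_{[i]}$ ($I\subset\mathbb Z$ finite) be graded and $D$ Green hyperbolic on $V$. A pair $\lambda^\pm:\Gamma_c(M;V)\to\Gamma(M;V)$ of continuous linear maps consists of *bosonic two-point functions for $D$* if $(u|\lambda^\pm v)_V=(\lambda^\pm u|v)_V$, $\lambda^\pm D=0$ on $\Gamma_c$, $\lambda^\pm\Gamma_c(M;V_{[i]})\subset\Gamma(M;V_{[-i]})$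 for $i\in I$, and $\lambda^+-(-1)^{\mathrm{gh}}\lambda^-=\mathrm i^{-1}G_D$, where the block of $(-1)^{\mathrm{gh}}\lambda^-$ from $V_{[j]}$ to $V_{[i]}$ is $(-1)^{ij}$ times that of $\lambda^-$. They are *Hadamard* if $\mathrm{WF}'(\lambda^\pm)=(\mathcal N^\pm\times\mathcal N^\pm)\cap\mathrm{WF}'(G_D)$, where $\mathcal N^\pm$ is the set of covectors $g(v,\cdot)$ with $v\ne0$ null and future-directed (for $+$), resp. past-directed (for $-$). Bundles without specified grading are placed in degree $0$. **BRST framework.** Given a hermitian graded bundle $V$ with $I=\{-1,0,1\}$ and operators $L,\gamma$ on $V$, the *BRST hypotheses* are: $\gamma^2=0$; $\gamma$ lowers the degree by one; every $u\in\Gamma_c(M;V_{[-1]})$ with $\gamma u=0$ is of the form $\gamma w$, $w\in\Gamma_c(M;V)$; $L$ is Green hyperbolic, $L=L^*$, $\gamma^*L=L\gamma$, and $L\Gamma(M;V_{[i]})\subset\Gamma(M;V_{[-i]})$. The phase space $(\mathcal V,q)$ is then $$\mathcal V=\frac{\operatorname{Ker}\gamma^*|_{\Gamma_c}\cap\Gamma_c(M;V_{[0]})}{\big(\operatorname{Ran}\gamma^*|_{\Gamma_c}+(\operatorname{Ran}L|_{\Gamma_c}\cap\operatorname{Ker}\gamma^*|_{\Gamma_c})\big)\cap\Gamma_c(M;V_{[0]})},\qquad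 q([u],[v])=\mathrm i^{-1}(u|G_Lv)_V .$$ The algebra $\mathrm{CCR}(\mathcal V,q)$ is the unital $*$-algebra generated by $\psi(v)$ (antilinear in $v$) and $\psi^*(v)=\psi(v)^*$, $v\in\mathcal V$, with $[\psi(v),\psi(w)]=[\psi^*(v),\psi^*(w)]=0$, $[\psi(v),\psi^*(w)]=q(v,w)\mathbf 1$. Operators $\lambda^\pm$ are the *two-point functions of a Hadamard state* on it if they are Hadamard bosonic two-point functions for $L$ and there is a (gauge-invariant) quasi-free state $\omega$ with $\omega(\psi([u])\psi^*([v]))=(u|\lambda^+v)_V$ and $\omega(\psi^*([v])\psi([u]))=(u|\lambda^-v)_V$ for all $u,v\in\operatorname{Ker}\gamma^*\cap\Gamma_c(M;V_{[0]})$. **Proposition.** Let $P$ be a formally self-adjoint differential operator on $V_1$ and $K\ne0$ a differential operator from $V_0$ to $V_1$ with $PK=0$, such that $D:=P+KK^*$ and $R:=K^*K$ are Green hyperbolic. Let $V=V_1\oplus V_0\oplus V_0\oplus V_0$ with the direct sum hermitian form, its summands having degrees $0,0,1,-1$, and let $$L=\begin{pmatrix}P&K&0&0\\K^*&-\mathbf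 1&0&0\\0&0&0&K^*K\\0&0&K^*K&0\end{pmatrix},\qquad \gamma=\begin{pmatrix}0&0&K&0\\0&0&0&0\\0&0&0&0\\0&\mathbf 1&0&0\end{pmatrix}.$$ Let $\lambda_D^\pm$, $\lambda_R^\pm$ be bosonic Hadamard two-point functions for $D$, $R$ such that $K\lambda_R^\pm=\lambda_D^\pm K$ on $\Gamma_c(M;V_0)$ and $(u|\lambda_D^\pm u)_{V_1}\ge0$ for all $u\in\Gamma_c(M;V_1)$ with $K^*u=0$. Then $L,\gamma$ satisfy the BRST hypotheses, $q$ is a well-defined hermitian form on $\mathcal V$, and $$\lambda_L^\pm=\begin{pmatrix}\lambda_D^\pm&K\lambda_R^\pm&0&0\\\lambda_R^\pm K^*&0&0&0\\0&0&0&\pm\lambda_R^\pm\\0&0&\pm\lambda_R^\pm&0\end{pmatrix}$$ are bosonic two-point functions for $L$ and are the two-point functions of a Hadamard state on $\mathrm{CCR}(\mathcal V,q)$. -/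

import Mathlib

open Set Filter Topology Bundle MeasureTheory
open scoped Manifold ContDiff ComplexOrder

universe u v v₁ v₂ v₃

noncomputable section

namespace BRST

/-! ### Complex vector bundles with hermitian structure, and their sections -/

/-- A smooth complex vector bundle of finite rank over the (real) manifold `M`, with a smooth,
fibrewise non-degenerate (not necessarily positive) hermitian form, antilinear in the first
argument. The bundle charts are `ℂ`-linear and smooth over `ℝ`. -/
structure HermBundle (n : ℕ) (M : Type u) [TopologicalSpace M]
    [ChartedSpace (EuclideanSpace ℝ (Fin n)) M] where
  F : Type v
  [normedGroup : NormedAddCommGroup F]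
  [normedSpace : NormedSpace ℂ F]
  [finiteDim : FiniteDimensional ℂ F]
  V : M → Type v
  [topTotal : TopologicalSpace (TotalSpace F V)]
  [topFiber : ∀ x, TopologicalSpace (V x)]
  [addCommGroup : ∀ x, AddCommGroup (V x)]
  [module : ∀ x, Module ℂ (V x)]
  [fiberBundle : FiberBundle F V]
  [complexBundle : VectorBundle ℂ F V]
  [realBundle : VectorBundle ℝ F V]
  [smoothBundle : ContMDiffVectorBundle ∞ F V (𝓡 n)]
  form : ∀ x, V x →ₗ⋆[ℂ] V x →ₗ[ℂ] ℂ
  form_symm : ∀ x v w, star (form x v w) = form x w v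
  form_nondeg : ∀ x v, (∀ w, form x v w = 0) → v = 0
  form_smooth : ∀ s t : ∀ x, V x,
    ContMDiff (𝓡 n) ((𝓡 n).prod 𝓘(ℝ, F)) ∞ (fun x => TotalSpace.mk' F x (s x)) →
    ContMDiff (𝓡 n) ((𝓡 n).prod 𝓘(ℝ, F)) ∞ (fun x => TotalSpace.mk' F x (t x)) →
    ContMDiff (𝓡 n) 𝓘(ℝ, ℂ) ∞ (fun x => form x (s x) (t x))

attribute [instance] HermBundle.normedGroup HermBundle.normedSpace HermBundle.finiteDim
  HermBundle.topTotal HermBundle.topFiber HermBundle.addCommGroup HermBundle.module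
  HermBundle.fiberBundle HermBundle.complexBundle HermBundle.realBundle HermBundle.smoothBundle

section Bundles

variable {n : ℕ} {M : Type u} [TopologicalSpace M] [ChartedSpace (EuclideanSpace ℝ (Fin n)) M]

/-- Smoothness of a section. -/
def IsSmooth (E : HermBundle.{u, v} n M) (s : ∀ x, E.V x) : Prop :=
  ContMDiff (𝓡 n) ((𝓡 n).prod 𝓘(ℝ, E.F)) ∞ (fun x => TotalSpace.mk' E.F x (s x))

/-- The support of a section. -/
def supp {E : HermBundle.{u, v} n M} (s : ∀ x, E.V x) : Set M := closure {x | s x ≠ 0}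

theorem isSmooth_iff {E : HermBundle.{u, v} n M} {s : ∀ x, E.V x} :
    IsSmooth E s ↔ ∀ x₀, ContMDiffAt (𝓡 n) 𝓘(ℝ, E.F) ∞
      (fun x => (trivializationAt E.F E.V x₀ ⟨x, s x⟩).2) x₀ :=
  forall_congr' fun _ => contMDiffAt_section _

theorem smul_smooth_at {E : HermBundle.{u, v} n M} {f : M → ℂ} {s : ∀ x, E.V x} {x₀ : M}
    (hf : ContMDiffAt (𝓡 n) 𝓘(ℝ, ℂ) ∞ f x₀)
    (hs : ContMDiffAt (𝓡 n) 𝓘(ℝ, E.F) ∞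
      (fun x => (trivializationAt E.F E.V x₀ ⟨x, s x⟩).2) x₀) :
    ContMDiffAt (𝓡 n) 𝓘(ℝ, E.F) ∞
      (fun x => (trivializationAt E.F E.V x₀ ⟨x, f x • s x⟩).2) x₀ := by
  set e := trivializationAt E.F E.V x₀
  have h1 : ContMDiffAt (𝓡 n) 𝓘(ℝ, E.F) ∞ (fun x => f x • (e ⟨x, s x⟩).2) x₀ := by
    have hb : ContDiff ℝ ∞ (fun p : ℂ × E.F => p.1 • p.2) := contDiff_fst.smul contDiff_snd
    exact hb.contMDiff.contMDiffAt.comp x₀ (hf.prodMk_space hs)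
  refine h1.congr_of_eventuallyEq ?_
  filter_upwards [e.open_baseSet.mem_nhds (FiberBundle.mem_baseSet_trivializationAt' x₀)]
    with x hx
  exact (e.linear ℂ hx).map_smul (f x) (s x)

theorem IsSmooth.mul {E : HermBundle.{u, v} n M} {f : M → ℂ}
    (hf : ContMDiff (𝓡 n) 𝓘(ℝ, ℂ) ∞ f) {s : ∀ x, E.V x} (hs : IsSmooth E s) :
    IsSmooth E (fun x => f x • s x) :=
  isSmooth_iff.2 fun x₀ => smul_smooth_at (hf x₀) (isSmooth_iff.1 hs x₀)

/-- The space `Γ(M;E)` of smooth sections. -/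
def Sec (E : HermBundle.{u, v} n M) : Submodule ℂ (∀ x, E.V x) where
  carrier := {s | IsSmooth E s}
  zero_mem' := contMDiff_zeroSection ℝ E.V
  add_mem' hs ht := ContMDiff.add_section hs ht
  smul_mem' _ _ hs := IsSmooth.mul contMDiff_const hs

theorem supp_add_subset {E : HermBundle.{u, v} n M} (s t : ∀ x, E.V x) :
    supp (s + t) ⊆ supp s ∪ supp t := by
  rw [supp, supp, supp, ← closure_union]
  refine closure_mono fun x hx => ?_
  by_contra h
  simp only [mem_union, mem_ofPred_eq, not_or, not_not] at h
  exact hx (by simp [h.1, h.2])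

theorem supp_mul_subset {E : HermBundle.{u, v} n M} (f : M → ℂ) (s : ∀ x, E.V x) :
    supp (fun x => f x • s x) ⊆ supp s :=
  closure_mono fun x hx h => hx (by simp [h])

/-- The space `Γ_c(M;E)` of compactly supported smooth sections. -/
def SecC (E : HermBundle.{u, v} n M) : Submodule ℂ (∀ x, E.V x) where
  carrier := {s | IsSmooth E s ∧ IsCompact (supp s)}
  zero_mem' := ⟨(Sec E).zero_mem, by simp [supp]⟩
  add_mem' {s t} hs ht := ⟨(Sec E).add_mem hs.1 ht.1,
    (hs.2.union ht.2).of_isClosed_subset isClosed_closure (supp_add_subset s t)⟩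
  smul_mem' c s hs := ⟨(Sec E).smul_mem c hs.1,
    hs.2.of_isClosed_subset isClosed_closure (supp_mul_subset (fun _ => c) s)⟩

instance (E : HermBundle.{u, v} n M) : AddCommGroup (Sec E) := Submodule.addCommGroup _

instance (E : HermBundle.{u, v} n M) : AddCommGroup (SecC E) := Submodule.addCommGroup _

/-- The inclusion `Γ_c(M;E) ⊆ Γ(M;E)`. -/
def toSec (E : HermBundle.{u, v} n M) : SecC E →ₗ[ℂ] Sec E :=
  Submodule.inclusion fun _ hs => hs.1

/-- Multiplication of sections by a smooth complex function. -/
def mulSec (E : HermBundle.{u, v} n M) (f : C^∞⟮𝓡 n, M; 𝓘(ℝ, ℂ), ℂ⟯) : Sec E →ₗ[ℂ] Sec E where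
  toFun s := ⟨fun x => f x • s.1 x, IsSmooth.mul f.contMDiff s.2⟩
  map_add' s t := Subtype.ext (funext fun x => smul_add (f x) (s.1 x) (t.1 x))
  map_smul' c s := Subtype.ext (funext fun x => smul_comm (f x) c (s.1 x))

/-! ### Differential operators -/

/-- The commutator `[A, f]` of an operator with multiplication by a function. -/
def comm {E : HermBundle.{u, v₁} n M} {E' : HermBundle.{u, v₂} n M}
    (A : Sec E →ₗ[ℂ] Sec E') (f : C^∞⟮𝓡 n, M; 𝓘(ℝ, ℂ), ℂ⟯) : Sec E →ₗ[ℂ] Sec E' :=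
  A ∘ₗ mulSec E f - mulSec E' f ∘ₗ A

/-- `OrderLT m A`: the operator `A` is a differential operator of order `< m`, i.e. all
`m`-fold commutators with multiplication by smooth functions vanish. -/
def OrderLT {E : HermBundle.{u, v₁} n M} {E' : HermBundle.{u, v₂} n M} :
    ℕ → (Sec E →ₗ[ℂ] Sec E') → Prop
  | 0, A => A = 0
  | m + 1, A => ∀ f, OrderLT m (comm A f)

/-- `Diff(M;E,E')`: linear differential operators of finite order with smooth coefficients.
(Support decrease follows from finiteness of the order; it is recorded for convenience.) -/
structure DiffOp (E : HermBundle.{u, v₁} n M) (E' : HermBundle.{u, v₂} n M) where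
  toLin : Sec E →ₗ[ℂ] Sec E'
  supp_subset : ∀ s, supp (toLin s).1 ⊆ supp s.1
  finite_order : ∃ m, OrderLT m toLin

section OrderLemmas

variable {E : HermBundle.{u, v₁} n M} {E' : HermBundle.{u, v₂} n M} {E'' : HermBundle.{u, v₃} n M}

theorem orderLT_zero (m : ℕ) : OrderLT m (0 : Sec E →ₗ[ℂ] Sec E') := by
  induction m with
  | zero => rfl
  | succ m ih =>
    intro f
    have : comm (0 : Sec E →ₗ[ℂ] Sec E') f = 0 := by
      ext s : 1; simp [comm]
    rw [this]; exact ih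

theorem OrderLT.succ {m : ℕ} {A : Sec E →ₗ[ℂ] Sec E'} (h : OrderLT m A) : OrderLT (m + 1) A := by
  induction m generalizing A with
  | zero =>
    intro f
    rw [show A = 0 from h]
    exact orderLT_zero 1 f
  | succ m ih => exact fun f => ih (h f)

theorem OrderLT.add_right {m : ℕ} {A : Sec E →ₗ[ℂ] Sec E'} (h : OrderLT m A) (k : ℕ) :
    OrderLT (m + k) A := by
  induction k with
  | zero => exact h
  | succ k ih => exact ih.succ

theorem OrderLT.add {m : ℕ} {A B : Sec E →ₗ[ℂ] Sec E'} (hA : OrderLT m A) (hB : OrderLT m B) :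
    OrderLT m (A + B) := by
  induction m generalizing A B with
  | zero => rw [show A = 0 from hA, show B = 0 from hB]; exact add_zero _
  | succ m ih =>
    intro f
    have : comm (A + B) f = comm A f + comm B f := by
      simp only [comm, LinearMap.add_comp, LinearMap.comp_add]; abel
    rw [this]; exact ih (hA f) (hB f)

theorem OrderLT.smul {m : ℕ} {A : Sec E →ₗ[ℂ] Sec E'} (c : ℂ) (hA : OrderLT m A) :
    OrderLT m (c • A) := by
  induction m generalizing A with
  | zero => rw [show A = 0 from hA]; exact smul_zero c
  | succ m ih =>
    intro f
    have : comm (c • A) f = c • comm A f := by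
      ext1 s
      simp only [comm, LinearMap.smul_apply, LinearMap.sub_apply, LinearMap.comp_apply, map_smul]
      exact (smul_sub c _ _).symm
    rw [this]; exact ih (hA f)

theorem OrderLT.comp {N a b : ℕ} (hN : a + b ≤ N) {A : Sec E' →ₗ[ℂ] Sec E''}
    {B : Sec E →ₗ[ℂ] Sec E'} (hA : OrderLT a A) (hB : OrderLT b B) : OrderLT N (A ∘ₗ B) := by
  induction N generalizing a b A B with
  | zero =>
    obtain rfl : a = 0 := by omega
    rw [show A = 0 from hA, LinearMap.zero_comp]; exact orderLT_zero 0
  | succ N ih =>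
    rcases a with _ | a
    · rw [show A = 0 from hA, LinearMap.zero_comp]; exact orderLT_zero _
    rcases b with _ | b
    · rw [show B = 0 from hB, LinearMap.comp_zero]; exact orderLT_zero _
    intro f
    have : comm (A ∘ₗ B) f = comm A f ∘ₗ B + A ∘ₗ comm B f := by
      ext1 s; simp [comm]
    rw [this]
    exact (ih (a := a) (b := b + 1) (by omega) (hA f) hB).add
      (ih (a := a + 1) (b := b) (by omega) hA (hB f))

end OrderLemmas

namespace DiffOp

variable {E : HermBundle.{u, v₁} n M} {E' : HermBundle.{u, v₂} n M} {E'' : HermBundle.{u, v₃} n M}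

instance : Zero (DiffOp E E') where
  zero := ⟨0, fun s => by simp [supp], 0, rfl⟩

instance : Add (DiffOp E E') where
  add A B := ⟨A.toLin + B.toLin,
    fun s => (supp_add_subset _ _).trans (union_subset (A.supp_subset s) (B.supp_subset s)), by
      obtain ⟨a, ha⟩ := A.finite_order
      obtain ⟨b, hb⟩ := B.finite_order
      exact ⟨a + b, (ha.add_right b).add (by rw [add_comm]; exact hb.add_right a)⟩⟩

/-- Scalar multiples of differential operators. -/
def smul (c : ℂ) (A : DiffOp E E') : DiffOp E E' where
  toLin := c • A.toLin
  supp_subset s := (supp_mul_subset (fun _ => c) _).trans (A.supp_subset s)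
  finite_order := A.finite_order.imp fun _ h => h.smul c

/-- The composition `A B`. -/
def comp (A : DiffOp E' E'') (B : DiffOp E E') : DiffOp E E'' where
  toLin := A.toLin ∘ₗ B.toLin
  supp_subset s := (A.supp_subset _).trans (B.supp_subset s)
  finite_order := by
    obtain ⟨a, ha⟩ := A.finite_order
    obtain ⟨b, hb⟩ := B.finite_order
    exact ⟨a + b, OrderLT.comp le_rfl ha hb⟩

/-- The operator acting between compactly supported sections. -/
def onC (A : DiffOp E E') : SecC E →ₗ[ℂ] SecC E' where
  toFun s := ⟨(A.toLin (toSec E s)).1, (A.toLin (toSec E s)).2,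
    s.2.2.of_isClosed_subset isClosed_closure (A.supp_subset (toSec E s))⟩
  map_add' s t := by ext1; simp
  map_smul' c s := by ext1; simp

/-- A smooth fibrewise linear map, as a differential operator of order zero. -/
def ofFiberwise (T : ∀ x, E.V x →ₗ[ℂ] E'.V x)
    (hT : ∀ s, IsSmooth E s → IsSmooth E' (fun x => T x (s x))) : DiffOp E E' where
  toLin :=
    { toFun := fun s => ⟨fun x => T x (s.1 x), hT s.1 s.2⟩
      map_add' := fun s t => Subtype.ext (funext fun x => (T x).map_add (s.1 x) (t.1 x))
      map_smul' := fun c s => Subtype.ext (funext fun x => (T x).map_smul c (s.1 x)) }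
  supp_subset s := closure_mono fun x hx h => hx (by
    change T x (s.1 x) = 0
    rw [h, map_zero])
  finite_order := ⟨1, fun f => by
    change _ = _
    ext s x
    simp [comm, mulSec]⟩

end DiffOp

/-! ### Direct sums of hermitian bundles -/

theorem contMDiff_prod_iff {E₁ : HermBundle.{u, v₁} n M} {E₂ : HermBundle.{u, v₂} n M}
    (s : ∀ x, E₁.V x × E₂.V x) :
    ContMDiff (𝓡 n) ((𝓡 n).prod 𝓘(ℝ, E₁.F × E₂.F)) ∞
      (fun x => TotalSpace.mk' (E₁.F × E₂.F) (E := E₁.V ×ᵇ E₂.V) x (s x)) ↔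
    IsSmooth E₁ (fun x => (s x).1) ∧ IsSmooth E₂ (fun x => (s x).2) := by
  rw [isSmooth_iff, isSmooth_iff, ← forall_and]
  refine forall_congr' fun x₀ => ?_
  rw [contMDiffAt_section]
  exact contMDiffAt_prod_module_iff _

/-- The direct sum `E₁ ⊕ E₂`, with the direct sum hermitian form. -/
def HermBundle.prod (E₁ : HermBundle.{u, v₁} n M) (E₂ : HermBundle.{u, v₂} n M) :
    HermBundle.{u, max v₁ v₂} n M where
  F := E₁.F × E₂.F
  V := E₁.V ×ᵇ E₂.V
  complexBundle := VectorBundle.prod ℂ E₁.F E₁.V E₂.F E₂.V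
  realBundle := VectorBundle.prod ℝ E₁.F E₁.V E₂.F E₂.V
  smoothBundle := Bundle.Prod.contMDiffVectorBundle E₁.F E₁.V E₂.F E₂.V
  form x := LinearMap.mk₂'ₛₗ (starRingEnd ℂ) (RingHom.id ℂ)
    (fun (v w : E₁.V x × E₂.V x) => E₁.form x v.1 w.1 + E₂.form x v.2 w.2)
    (by intros; simp; abel) (by intros; simp [mul_add]) (by intros; simp; abel)
    (by intros; simp [mul_add])
  form_symm x v w := by
    simpa using congrArg₂ (· + ·) (E₁.form_symm x v.1 w.1) (E₂.form_symm x v.2 w.2)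
  form_nondeg x v h := by
    refine Prod.ext (E₁.form_nondeg x v.1 fun w => ?_) (E₂.form_nondeg x v.2 fun w => ?_)
    · simpa using h (w, 0)
    · simpa using h (0, w)
  form_smooth s t hs ht := by
    have hs' := (contMDiff_prod_iff s).1 hs
    have ht' := (contMDiff_prod_iff t).1 ht
    exact (E₁.form_smooth _ _ hs'.1 ht'.1).add (E₂.form_smooth _ _ hs'.2 ht'.2)

/-- The trivial line bundle with its standard hermitian form. -/
def HermBundle.line (n : ℕ) (M : Type u) [TopologicalSpace M]
    [ChartedSpace (EuclideanSpace ℝ (Fin n)) M] : HermBundle.{u, 0} n M where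
  F := ℂ
  V := Bundle.Trivial M ℂ
  addCommGroup := fun _ => inferInstanceAs (AddCommGroup ℂ)
  module := fun _ => inferInstanceAs (Module ℂ ℂ)
  complexBundle := Bundle.Trivial.vectorBundle ℂ M ℂ
  realBundle := Bundle.Trivial.vectorBundle ℝ M ℂ
  smoothBundle := Bundle.Trivial.contMDiffVectorBundle ℂ
  form x := LinearMap.mk₂'ₛₗ (starRingEnd ℂ) (RingHom.id ℂ) (fun (v w : ℂ) => star v * w)
    (by intros; simp [add_mul]) (by intros; simp [mul_assoc]) (by intros; simp [mul_add])
    (by intros; simp [mul_left_comm])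
  form_symm := fun x (v w : ℂ) => show star (star v * w) = star w * v by simp [mul_comm]
  form_nondeg := fun x (v : ℂ) h => by
    have : star v * v = 0 := h v
    simpa using this
  form_smooth s t hs ht := by
    have h (f : M → ℂ) (hf : ContMDiff (𝓡 n) ((𝓡 n).prod 𝓘(ℝ, ℂ)) ∞
        (fun x => TotalSpace.mk' ℂ (E := Bundle.Trivial M ℂ) x (f x))) :
        ContMDiff (𝓡 n) 𝓘(ℝ, ℂ) ∞ f := fun x => (contMDiffAt_section x).1 (hf x)
    have h1 := h s hs
    have h2 := h t ht
    have hb : ContDiff ℝ ∞ (fun p : ℂ × ℂ => star p.1 * p.2) :=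
      (Complex.conjCLE.contDiff.comp contDiff_fst).mul contDiff_snd
    exact hb.contMDiff.comp (h1.prodMk_space h2)

section Components

variable (E₁ : HermBundle.{u, v₁} n M) (E₂ : HermBundle.{u, v₂} n M)

/-- The projections from and inclusions into a direct sum. -/
def fstOp : DiffOp (E₁.prod E₂) E₁ :=
  DiffOp.ofFiberwise (E := E₁.prod E₂) (fun x => (LinearMap.fst ℂ (E₁.V x) (E₂.V x) : _)) fun s hs =>
    ((contMDiff_prod_iff (E₁ := E₁) (E₂ := E₂) s).1 hs).1

def sndOp : DiffOp (E₁.prod E₂) E₂ :=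
  DiffOp.ofFiberwise (E := E₁.prod E₂) (fun x => (LinearMap.snd ℂ (E₁.V x) (E₂.V x) : _)) fun s hs =>
    ((contMDiff_prod_iff (E₁ := E₁) (E₂ := E₂) s).1 hs).2

def inlOp : DiffOp E₁ (E₁.prod E₂) :=
  DiffOp.ofFiberwise (E' := E₁.prod E₂) (fun x => (LinearMap.inl ℂ (E₁.V x) (E₂.V x) : _)) fun s hs =>
    (contMDiff_prod_iff (E₁ := E₁) (E₂ := E₂) (fun x => LinearMap.inl ℂ (E₁.V x) (E₂.V x) (s x))).2
      ⟨hs, (Sec E₂).zero_mem⟩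

def inrOp : DiffOp E₂ (E₁.prod E₂) :=
  DiffOp.ofFiberwise (E' := E₁.prod E₂) (fun x => (LinearMap.inr ℂ (E₁.V x) (E₂.V x) : _)) fun s hs =>
    (contMDiff_prod_iff (E₁ := E₁) (E₂ := E₂) (fun x => LinearMap.inr ℂ (E₁.V x) (E₂.V x) (s x))).2
      ⟨(Sec E₁).zero_mem, hs⟩

end Components

/-! ### Gradings -/

/-- A grading `E = ⨁_{i ∈ I} E_[i]` of a vector bundle, given by its smooth projections. -/
structure Grading (E : HermBundle.{u, v} n M) where
  idx : Finset ℤ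
  proj : ℤ → ∀ x, E.V x →ₗ[ℂ] E.V x
  proj_proj : ∀ i j x v, proj i x (proj j x v) = if i = j then proj j x v else 0
  proj_eq_zero : ∀ i, i ∉ idx → ∀ x v, proj i x v = 0
  sum_proj : ∀ x v, ∑ i ∈ idx, proj i x v = v
  smooth : ∀ i s, IsSmooth E s → IsSmooth E (fun x => proj i x (s x))

namespace Grading

/-- The bundle `E` placed in the single degree `d`. -/
def single (E : HermBundle.{u, v} n M) (d : ℤ) : Grading E where
  idx := {d}
  proj i x := if i = d then LinearMap.id else 0
  proj_proj i j x v := by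
    by_cases h : i = j
    · subst h; by_cases h' : i = d <;> simp [h']
    · by_cases h' : i = d
      · have : j ≠ d := fun h2 => h (h'.trans h2.symm)
        simp [h, this]
      · simp [h, h']
  proj_eq_zero i hi x v := by
    have : i ≠ d := by simpa using hi
    simp [this]
  sum_proj x v := by simp
  smooth i s hs := by
    by_cases h : i = d
    · simpa [h] using hs
    · simp only [h, if_false]
      exact (Sec E).zero_mem

/-- The direct sum of two graded bundles. -/
def prod {E₁ : HermBundle.{u, v₁} n M} {E₂ : HermBundle.{u, v₂} n M} (g₁ : Grading E₁)
    (g₂ : Grading E₂) : Grading (E₁.prod E₂) where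
  idx := g₁.idx ∪ g₂.idx
  proj i x := ((g₁.proj i x).prodMap (g₂.proj i x) : E₁.V x × E₂.V x →ₗ[ℂ] E₁.V x × E₂.V x)
  proj_proj i j x := fun (v : E₁.V x × E₂.V x) => by
    have h1 := g₁.proj_proj i j x v.1
    have h2 := g₂.proj_proj i j x v.2
    by_cases h : i = j
    · rw [if_pos h] at h1 h2 ⊢
      exact Prod.ext h1 h2
    · rw [if_neg h] at h1 h2 ⊢
      exact Prod.ext h1 h2
  proj_eq_zero i hi x := fun (v : E₁.V x × E₂.V x) => by
    rw [Finset.mem_union, not_or] at hi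
    exact (Prod.ext (g₁.proj_eq_zero i hi.1 x v.1) (g₂.proj_eq_zero i hi.2 x v.2) :
      ((g₁.proj i x v.1, g₂.proj i x v.2) : E₁.V x × E₂.V x) = 0)
  sum_proj x := fun (v : E₁.V x × E₂.V x) => by
    have h1 : ∑ i ∈ g₁.idx ∪ g₂.idx, g₁.proj i x v.1 = v.1 := by
      rw [← Finset.sum_subset Finset.subset_union_left
        (fun i _ hi => g₁.proj_eq_zero i hi x v.1)]
      exact g₁.sum_proj x v.1
    have h2 : ∑ i ∈ g₁.idx ∪ g₂.idx, g₂.proj i x v.2 = v.2 := by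
      rw [← Finset.sum_subset Finset.subset_union_right
        (fun i _ hi => g₂.proj_eq_zero i hi x v.2)]
      exact g₂.sum_proj x v.2
    have h3 : ∑ i ∈ g₁.idx ∪ g₂.idx,
        ((g₁.proj i x v.1, g₂.proj i x v.2) : E₁.V x × E₂.V x) = v := by
      refine Prod.ext ?_ ?_
      · rw [Prod.fst_sum]; exact h1
      · rw [Prod.snd_sum]; exact h2
    exact h3
  smooth i s hs := by
    have h := (contMDiff_prod_iff (E₁ := E₁) (E₂ := E₂) s).1 hs
    exact (contMDiff_prod_iff (E₁ := E₁) (E₂ := E₂)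
      (fun x => (g₁.proj i x (s x).1, g₂.proj i x (s x).2))).2
      ⟨g₁.smooth i _ h.1, g₂.smooth i _ h.2⟩

/-- The section `s` takes values in `E_[i]`. -/
def HasDegree {E : HermBundle.{u, v} n M} (gr : Grading E) (i : ℤ) (s : ∀ x, E.V x) : Prop :=
  ∀ x, gr.proj i x (s x) = s x

/-- `Γ_c(M;E_[i])` as a subspace of `Γ_c(M;E)`. -/
def degC {E : HermBundle.{u, v} n M} (gr : Grading E) (i : ℤ) : Submodule ℂ (SecC E) where
  carrier := {u | gr.HasDegree i u.1}
  zero_mem' x := map_zero (gr.proj i x)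
  add_mem' {s t} hs ht x := (map_add (gr.proj i x) (s.1 x) (t.1 x)).trans
    (congrArg₂ (· + ·) (hs x) (ht x))
  smul_mem' c s hs x := (map_smul (gr.proj i x) c (s.1 x)).trans (congrArg (c • ·) (hs x))

end Grading

/-! ### Spacetimes -/

variable [IsManifold (𝓡 n) ∞ M]

variable (n M) in
/-- A time-oriented Lorentzian manifold, signature `(-,+,…,+)`; the time orientation is given
by a smooth timelike vector field. -/
structure Spacetime where
  metric : ∀ x : M, TangentSpace (𝓡 n) x →L[ℝ] TangentSpace (𝓡 n) x →L[ℝ] ℝ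
  metric_smooth : ContMDiff (𝓡 n) ((𝓡 n).prod 𝓘(ℝ, EuclideanSpace ℝ (Fin n) →L[ℝ]
      EuclideanSpace ℝ (Fin n) →L[ℝ] ℝ)) ∞
    (fun x => TotalSpace.mk' (EuclideanSpace ℝ (Fin n) →L[ℝ] EuclideanSpace ℝ (Fin n) →L[ℝ] ℝ)
      (E := fun x : M => TangentSpace (𝓡 n) x →L[ℝ] TangentSpace (𝓡 n) x →L[ℝ] ℝ) x (metric x))
  metric_symm : ∀ x v w, metric x v w = metric x w v
  time : ∀ x : M, TangentSpace (𝓡 n) x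
  time_smooth : ContMDiff (𝓡 n) ((𝓡 n).prod 𝓘(ℝ, EuclideanSpace ℝ (Fin n))) ∞
    (fun x => TotalSpace.mk' (EuclideanSpace ℝ (Fin n)) (E := TangentSpace (𝓡 n) (M := M))
      x (time x))
  time_neg : ∀ x, metric x (time x) (time x) < 0
  space_pos : ∀ x v, metric x (time x) v = 0 → v ≠ 0 → 0 < metric x v v

namespace Spacetime

variable (S : Spacetime n M)

/-- Future-directed causal tangent vectors. -/
def IsFutureCausal (x : M) (v : TangentSpace (𝓡 n) x) : Prop :=
  v ≠ 0 ∧ S.metric x v v ≤ 0 ∧ S.metric x (S.time x) v < 0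

/-- There is a future-directed causal `C¹` curve from `p` to `q`. -/
def CausalCurve (p q : M) : Prop :=
  ∃ c : ℝ → M, c 0 = p ∧ c 1 = q ∧ ContMDiffOn 𝓘(ℝ, ℝ) (𝓡 n) 1 c (Icc 0 1) ∧
    ∀ t ∈ Icc (0 : ℝ) 1,
      S.IsFutureCausal (c t) (mfderivWithin 𝓘(ℝ, ℝ) (𝓡 n) c (Icc 0 1) t (1 : ℝ))

/-- `q ∈ J⁺(p)`: `p = q`, or there is a piecewise `C¹` future-directed causal curve from `p`
to `q`. -/
def CausalLE : M → M → Prop := Relation.ReflTransGen S.CausalCurve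

/-- The causal future `J⁺(A)`. -/
def future (A : Set M) : Set M := {q | ∃ p ∈ A, S.CausalLE p q}

/-- The causal past `J⁻(A)`. -/
def past (A : Set M) : Set M := {q | ∃ p ∈ A, S.CausalLE q p}

/-- Global hyperbolicity: no closed causal curves, and compact causal diamonds. -/
def GloballyHyperbolic : Prop :=
  (∀ p, ¬ Relation.TransGen S.CausalCurve p p) ∧
    ∀ p q, IsCompact {r | S.CausalLE p r ∧ S.CausalLE r q}

/-- The density `|det g_{ij}|^{1/2}` in the chart at `x₀`, at the point with coordinates `y`. -/
def density (x₀ : M) (y : EuclideanSpace ℝ (Fin n)) : ℝ :=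
  let p := (extChartAt (𝓡 n) x₀).symm y
  let b (i : Fin n) : TangentSpace (𝓡 n) p :=
    mfderiv 𝓘(ℝ, EuclideanSpace ℝ (Fin n)) (𝓡 n) (extChartAt (𝓡 n) x₀).symm y
      (EuclideanSpace.single i (1 : ℝ))
  Real.sqrt |(Matrix.of fun i j => S.metric p (b i) (b j)).det|

variable [MeasurableSpace M]

/-- The measure `|det g_{ij}|^{1/2} dy` of the chart at `x₀`. -/
def chartVol (x₀ : M) : Measure M :=
  ((volume.restrict (extChartAt (𝓡 n) x₀).target).withDensity
    fun y => ENNReal.ofReal (S.density x₀ y)).map (extChartAt (𝓡 n) x₀).symm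

variable [T2Space M] [SigmaCompactSpace M]

variable (n M) in
/-- A smooth partition of unity subordinate to the charts. -/
def partition : SmoothPartitionOfUnity M (𝓡 n) M univ :=
  (SmoothPartitionOfUnity.exists_isSubordinate_chartAt_source (𝓡 n) M).choose

/-- The volume measure `dVol_g`, glued from the charts with a partition of unity (the result
does not depend on its choice). -/
def vol : Measure M :=
  Measure.sum fun x₀ : M =>
    (S.chartVol x₀).withDensity fun x => ENNReal.ofReal (partition n M x₀ x)

end Spacetime

/-! ### The hermitian pairing, formal adjoints, Green hyperbolic operators -/

section Pairing

variable [MeasurableSpace M] [T2Space M] [SigmaCompactSpace M] (S : Spacetime n M)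

/-- The pairing `(u|v)_E = ∫_M (u(x),v(x))_E dVol_g`. -/
def pair (E : HermBundle.{u, v} n M) (s t : ∀ x, E.V x) : ℂ := ∫ x, E.form x (s x) (t x) ∂S.vol

/-- `B` is the formal adjoint of `A`: `(A u|v) = (u|B v)` for compactly supported `u`, `v`. -/
def IsFormalAdjoint {E : HermBundle.{u, v₁} n M} {E' : HermBundle.{u, v₂} n M} (A : DiffOp E E')
    (B : DiffOp E' E) : Prop :=
  ∀ (s : SecC E) (t : SecC E'), pair S E' (A.onC s).1 t.1 = pair S E s.1 (B.onC t).1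

open Classical in
/-- The formal adjoint `A*` of a differential operator (it exists and is unique). -/
def adj {E : HermBundle.{u, v₁} n M} {E' : HermBundle.{u, v₂} n M} (A : DiffOp E E') :
    DiffOp E' E :=
  if h : ∃ B, IsFormalAdjoint S A B then h.choose else 0

end Pairing

/-- `G : Γ_c(M;E) → Γ(M;E)` is a two-sided inverse of `D` with `supp G u ⊆ J (supp u)`. -/
structure IsPropagator {E : HermBundle.{u, v} n M} (J : Set M → Set M) (D : DiffOp E E)
    (G : SecC E →ₗ[ℂ] Sec E) : Prop where
  right_inv : ∀ s, D.toLin (G s) = toSec E s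
  left_inv : ∀ s, G (D.onC s) = toSec E s
  supp_subset : ∀ s, supp (G s).1 ⊆ J (supp s.1)

/-- `D` has retarded and advanced propagators. -/
def HasPropagators (S : Spacetime n M) {E : HermBundle.{u, v} n M} (D : DiffOp E E) : Prop :=
  (∃ G, IsPropagator S.future D G) ∧ ∃ G, IsPropagator S.past D G

open Classical in
/-- The propagator of `D` with support in `J`, if it exists. -/
def propagator {E : HermBundle.{u, v} n M} (J : Set M → Set M) (D : DiffOp E E) :
    SecC E →ₗ[ℂ] Sec E :=
  if h : ∃ G, IsPropagator J D G then h.choose else 0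

/-- The causal propagator `G_D = G_D⁺ - G_D⁻` (retarded minus advanced). -/
def causalPropagator (S : Spacetime n M) {E : HermBundle.{u, v} n M} (D : DiffOp E E) :
    SecC E →ₗ[ℂ] Sec E :=
  propagator S.future D - propagator S.past D

/-- `D` is Green hyperbolic: `D` and `D*` have retarded and advanced propagators. -/
def IsGreenHyperbolic [MeasurableSpace M] [T2Space M] [SigmaCompactSpace M] (S : Spacetime n M)
    {E : HermBundle.{u, v} n M} (D : DiffOp E E) : Prop :=
  HasPropagators S D ∧ HasPropagators S (adj S D)

/-! ### Continuity -/

/-- Convergence to zero in the Fréchet space `Γ(M;E)`: all scalar differential operators applied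
to the sequence converge to zero uniformly on compact sets. -/
def TendstoZero {E : HermBundle.{u, v} n M} (s : ℕ → Sec E) : Prop :=
  ∀ (A : DiffOp E (HermBundle.line n M)) (C : Set M), IsCompact C →
    TendstoUniformlyOn (fun k => ((A.toLin (s k)).1 : M → ℂ)) (fun _ => 0) atTop C

/-- Continuity of a linear map `Γ_c(M;E) → Γ(M;E')`. (`Γ_c` is a strict inductive limit of
Fréchet spaces, so that continuity is the same as sequential continuity at zero on each of them.) -/
def IsContinuousOp {E : HermBundle.{u, v₁} n M} {E' : HermBundle.{u, v₂} n M}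
    (T : SecC E →ₗ[ℂ] Sec E') : Prop :=
  ∀ s : ℕ → SecC E, (∃ C, IsCompact C ∧ ∀ k, supp (s k).1 ⊆ C) →
    TendstoZero (fun k => toSec E (s k)) → TendstoZero (fun k => T (s k))

/-! ### Wave front sets and the Hadamard condition -/

variable (n M) in
/-- The cotangent bundle, as a set of pairs `(x, ξ)` with `ξ ∈ T*_x M`. -/
abbrev Cotangent := Σ x : M, TangentSpace (𝓡 n) x →L[ℝ] ℝ


/-- The oscillating section `y ↦ exp(i⟨ξ, κ(y)⟩) s(y)`, where `κ` is the chart at `x₀`, whose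
differential at `x₀` is the identity of `T_{x₀}M`, and `s` is supported in the chart domain. -/
def osc {E : HermBundle.{u, v} n M} (x₀ : M) (ξ : TangentSpace (𝓡 n) x₀ →L[ℝ] ℝ) (s : SecC E)
    (hs : supp s.1 ⊆ (extChartAt (𝓡 n) x₀).source) : SecC E :=
  ⟨fun y => Complex.exp (Complex.I *
      (((ξ : EuclideanSpace ℝ (Fin n) →L[ℝ] ℝ) (extChartAt (𝓡 n) x₀ y) : ℝ) : ℂ)) • s.1 y, by
    refine ⟨isSmooth_iff.2 fun y => ?_, s.2.2.of_isClosed_subset isClosed_closure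
      (supp_mul_subset _ _)⟩
    by_cases hy : y ∈ supp s.1
    · refine smul_smooth_at ?_ (isSmooth_iff.1 s.2.1 y)
      have h1 : ContMDiffAt (𝓡 n) 𝓘(ℝ, EuclideanSpace ℝ (Fin n)) ∞ (extChartAt (𝓡 n) x₀) y :=
        contMDiffAt_extChartAt' (by simpa using hs hy)
      have h2 : ContDiff ℝ ∞ (fun z : EuclideanSpace ℝ (Fin n) => Complex.exp (Complex.I *
          (((ξ : EuclideanSpace ℝ (Fin n) →L[ℝ] ℝ) z : ℝ) : ℂ))) := by
        have h3 : ContDiff ℝ ∞ (fun z => (id ξ : EuclideanSpace ℝ (Fin n) →L[ℝ] ℝ) z) :=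
          ContinuousLinearMap.contDiff (𝕜 := ℝ) (E := EuclideanSpace ℝ (Fin n)) (F := ℝ) _
        exact (contDiff_const.mul (Complex.ofRealCLM.contDiff.comp h3)).cexp
      exact h2.contMDiff.contMDiffAt.comp y h1
    · have h0 := isSmooth_iff.1 (Sec E).zero_mem y
      refine h0.congr_of_eventuallyEq ?_
      filter_upwards [(isClosed_closure (s := {x | s.1 x ≠ 0})).isOpen_compl.mem_nhds hy] with z hz
      have : s.1 z = 0 := by
        by_contra h
        exact hz (subset_closure h)
      simp [this]⟩

section WaveFront

variable [MeasurableSpace M] [T2Space M] [SigmaCompactSpace M] (S : Spacetime n M)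

/-- The operator `T` is microlocally smoothing at `((x,ξ),(y,η))`: with `K_T` its Schwartz kernel,
the localized Fourier transforms `(e^{iξ'·}s | T e^{iη'·}t)` of `K_T`, taken at `(ξ',-η')`, decay
rapidly in a conic neighbourhood of `(ξ,η)` for all cut-offs `s`, `t` supported near `x`, `y`. -/
def IsMicrosmooth {E : HermBundle.{u, v} n M} (T : SecC E →ₗ[ℂ] Sec E)
    (p q : Cotangent n M) : Prop :=
  ∃ U ∈ 𝓝 p.1, ∃ U' ∈ 𝓝 q.1, ∃ W ∈ 𝓝 (p.2, q.2), ∀ (s t : SecC E)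
    (hs : supp s.1 ⊆ (extChartAt (𝓡 n) p.1).source)
    (ht : supp t.1 ⊆ (extChartAt (𝓡 n) q.1).source), supp s.1 ⊆ U → supp t.1 ⊆ U' →
    ∀ N : ℕ, ∃ C : ℝ, ∀ w ∈ W, ∀ τ : ℝ, 1 ≤ τ →
      ‖pair S E (osc p.1 (τ • w.1) s hs).1 (T (osc q.1 (τ • w.2) t ht)).1‖ * τ ^ N ≤ C

/-- The primed wave front set `WF'(T) = {((x,ξ),(y,η)) : ((x,ξ),(y,-η)) ∈ WF(K_T)}`, a subset of
`T*(M × M)` without the zero section. -/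
def WFprime {E : HermBundle.{u, v} n M} (T : SecC E →ₗ[ℂ] Sec E) :
    Set (Cotangent n M × Cotangent n M) :=
  {z | (z.1.2 ≠ 0 ∨ z.2.2 ≠ 0) ∧ ¬ IsMicrosmooth S T z.1 z.2}

end WaveFront

/-- `N⁺`: nonzero null covectors of positive energy, `ξ = g(v,·)` with `v` future-directed. -/
def nullPos (S : Spacetime n M) : Set (Cotangent n M) :=
  {p | ∃ v : TangentSpace (𝓡 n) p.1, v ≠ 0 ∧ S.metric p.1 v v = 0 ∧
    S.metric p.1 (S.time p.1) v < 0 ∧ p.2 = S.metric p.1 v}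

/-- `N⁻`: nonzero null covectors of negative energy, `ξ = g(v,·)` with `v` past-directed. -/
def nullNeg (S : Spacetime n M) : Set (Cotangent n M) :=
  {p | ∃ v : TangentSpace (𝓡 n) p.1, v ≠ 0 ∧ S.metric p.1 v v = 0 ∧
    0 < S.metric p.1 (S.time p.1) v ∧ p.2 = S.metric p.1 v}

section TwoPoint

variable [MeasurableSpace M] [T2Space M] [SigmaCompactSpace M] (S : Spacetime n M)

/-- Conditions i)-iv) for one member `λ^±` of a pair of two-point functions. -/
structure IsTwoPointPart {E : HermBundle.{u, v} n M} (gr : Grading E) (D : DiffOp E E)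
    (l : SecC E →ₗ[ℂ] Sec E) : Prop where
  continuous : IsContinuousOp l
  herm : ∀ s t : SecC E, pair S E s.1 (l t).1 = pair S E (l s).1 t.1
  eom : ∀ s, l (D.onC s) = 0
  degree : ∀ i ∈ gr.idx, ∀ s : SecC E, gr.HasDegree i s.1 → gr.HasDegree (-i) (l s).1

/-- `λ^±` are bosonic two-point functions for the (Green hyperbolic) operator `D`. The last field is
`λ⁺ - (-1)^gh λ⁻ = i⁻¹ G_D`, where the block of `(-1)^gh λ⁻` from `E_[j]` to `E_[i]` is
`(-1)^{ij}` times that of `λ⁻`. -/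
structure IsBosonicTwoPoint {E : HermBundle.{u, v} n M} (gr : Grading E) (D : DiffOp E E)
    (lp lm : SecC E →ₗ[ℂ] Sec E) : Prop where
  green : IsGreenHyperbolic S D
  pos : IsTwoPointPart S gr D lp
  neg : IsTwoPointPart S gr D lm
  ccr : ∀ i ∈ gr.idx, ∀ j ∈ gr.idx, ∀ s : SecC E, gr.HasDegree j s.1 → ∀ x,
    gr.proj i x ((lp s).1 x) - (-1 : ℂ) ^ (i * j) • gr.proj i x ((lm s).1 x) =
      Complex.I⁻¹ • gr.proj i x ((causalPropagator S D s).1 x)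

/-- The Hadamard condition `WF'(λ^±) = (N^± × N^±) ∩ WF'(G_D)`. -/
def IsHadamard {E : HermBundle.{u, v} n M} (D : DiffOp E E) (lp lm : SecC E →ₗ[ℂ] Sec E) : Prop :=
  WFprime S lp = (nullPos S ×ˢ nullPos S) ∩ WFprime S (causalPropagator S D) ∧
  WFprime S lm = (nullNeg S ×ˢ nullNeg S) ∩ WFprime S (causalPropagator S D)

end TwoPoint

/-! ### The subsidiary condition framework and the BRST framework -/

section Frameworks

variable [MeasurableSpace M] [T2Space M] [SigmaCompactSpace M] (S : Spacetime n M)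

/-- The hypotheses of the subsidiary condition framework for `P`, `K`, `T`. -/
structure IsSubsidiary {V₀ : HermBundle.{u, v₁} n M} {V₁ : HermBundle.{u, v₂} n M}
    (P : DiffOp V₁ V₁) (K T : DiffOp V₀ V₁) : Prop where
  selfadj : IsFormalAdjoint S P P
  K_ne : K.toLin ≠ 0
  PK : P.toLin ∘ₗ K.toLin = 0
  green_R : IsGreenHyperbolic S ((adj S K).comp K)
  green_D : IsGreenHyperbolic S (P + T.comp (adj S K))
  green_Q : IsGreenHyperbolic S ((adj S K).comp T)

/-- The hypotheses of the BRST framework: a hermitian graded bundle `E`, a codifferential `γ` and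
an operator `L`. -/
structure IsBRST {E : HermBundle.{u, v} n M} (gr : Grading E) (L γ : DiffOp E E) : Prop where
  idx_eq : gr.idx = {-1, 0, 1}
  orthogonal : ∀ i j, i ≠ j → ∀ x v w, E.form x (gr.proj i x v) (gr.proj j x w) = 0
  γ_sq : γ.toLin ∘ₗ γ.toLin = 0
  γ_degree : ∀ i ∈ gr.idx, ∀ s : Sec E, gr.HasDegree i s.1 →
    gr.HasDegree (i - 1) (γ.toLin s).1
  homology : ∀ s : SecC E, gr.HasDegree (-1) s.1 → γ.onC s = 0 → ∃ t, γ.onC t = s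
  L_green : IsGreenHyperbolic S L
  L_selfadj : IsFormalAdjoint S L L
  L_γ : (adj S γ).toLin ∘ₗ L.toLin = L.toLin ∘ₗ γ.toLin
  L_degree : ∀ i ∈ gr.idx, ∀ s : Sec E, gr.HasDegree i s.1 → gr.HasDegree (-i) (L.toLin s).1

/-- `Ker γ*|_{Γ_c(M;E_[0])}`. -/
def physKer {E : HermBundle.{u, v} n M} (gr : Grading E) (γ : DiffOp E E) :
    Submodule ℂ (SecC E) :=
  LinearMap.ker (adj S γ).onC ⊓ gr.degC 0

/-- `(Ran γ*|_{Γ_c} + (Ran L|_{Γ_c} ∩ Ker γ*|_{Γ_c})) ∩ Γ_c(M;E_[0])`. -/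
def gaugeRan {E : HermBundle.{u, v} n M} (gr : Grading E) (L γ : DiffOp E E) :
    Submodule ℂ (SecC E) :=
  (LinearMap.range (adj S γ).onC ⊔
    (LinearMap.range L.onC ⊓ LinearMap.ker (adj S γ).onC)) ⊓ gr.degC 0

/-- The vector space `𝒱` of the classical phase space. -/
abbrev PhaseSpace {E : HermBundle.{u, v} n M} (gr : Grading E) (L γ : DiffOp E E) :=
  physKer S gr γ ⧸ (gaugeRan S gr L γ).comap (physKer S gr γ).subtype

end Frameworks

end Bundles

/-! ### The polynomial CCR algebra and its quasi-free states -/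

/-- A hermitian form on a complex vector space, antilinear in the first argument. -/
structure HermForm (𝒱 : Type v) [AddCommGroup 𝒱] [Module ℂ 𝒱] where
  form : 𝒱 →ₗ⋆[ℂ] 𝒱 →ₗ[ℂ] ℂ
  symm : ∀ v w, star (form v w) = form w v

/-- The generators `ψ(v)`, `ψ*(v)`. -/
inductive CCRGen (𝒱 : Type v) : Type v
  | ann (v : 𝒱)
  | cre (v : 𝒱)

/-- Exchange of `ψ(v)` and `ψ*(v)`. -/
def CCRGen.swap {𝒱 : Type v} : CCRGen 𝒱 → CCRGen 𝒱
  | ann v => cre v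
  | cre v => ann v

namespace CCR

variable {𝒱 : Type v}

/-- The antilinear antihomomorphism of the free algebra exchanging `ψ` and `ψ*`. -/
def preStar : FreeAlgebra ℂ (CCRGen 𝒱) →+* (FreeAlgebra ℂ (CCRGen 𝒱))ᵐᵒᵖ :=
  letI : Algebra ℂ (FreeAlgebra ℂ (CCRGen 𝒱))ᵐᵒᵖ := Algebra.compHom _ (starRingEnd ℂ)
  (FreeAlgebra.lift ℂ fun g => MulOpposite.op (FreeAlgebra.ι ℂ g.swap)).toRingHom

theorem preStar_ι (g : CCRGen 𝒱) :
    preStar (FreeAlgebra.ι ℂ g) = MulOpposite.op (FreeAlgebra.ι ℂ g.swap) := by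
  let _ : Algebra ℂ (FreeAlgebra ℂ (CCRGen 𝒱))ᵐᵒᵖ := Algebra.compHom _ (starRingEnd ℂ)
  exact FreeAlgebra.lift_ι_apply _ g

theorem preStar_algebraMap (c : ℂ) :
    preStar (algebraMap ℂ (FreeAlgebra ℂ (CCRGen 𝒱)) c) =
      MulOpposite.op (algebraMap ℂ (FreeAlgebra ℂ (CCRGen 𝒱)) (star c)) := by
  let _ : Algebra ℂ (FreeAlgebra ℂ (CCRGen 𝒱))ᵐᵒᵖ := Algebra.compHom _ (starRingEnd ℂ)
  exact AlgHom.commutes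
    (FreeAlgebra.lift ℂ fun g : CCRGen 𝒱 => MulOpposite.op (FreeAlgebra.ι ℂ g.swap)) c

theorem preStar_preStar (a : FreeAlgebra ℂ (CCRGen 𝒱)) :
    (preStar (preStar a).unop).unop = a := by
  induction a using FreeAlgebra.induction with
  | grade0 c => simp [preStar_algebraMap]
  | grade1 g => rw [preStar_ι, MulOpposite.unop_op, preStar_ι]; cases g <;> rfl
  | mul a b ha hb => simp [ha, hb]
  | add a b ha hb => simp [ha, hb]

end CCR

section CCR

variable {𝒱 : Type v} [AddCommGroup 𝒱] [Module ℂ 𝒱]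

open FreeAlgebra in
/-- The relations of the CCR algebra: `ψ` is antilinear, `ψ*` is linear, and
`[ψ(v),ψ(w)] = [ψ*(v),ψ*(w)] = 0`, `[ψ(v),ψ*(w)] = q(v,w) 1`. -/
inductive CCRRel (q : HermForm 𝒱) :
    FreeAlgebra ℂ (CCRGen 𝒱) → FreeAlgebra ℂ (CCRGen 𝒱) → Prop
  | ann_add (v w : 𝒱) : CCRRel q (ι ℂ (.ann (v + w))) (ι ℂ (.ann v) + ι ℂ (.ann w))
  | cre_add (v w : 𝒱) : CCRRel q (ι ℂ (.cre (v + w))) (ι ℂ (.cre v) + ι ℂ (.cre w))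
  | ann_smul (c : ℂ) (v : 𝒱) :
      CCRRel q (ι ℂ (.ann (c • v))) (algebraMap ℂ _ (star c) * ι ℂ (.ann v))
  | cre_smul (c : ℂ) (v : 𝒱) :
      CCRRel q (ι ℂ (.cre (c • v))) (algebraMap ℂ _ c * ι ℂ (.cre v))
  | ann_comm (v w : 𝒱) :
      CCRRel q (ι ℂ (.ann v) * ι ℂ (.ann w)) (ι ℂ (.ann w) * ι ℂ (.ann v))
  | cre_comm (v w : 𝒱) :
      CCRRel q (ι ℂ (.cre v) * ι ℂ (.cre w)) (ι ℂ (.cre w) * ι ℂ (.cre v))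
  | ccr (v w : 𝒱) :
      CCRRel q (ι ℂ (.ann v) * ι ℂ (.cre w))
        (ι ℂ (.cre w) * ι ℂ (.ann v) + algebraMap ℂ _ (q.form v w))

/-- The polynomial CCR algebra of `(𝒱, q)`. -/
def CCR (q : HermForm 𝒱) : Type v := RingQuot (CCRRel q)

namespace CCR

variable (q : HermForm 𝒱)

instance : Ring (CCR q) := inferInstanceAs (Ring (RingQuot (CCRRel q)))

instance : Algebra ℂ (CCR q) := inferInstanceAs (Algebra ℂ (RingQuot (CCRRel q)))

/-- The quotient map from the free algebra. -/
def mk : FreeAlgebra ℂ (CCRGen 𝒱) →ₐ[ℂ] CCR q := RingQuot.mkAlgHom ℂ (CCRRel q)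

/-- The abstract annihilation field `ψ(v)`. -/
def ann (v : 𝒱) : CCR q := mk q (FreeAlgebra.ι ℂ (.ann v))

/-- The abstract creation field `ψ*(v)`. -/
def cre (v : 𝒱) : CCR q := mk q (FreeAlgebra.ι ℂ (.cre v))

theorem mk_surjective : Function.Surjective (mk q) := RingQuot.mkAlgHom_surjective ℂ _

theorem mk_rel {a b : FreeAlgebra ℂ (CCRGen 𝒱)} (h : CCRRel q a b) : mk q a = mk q b :=
  RingQuot.mkAlgHom_rel ℂ h

theorem preStar_rel {a b : FreeAlgebra ℂ (CCRGen 𝒱)} (h : CCRRel q a b) :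
    mk q (preStar a).unop = mk q (preStar b).unop := by
  cases h with
  | ann_add v w => simpa [preStar_ι, CCRGen.swap] using mk_rel q (.cre_add v w)
  | cre_add v w => simpa [preStar_ι, CCRGen.swap] using mk_rel q (.ann_add v w)
  | ann_smul c v =>
    have := mk_rel q (.cre_smul c v)
    simp only [map_mul, preStar_ι, preStar_algebraMap, MulOpposite.unop_mul, MulOpposite.unop_op,
      CCRGen.swap, star_star, this, AlgHom.commutes]
    exact Algebra.commutes (R := ℂ) (A := CCR q) _ _
  | cre_smul c v =>
    have := mk_rel q (.ann_smul c v)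
    simp only [map_mul, preStar_ι, preStar_algebraMap, MulOpposite.unop_mul, MulOpposite.unop_op,
      CCRGen.swap, this, AlgHom.commutes]
    exact Algebra.commutes (R := ℂ) (A := CCR q) _ _
  | ann_comm v w => simpa [preStar_ι, CCRGen.swap] using mk_rel q (.cre_comm w v)
  | cre_comm v w => simpa [preStar_ι, CCRGen.swap] using mk_rel q (.ann_comm w v)
  | ccr v w =>
    have := mk_rel q (.ccr w v)
    simpa [preStar_ι, preStar_algebraMap, CCRGen.swap, ← q.symm v w] using this

/-- The involution of the CCR algebra, as a ring homomorphism to the opposite algebra. -/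
def starHom : CCR q →+* (CCR q)ᵐᵒᵖ :=
  RingQuot.lift ⟨(mk q).toRingHom.op.comp preStar, fun _ _ h =>
    congrArg MulOpposite.op (preStar_rel q h)⟩

theorem starHom_mk (a : FreeAlgebra ℂ (CCRGen 𝒱)) :
    starHom q (mk q a) = MulOpposite.op (mk q (preStar a).unop) := by
  have h : mk q a = RingQuot.mkRingHom (CCRRel q) a := by
    rw [mk, ← RingQuot.mkAlgHom_coe ℂ]; rfl
  rw [h]
  exact RingQuot.lift_mkRingHom_apply _ _ _

/-- The `*`-algebra structure, with `ψ(v)* = ψ*(v)`. -/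
instance : StarRing (CCR q) where
  star a := (starHom q a).unop
  star_involutive a := by
    obtain ⟨a, rfl⟩ := mk_surjective q a
    simp [starHom_mk, preStar_preStar]
  star_mul a b := by simp
  star_add a b := by simp

instance : StarModule ℂ (CCR q) where
  star_smul c a := by
    change (starHom q (c • a)).unop = star c • (starHom q a).unop
    rw [Algebra.smul_def, Algebra.smul_def, Algebra.commutes, ← (mk q).commutes c, map_mul,
      starHom_mk, preStar_algebraMap, MulOpposite.unop_mul]
    simp

theorem star_ann (v : 𝒱) : star (ann q v) = cre q v := by
  change (starHom q (mk q _)).unop = _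
  rw [starHom_mk, preStar_ι]; rfl

end CCR

/-- A state on the CCR algebra: a normalized positive linear functional. -/
structure State (q : HermForm 𝒱) where
  toLin : CCR q →ₗ[ℂ] ℂ
  map_one : toLin 1 = 1
  nonneg : ∀ a, 0 ≤ toLin (star a * a)

/-- Gauge-invariant quasi-free states: the expectation values of normally ordered products (which
span the algebra) are given by Wick's theorem,
`φ(ψ*(w₁)⋯ψ*(wₘ)ψ(v₁)⋯ψ(vₖ)) = δ_{mk} ∑_σ ∏_i φ(ψ*(w_{σ(i)})ψ(v_i))`. -/
def State.IsQuasiFree {q : HermForm 𝒱} (φ : State q) : Prop :=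
  (∀ (m k : ℕ) (w : Fin m → 𝒱) (v : Fin k → 𝒱), m ≠ k →
    φ.toLin ((List.ofFn fun i => CCR.cre q (w i)).prod *
      (List.ofFn fun i => CCR.ann q (v i)).prod) = 0) ∧
  ∀ (m : ℕ) (w v : Fin m → 𝒱),
    φ.toLin ((List.ofFn fun i => CCR.cre q (w i)).prod *
      (List.ofFn fun i => CCR.ann q (v i)).prod) =
    ∑ σ : Equiv.Perm (Fin m), ∏ i, φ.toLin (CCR.cre q (w (σ i)) * CCR.ann q (v i))

end CCR

/-! ### Hadamard states in the BRST framework -/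

section Final

variable {n : ℕ} {M : Type u} [TopologicalSpace M] [ChartedSpace (EuclideanSpace ℝ (Fin n)) M]
  [IsManifold (𝓡 n) ∞ M] [MeasurableSpace M] [T2Space M] [SigmaCompactSpace M]
  (S : Spacetime n M)

/-- `q` is the form of the classical phase space: `q([s],[t]) = i⁻¹ (s | G_L t)`. -/
def IsPhaseSpaceForm {E : HermBundle.{u, v} n M} (gr : Grading E) (L γ : DiffOp E E)
    (q : HermForm (PhaseSpace S gr L γ)) : Prop :=
  ∀ s t : physKer S gr γ, q.form (Submodule.Quotient.mk s) (Submodule.Quotient.mk t) =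
    Complex.I⁻¹ * pair S E s.1.1 (causalPropagator S L t.1).1

/-- `λ^±` are the two-point functions of the Hadamard state `φ` on the CCR algebra of the phase
space: `φ` is quasi-free, `λ^±` are Hadamard bosonic two-point functions for `L`, and the complex
covariances of `φ` are `φ(ψ[s]ψ*[t]) = (s|λ⁺t)` and `φ(ψ*[t]ψ[s]) = (s|λ⁻t)`. -/
structure IsHadamardState {E : HermBundle.{u, v} n M} (gr : Grading E) (L γ : DiffOp E E)
    (q : HermForm (PhaseSpace S gr L γ)) (φ : State q) (lp lm : SecC E →ₗ[ℂ] Sec E) : Prop where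
  quasiFree : φ.IsQuasiFree
  twoPoint : IsBosonicTwoPoint S gr L lp lm
  hadamard : IsHadamard S L lp lm
  cov_pos : ∀ s t : physKer S gr γ,
    φ.toLin (CCR.ann q (Submodule.Quotient.mk s) * CCR.cre q (Submodule.Quotient.mk t)) =
      pair S E s.1.1 (lp t.1).1
  cov_neg : ∀ s t : physKer S gr γ,
    φ.toLin (CCR.cre q (Submodule.Quotient.mk t) * CCR.ann q (Submodule.Quotient.mk s)) =
      pair S E s.1.1 (lm t.1).1

variable (V₁ : HermBundle.{u, v₁} n M) (V₀ : HermBundle.{u, v₂} n M)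

/-- The bundle `V = V₁ ⊕ V₀ ⊕ V₀ ⊕ V₀`, with sections `(f_a, f_b, f_c, f_c̄)`. -/
def totalBundle : HermBundle.{u, max v₁ v₂} n M := V₁.prod (V₀.prod (V₀.prod V₀))

/-- The ghost number grading: the summands have degrees `0, 0, 1, -1`. -/
def ghostGrading : Grading (totalBundle V₁ V₀) :=
  (Grading.single V₁ 0).prod ((Grading.single V₀ 0).prod
    ((Grading.single V₀ 1).prod (Grading.single V₀ (-1))))

/-- The projections `V → V₁`, `V → V₀` to the summands `a, b, c, c̄`. -/
def projA : DiffOp (totalBundle V₁ V₀) V₁ := fstOp _ _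
/-- Projection to the summand `b`. -/
def projB : DiffOp (totalBundle V₁ V₀) V₀ := (fstOp _ _).comp (sndOp _ _)
/-- Projection to the summand `c`. -/
def projC : DiffOp (totalBundle V₁ V₀) V₀ := (fstOp _ _).comp ((sndOp _ _).comp (sndOp _ _))
/-- Projection to the summand `c̄`. -/
def projD : DiffOp (totalBundle V₁ V₀) V₀ := (sndOp _ _).comp ((sndOp _ _).comp (sndOp _ _))
/-- Inclusion of the summand `a`. -/
def inclA : DiffOp V₁ (totalBundle V₁ V₀) := inlOp _ _
/-- Inclusion of the summand `b`. -/
def inclB : DiffOp V₀ (totalBundle V₁ V₀) := (inrOp _ _).comp (inlOp _ _)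
/-- Inclusion of the summand `c`. -/
def inclC : DiffOp V₀ (totalBundle V₁ V₀) := (inrOp _ _).comp ((inrOp _ _).comp (inlOp _ _))
/-- Inclusion of the summand `c̄`. -/
def inclD : DiffOp V₀ (totalBundle V₁ V₀) := (inrOp _ _).comp ((inrOp _ _).comp (inrOp _ _))

variable {V₁ V₀}

/-- The operator `L` with gauge parameter `α`: the block matrix
`((P, K, 0, 0), (K*, -α, 0, 0), (0, 0, 0, K*K), (0, 0, K*K, 0))`. -/
def brstL (P : DiffOp V₁ V₁) (K : DiffOp V₀ V₁) (α : ℝ) :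
    DiffOp (totalBundle V₁ V₀) (totalBundle V₁ V₀) :=
  (inclA V₁ V₀).comp (P.comp (projA V₁ V₀)) +
  (inclA V₁ V₀).comp (K.comp (projB V₁ V₀)) +
  (inclB V₁ V₀).comp ((adj S K).comp (projA V₁ V₀)) +
  DiffOp.smul (-(α : ℂ)) ((inclB V₁ V₀).comp (projB V₁ V₀)) +
  (inclC V₁ V₀).comp (((adj S K).comp K).comp (projD V₁ V₀)) +
  (inclD V₁ V₀).comp (((adj S K).comp K).comp (projC V₁ V₀))

/-- The operator `γ (f_a, f_b, f_c, f_c̄) = (K f_c, 0, 0, f_b)`. -/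
def brstGamma (K : DiffOp V₀ V₁) : DiffOp (totalBundle V₁ V₀) (totalBundle V₁ V₀) :=
  (inclA V₁ V₀).comp (K.comp (projC V₁ V₀)) + (inclD V₁ V₀).comp (projB V₁ V₀)

/-- The block matrix `((λ_D, Kλ_R, 0, 0), (λ_R K*, 0, 0, 0), (0, 0, 0, ελ_R), (0, 0, ελ_R, 0))`. -/
def brstTwoPoint (K : DiffOp V₀ V₁) (ε : ℂ) (lD : SecC V₁ →ₗ[ℂ] Sec V₁)
    (lR : SecC V₀ →ₗ[ℂ] Sec V₀) : SecC (totalBundle V₁ V₀) →ₗ[ℂ] Sec (totalBundle V₁ V₀) :=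
  (inclA V₁ V₀).toLin ∘ₗ lD ∘ₗ (projA V₁ V₀).onC +
  (inclA V₁ V₀).toLin ∘ₗ K.toLin ∘ₗ lR ∘ₗ (projB V₁ V₀).onC +
  (inclB V₁ V₀).toLin ∘ₗ lR ∘ₗ (adj S K).onC ∘ₗ (projA V₁ V₀).onC +
  ε • ((inclC V₁ V₀).toLin ∘ₗ lR ∘ₗ (projD V₁ V₀).onC) +
  ε • ((inclD V₁ V₀).toLin ∘ₗ lR ∘ₗ (projC V₁ V₀).onC)

end Final

end BRST

end

open BRST

set_option linter.unusedSectionVars false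

noncomputable section

namespace BRST

/-! Write D = P + KK*, R = K*K, and let B_ε(lD, lR) be the block operator `brstTwoPoint`. From PK =
0 and its adjoint K*P = 0 one gets DK = KR and RK* = K*D. If moreover K lR = lD K, multiplying out
gives B_ε(lD, lR) L = diag(lD D, lR R, ε lR R, ε lR R) (`brstTwoPoint_brstL`). Most of what is
needed about L follows from this identity.

Propagators. The retarded (or advanced) propagators of D and R are intertwined by K and K*, because
a solution of Dw = 0 with support in J^±(compact) vanishes (`IsPropagator.eq_zero_of_supp`,
`IsPropagator.intertwine`): one pairs it with the opposite propagator, and integration by parts is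
legitimate since J⁺(A) ∩ J⁻(B) is relatively compact for compact A, B. So B_1 of the propagators
inverts L (`isPropagator_brst`), L is Green hyperbolic and G_L = B_1(G_D, G_R)
(`causalPropagator_brstL`).

Two-point functions. Now B_ε L = 0. In the ghost blocks the sign (-1)^{ij} = -1 cancels the sign ε =
-1 of λ⁻, so the commutation relation for L is that of D and R (`isBosonicTwoPoint_brst`).

Hadamard condition. Every block is lD or lR composed with differential operators, and both lD and a
multiple of lR occur as corners. Hence WF'(B_ε(lD, lR)) = WF'(lD) ∪ WF'(lR), and the same formula
holds for G_L (`WFprime_brstTwoPoint`). The input is that differential operators do not enlarge WF'.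
Since WF' is defined by oscillating test sections, this amounts to expanding A(e^{iφ}s) as e^{iφ}
times a finite sum of iterated commutators, polynomial in the frequency (`OrderLT.exists_expansion`,
`DiffOp.exists_osc_expansion`).

Phase space. A physical section is (a, b, 0, 0) with K*a = 0. On two such sections (s | B_ε t)
reduces to (a | lD a'), so ghosts and signs disappear and positivity is exactly the hypothesis on
λ_D^±. The gauge part does not contribute: Ran L is annihilated, and Ran γ* has no a-component. Thus
λ_L^± descend to positive forms Λ^± on the phase space, with Λ⁺ - Λ⁻ = q (`exists_covariance`).

The state. Positive hermitian forms with Λ⁺ - Λ⁻ = q always come from a quasi-free state. On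
polynomials in two copies of a basis of 𝒱, let ψ(v) be the derivation given by Λ⁺(v, ·) plus
multiplication by the conjugate variable of v, and ψ*(v) the derivation given by Λ⁻(·, v) plus
multiplication by the variable of v. The state is the constant term of the result of acting on 1.
Wick's theorem is the Leibniz rule (`constantCoeff_creProd_prod`). For positivity, a given element
involves finitely many vectors, on which Λ^± are Gram forms (`exists_gram`); this maps the
polynomials to a finite-dimensional Fock space in which ψ and ψ* are adjoint to each other
(`freeRep_nonneg`). -/

theorem det_gram_ne_zero {n : ℕ} {V : Type*} [AddCommGroup V] [Module ℝ V]
    (g : V →ₗ[ℝ] V →ₗ[ℝ] ℝ) (hg : ∀ v, (∀ w, g w v = 0) → v = 0)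
    (e : EuclideanSpace ℝ (Fin n) ≃ₗ[ℝ] V) :
    (Matrix.of fun i j => g (e (EuclideanSpace.single i 1)) (e (EuclideanSpace.single j 1))).det
      ≠ 0 := by
  intro h0
  obtain ⟨c, hc, h⟩ := Matrix.exists_mulVec_eq_zero_iff.2 h0
  have hw : ∀ a : EuclideanSpace ℝ (Fin n), a = ∑ j, a j • EuclideanSpace.single j (1 : ℝ) := by
    intro a
    ext i
    simp [Finset.sum_apply, Pi.single_apply]
  have hmet (i : Fin n) : g (e (EuclideanSpace.single i (1 : ℝ))) (e (WithLp.toLp 2 c)) = 0 := by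
    have := congrFun h i
    simp only [Matrix.mulVec, dotProduct, Matrix.of_apply, Pi.zero_apply] at this
    rw [hw (WithLp.toLp 2 c), map_sum, map_sum, ← this]
    refine Finset.sum_congr rfl fun j _ => ?_
    rw [map_smul, map_smul, smul_eq_mul, mul_comm]
  have h2 : e (WithLp.toLp 2 c) = 0 := hg _ fun v => by
    obtain ⟨a, rfl⟩ := e.surjective v
    rw [hw a, map_sum, map_sum, LinearMap.sum_apply]
    refine Finset.sum_eq_zero fun j _ => ?_
    rw [map_smul, map_smul, LinearMap.smul_apply, hmet, smul_zero]
  have h3 : WithLp.toLp 2 c = 0 := e.injective (by rw [h2, map_zero])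
  exact hc (by simpa using congrArg WithLp.ofLp h3)

/-! ### The volume measure: positive on open sets, finite on compact sets. -/

section Geometry
variable {n : ℕ} {M : Type u} [TopologicalSpace M] [ChartedSpace (EuclideanSpace ℝ (Fin n)) M]
  [IsManifold (𝓡 n) ∞ M]

namespace Spacetime

variable (S : Spacetime n M)

/-- The tangent vector at the point with coordinates `y` in the chart at `x₀` whose coordinates
are `w`. -/
def chartVec (x₀ : M) (y w : EuclideanSpace ℝ (Fin n)) :
    TangentSpace (𝓡 n) ((extChartAt (𝓡 n) x₀).symm y) :=
  mfderiv 𝓘(ℝ, EuclideanSpace ℝ (Fin n)) (𝓡 n) (extChartAt (𝓡 n) x₀).symm y w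

theorem continuousOn_chartVec (x₀ : M) :
    ContinuousOn (fun p : EuclideanSpace ℝ (Fin n) × EuclideanSpace ℝ (Fin n) =>
      TotalSpace.mk' (EuclideanSpace ℝ (Fin n)) (E := TangentSpace (𝓡 n) (M := M))
        ((extChartAt (𝓡 n) x₀).symm p.1) (chartVec x₀ p.1 p.2))
      ((extChartAt (𝓡 n) x₀).target ×ˢ univ) := by
  have ht : IsOpen (extChartAt (𝓡 n) x₀).target := isOpen_extChartAt_target x₀
  have h1 := (contMDiffOn_extChartAt_symm (I := 𝓡 n) (n := ∞) x₀).continuousOn_tangentMapWithin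
    (by norm_num) ht.uniqueMDiffOn
  have h2 : Continuous fun p : EuclideanSpace ℝ (Fin n) × EuclideanSpace ℝ (Fin n) =>
      (TotalSpace.mk' (EuclideanSpace ℝ (Fin n)) p.1 p.2 :
        TangentBundle 𝓘(ℝ, EuclideanSpace ℝ (Fin n)) (EuclideanSpace ℝ (Fin n))) :=
    (tangentBundleModelSpaceHomeomorph 𝓘(ℝ, EuclideanSpace ℝ (Fin n))).symm.continuous
  refine (h1.comp h2.continuousOn (fun p hp => hp.1)).congr fun p hp => ?_
  simp only [Function.comp, tangentMapWithin, chartVec]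
  rw [mfderivWithin_of_isOpen ht hp.1]

theorem continuousOn_metric {X : Type*} [TopologicalSpace X] {s : Set X} {b : X → M}
    {v w : ∀ x, TangentSpace (𝓡 n) (b x)}
    (hv : ContinuousOn (fun x => TotalSpace.mk' (EuclideanSpace ℝ (Fin n))
      (E := TangentSpace (𝓡 n) (M := M)) (b x) (v x)) s)
    (hw : ContinuousOn (fun x => TotalSpace.mk' (EuclideanSpace ℝ (Fin n))
      (E := TangentSpace (𝓡 n) (M := M)) (b x) (w x)) s) :
    ContinuousOn (fun x => S.metric (b x) (v x) (w x)) s := by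
  have hb : ContinuousOn b s :=
    (FiberBundle.continuous_proj (EuclideanSpace ℝ (Fin n))
      (TangentSpace (𝓡 n) (M := M))).comp_continuousOn hv
  have hg := S.metric_smooth.continuous.comp_continuousOn hb
  intro x hx
  have h : ContinuousWithinAt (fun m => TotalSpace.mk' ℝ (E := Bundle.Trivial M ℝ) (b m)
      (S.metric (b m) (v m) (w m))) s x :=
    ContinuousWithinAt.clm_bundle_apply₂ (F₁ := EuclideanSpace ℝ (Fin n))
      (F₂ := EuclideanSpace ℝ (Fin n)) (hg x hx) (hv x hx) (hw x hx)
  rw [FiberBundle.continuousWithinAt_totalSpace] at h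
  exact h.2

/-- A vector orthogonal to everything is orthogonal to the time vector, hence spacelike if nonzero;
but it is also orthogonal to itself. -/
theorem metric_nondeg {x : M} {v : TangentSpace (𝓡 n) x} (h : ∀ w, S.metric x w v = 0) : v = 0 := by
  by_contra hv
  exact (S.space_pos x v (h _) hv).ne' (h v)

theorem isInvertible_mfderiv_extChartAt_symm {x₀ : M} {y : EuclideanSpace ℝ (Fin n)}
    (hy : y ∈ (extChartAt (𝓡 n) x₀).target) :
    (mfderiv 𝓘(ℝ, EuclideanSpace ℝ (Fin n)) (𝓡 n) (extChartAt (𝓡 n) x₀).symm y).IsInvertible := by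
  have : IsManifold (𝓡 n) 1 M := .of_le (n := ∞) (by norm_num)
  have h := isInvertible_mfderivWithin_extChartAt_symm (I := 𝓡 n) hy
  rwa [ModelWithCorners.range_eq_univ, mfderivWithin_univ] at h

theorem continuousOn_density (x₀ : M) :
    ContinuousOn (S.density x₀) (extChartAt (𝓡 n) x₀).target := by
  refine (Real.continuous_sqrt.comp continuous_abs).comp_continuousOn ?_
  have h1 (i j : Fin n) : ContinuousOn (fun y => S.metric ((extChartAt (𝓡 n) x₀).symm y)
      (chartVec x₀ y (EuclideanSpace.single i (1 : ℝ)))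
      (chartVec x₀ y (EuclideanSpace.single j (1 : ℝ)))) (extChartAt (𝓡 n) x₀).target := by
    have h2 (i : Fin n) := (continuousOn_chartVec x₀).comp
      (f := fun y => (y, EuclideanSpace.single i (1 : ℝ))) (s := (extChartAt (𝓡 n) x₀).target)
      (by fun_prop) (fun y hy => ⟨hy, mem_univ _⟩)
    exact S.continuousOn_metric (h2 i) (h2 j)
  have h3 : ContinuousOn (fun y => (Matrix.of fun i j : Fin n =>
      S.metric ((extChartAt (𝓡 n) x₀).symm y)
      (chartVec x₀ y (EuclideanSpace.single i (1 : ℝ)))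
      (chartVec x₀ y (EuclideanSpace.single j (1 : ℝ))))) (extChartAt (𝓡 n) x₀).target :=
    continuousOn_pi.2 fun i => continuousOn_pi.2 fun j => h1 i j
  exact (Continuous.matrix_det continuous_id).comp_continuousOn h3

theorem density_pos {x₀ : M} {y : EuclideanSpace ℝ (Fin n)}
    (hy : y ∈ (extChartAt (𝓡 n) x₀).target) : 0 < S.density x₀ y := by
  obtain ⟨e, he⟩ := isInvertible_mfderiv_extChartAt_symm hy
  refine Real.sqrt_pos.2 (abs_pos.2 ?_)
  have h := det_gram_ne_zero (V := TangentSpace (𝓡 n) ((extChartAt (𝓡 n) x₀).symm y))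
    (S.metric _).toBilinForm (fun v hv => S.metric_nondeg hv) e.toLinearEquiv
  have hB : ∀ w, e w = mfderiv 𝓘(ℝ, EuclideanSpace ℝ (Fin n)) (𝓡 n)
      (extChartAt (𝓡 n) x₀).symm y w := fun w => congrArg (fun f => f w) he
  intro h0
  refine h (Eq.trans (congrArg Matrix.det (Matrix.ext fun i j => ?_)) h0)
  exact congrArg₂ (fun a b => S.metric _ a b) (hB _) (hB _)

theorem aemeasurable_density (x₀ : M) : AEMeasurable (fun y => ENNReal.ofReal (S.density x₀ y))
    (volume.restrict (extChartAt (𝓡 n) x₀).target) :=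
  ((S.continuousOn_density x₀).aemeasurable
    (isOpen_extChartAt_target x₀).measurableSet).ennreal_ofReal

section Volume

theorem partition_tsupport [T2Space M] [SigmaCompactSpace M] (x₀ : M) :
    tsupport (partition n M x₀) ⊆ (extChartAt (𝓡 n) x₀).source := by
  rw [extChartAt_source]
  exact (SmoothPartitionOfUnity.exists_isSubordinate_chartAt_source (𝓡 n) M).choose_spec x₀

variable [MeasurableSpace M] [BorelSpace M]

theorem chartVol_apply (x₀ : M) {U : Set M} (hU : MeasurableSet U) :
    S.chartVol x₀ U = ∫⁻ y in (extChartAt (𝓡 n) x₀).target ∩ (extChartAt (𝓡 n) x₀).symm ⁻¹' U,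
      ENNReal.ofReal (S.density x₀ y) := by
  have ht : MeasurableSet (extChartAt (𝓡 n) x₀).target :=
    (isOpen_extChartAt_target x₀).measurableSet
  have h1 : AEMeasurable (extChartAt (𝓡 n) x₀).symm
      (volume.restrict (extChartAt (𝓡 n) x₀).target) :=
    (continuousOn_extChartAt_symm x₀).aemeasurable ht
  have h2 := h1.mono_ac (withDensity_absolutelyContinuous _
    (fun y => ENNReal.ofReal (S.density x₀ y)))
  have h3 : NullMeasurableSet ((extChartAt (𝓡 n) x₀).symm ⁻¹' U)
      (volume.restrict (extChartAt (𝓡 n) x₀).target) := h1.nullMeasurableSet_preimage hU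
  rw [chartVol, Measure.map_apply_of_aemeasurable h2 hU,
    withDensity_apply₀ _ h3, Measure.restrict_restrict₀ h3, inter_comm]

variable [T2Space M] [SigmaCompactSpace M]

/-- Some partition function is positive at a point of U. If U were null, the corresponding summand
would force the chart density to vanish almost everywhere on a nonempty open set, but the density is
positive there. This yields the non-degeneracy of the pairing. -/
instance vol_isOpenPosMeasure : S.vol.IsOpenPosMeasure where
  open_pos U hU hne h0 := by
    obtain ⟨x, hx⟩ := hne
    obtain ⟨x₀, hx₀⟩ := (partition n M).exists_pos_of_mem (mem_univ x)
    have h1 : ((S.chartVol x₀).withDensity fun x => ENNReal.ofReal (partition n M x₀ x)) U = 0 :=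
      le_antisymm ((Measure.le_sum _ x₀ U).trans h0.le) zero_le
    have hm : Measurable fun x => ENNReal.ofReal (partition n M x₀ x) :=
      (partition n M x₀).contMDiff.continuous.measurable.ennreal_ofReal
    rw [withDensity_apply_eq_zero hm] at h1
    have hV : IsOpen ({x | ENNReal.ofReal (partition n M x₀ x) ≠ 0} ∩ U) := by
      refine IsOpen.inter ?_ hU
      exact isOpen_ne_fun (ENNReal.continuous_ofReal.comp (partition n M x₀).contMDiff.continuous)
        continuous_const
    rw [chartVol_apply _ _ hV.measurableSet] at h1
    set V := {x | ENNReal.ofReal (partition n M x₀ x) ≠ 0} ∩ U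
    have hO : IsOpen ((extChartAt (𝓡 n) x₀).target ∩ (extChartAt (𝓡 n) x₀).symm ⁻¹' V) :=
      (continuousOn_extChartAt_symm x₀).isOpen_inter_preimage (isOpen_extChartAt_target x₀) hV
    have hxV : x ∈ V := ⟨by simpa using hx₀, hx⟩
    have hxs : x ∈ (extChartAt (𝓡 n) x₀).source :=
      partition_tsupport x₀ (subset_tsupport _ hx₀.ne')
    have hO' : ((extChartAt (𝓡 n) x₀).target ∩ (extChartAt (𝓡 n) x₀).symm ⁻¹' V).Nonempty :=
      ⟨extChartAt (𝓡 n) x₀ x, (extChartAt (𝓡 n) x₀).map_source hxs, by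
        rw [mem_preimage, (extChartAt (𝓡 n) x₀).left_inv hxs]; exact hxV⟩
    refine (hO.measure_pos volume hO').ne' ?_
    have h4 := (lintegral_eq_zero_iff' ((S.aemeasurable_density x₀).mono_measure
      (Measure.restrict_mono inter_subset_left le_rfl))).1 h1
    rw [Filter.EventuallyEq, ae_restrict_iff' hO.measurableSet] at h4
    rw [measure_eq_zero_iff_ae_notMem]
    filter_upwards [h4] with y hy hyO
    have := hy hyO
    simp only [Pi.zero_apply, ENNReal.ofReal_eq_zero] at this
    exact absurd (S.density_pos hyO.1) (not_lt.2 this)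

/-- Only finitely many partition functions meet a compact set, and each summand is an integral of a
continuous density over a compact subset of the chart. This yields the integrability of the pairing.
-/
instance vol_isFiniteMeasureOnCompacts : IsFiniteMeasureOnCompacts S.vol where
  lt_top_of_isCompact C hC := by
    have hCm := hC.measurableSet
    rw [vol, Measure.sum_apply _ hCm]
    have hfin := (partition n M).locallyFinite.finite_nonempty_inter_compact hC
    have hz : ∀ x₀ ∉ hfin.toFinset,
        ((S.chartVol x₀).withDensity fun x => ENNReal.ofReal (partition n M x₀ x)) C = 0 := by
      intro x₀ hx₀
      rw [withDensity_apply _ hCm, setLIntegral_eq_zero_iff hCm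
        (partition n M x₀).contMDiff.continuous.measurable.ennreal_ofReal]
      refine ae_of_all _ fun x hx => ?_
      by_contra hne
      refine hx₀ (hfin.mem_toFinset.2 ⟨x, ?_, hx⟩)
      intro h
      exact hne (by simp [h])
    rw [tsum_eq_sum hz]
    refine ENNReal.sum_lt_top.2 fun x₀ _ => ?_
    have hK : IsCompact (C ∩ tsupport (partition n M x₀)) := hC.inter_right (isClosed_tsupport _)
    have hKs : C ∩ tsupport (partition n M x₀) ⊆ (extChartAt (𝓡 n) x₀).source :=
      inter_subset_right.trans (partition_tsupport x₀)
    calc ((S.chartVol x₀).withDensity fun x => ENNReal.ofReal (partition n M x₀ x)) C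
        = ∫⁻ x in C, ENNReal.ofReal (partition n M x₀ x) ∂(S.chartVol x₀) :=
          withDensity_apply _ hCm
      _ ≤ ∫⁻ x in C, (tsupport (partition n M x₀)).indicator 1 x ∂(S.chartVol x₀) := by
          refine lintegral_mono fun x => ?_
          by_cases hx : x ∈ tsupport (partition n M x₀)
          · rw [indicator_of_mem hx]
            exact ENNReal.ofReal_le_one.2 ((partition n M).le_one x₀ x)
          · rw [image_eq_zero_of_notMem_tsupport hx]; simp
      _ = S.chartVol x₀ (C ∩ tsupport (partition n M x₀)) := by
          rw [lintegral_indicator_one (isClosed_tsupport _).measurableSet,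
            Measure.restrict_apply (isClosed_tsupport _).measurableSet, inter_comm]
      _ < ⊤ := by
          rw [chartVol_apply _ _ hK.measurableSet]
          set K := C ∩ tsupport (partition n M x₀)
          have hK' : IsCompact (extChartAt (𝓡 n) x₀ '' K) :=
            hK.image_of_continuousOn ((continuousOn_extChartAt x₀).mono hKs)
          have hKt : extChartAt (𝓡 n) x₀ '' K ⊆ (extChartAt (𝓡 n) x₀).target := by
            rintro _ ⟨x, hx, rfl⟩
            exact (extChartAt (𝓡 n) x₀).map_source (hKs hx)
          obtain ⟨B, hB⟩ := (hK'.image_of_continuousOn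
            ((S.continuousOn_density x₀).mono hKt)).bddAbove
          refine (lintegral_mono_set (t := extChartAt (𝓡 n) x₀ '' K) ?_).trans_lt
            ((setLIntegral_mono' hK'.measurableSet
              (g := fun _ => ENNReal.ofReal B) fun y hy => ?_).trans_lt ?_)
          · rintro y ⟨hy, hyK⟩
            exact ⟨_, hyK, (extChartAt (𝓡 n) x₀).right_inv hy⟩
          · exact ENNReal.ofReal_le_ofReal (hB ⟨y, hy, rfl⟩)
          · rw [setLIntegral_const]
            exact ENNReal.mul_lt_top ENNReal.ofReal_lt_top hK'.measure_lt_top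

end Volume

end Spacetime
end Geometry

/-! ### Compactness of causal diamonds over compact sets. -/

section Causality
variable {n : ℕ} {M : Type u} [TopologicalSpace M] [ChartedSpace (EuclideanSpace ℝ (Fin n)) M]
  [IsManifold (𝓡 n) ∞ M]

namespace Spacetime

variable (S : Spacetime n M)

/-- Near every point there is, in the coordinates of a chart, a ball of base points and a ball of
directions all of which are timelike and future-directed. -/
theorem exists_timelike_ball (x : M) : ∃ u₀ : EuclideanSpace ℝ (Fin n), ∃ r > 0,
    Metric.ball (extChartAt (𝓡 n) x x) r ⊆ (extChartAt (𝓡 n) x).target ∧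
    ∀ y ∈ Metric.ball (extChartAt (𝓡 n) x x) r, ∀ w ∈ Metric.ball u₀ r,
      S.metric ((extChartAt (𝓡 n) x).symm y) (chartVec x y w) (chartVec x y w) < 0 ∧
      S.metric ((extChartAt (𝓡 n) x).symm y) (S.time _) (chartVec x y w) < 0 := by
  have hT := isOpen_extChartAt_target (I := 𝓡 n) x
  have hx : extChartAt (𝓡 n) x x ∈ (extChartAt (𝓡 n) x).target := mem_extChartAt_target x
  obtain ⟨e, he⟩ := isInvertible_mfderiv_extChartAt_symm hx
  obtain ⟨u₀, hu₀⟩ : ∃ u₀, chartVec x (extChartAt (𝓡 n) x x) u₀ = S.time _ :=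
    ⟨e.symm (S.time _), (congrArg (fun f => f (e.symm (S.time _))) he.symm).trans
      (e.apply_symm_apply _)⟩
  have hvec := continuousOn_chartVec (n := n) x
  have htime : ContinuousOn (fun p : EuclideanSpace ℝ (Fin n) × EuclideanSpace ℝ (Fin n) =>
      TotalSpace.mk' (EuclideanSpace ℝ (Fin n)) (E := TangentSpace (𝓡 n) (M := M))
        ((extChartAt (𝓡 n) x).symm p.1) (S.time ((extChartAt (𝓡 n) x).symm p.1)))
      ((extChartAt (𝓡 n) x).target ×ˢ univ) :=
    S.time_smooth.continuous.comp_continuousOn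
      ((continuousOn_extChartAt_symm x).comp continuousOn_fst fun p hp => hp.1)
  have hnhds : (extChartAt (𝓡 n) x).target ×ˢ univ ∈ 𝓝 (extChartAt (𝓡 n) x x, u₀) :=
    (hT.prod isOpen_univ).mem_nhds ⟨hx, mem_univ _⟩
  have h1 := ((S.continuousOn_metric hvec hvec).continuousAt hnhds).eventually_lt
    (continuousAt_const (y := (0 : ℝ))) (by
      change S.metric _ (chartVec x _ u₀) (chartVec x _ u₀) < 0
      rw [hu₀]; exact S.time_neg _)
  have h2 := ((S.continuousOn_metric htime hvec).continuousAt hnhds).eventually_lt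
    (continuousAt_const (y := (0 : ℝ))) (by
      change S.metric _ _ (chartVec x _ u₀) < 0
      rw [hu₀]; exact S.time_neg _)
  obtain ⟨r, hr, h⟩ := Metric.eventually_nhds_iff_ball.1 (Filter.Eventually.and hnhds (h1.and h2))
  rw [← ball_prod_same] at h
  exact ⟨u₀, r, hr, fun y hy => (h (y, u₀) ⟨hy, Metric.mem_ball_self hr⟩).1.1,
    fun y hy w hw => (h (y, w) ⟨hy, hw⟩).2⟩

/-- In coordinates the segment has the constant velocity ε w. By convexity it stays in the ball of
base points over which w is timelike and future-directed, and scaling by ε > 0 preserves both signs.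
-/
theorem causalLE_of_segment {x : M} {y₀ u₀ : EuclideanSpace ℝ (Fin n)} {r ε : ℝ} (hε : 0 < ε)
    (hT : Metric.ball y₀ r ⊆ (extChartAt (𝓡 n) x).target)
    (h : ∀ y ∈ Metric.ball y₀ r, ∀ w ∈ Metric.ball u₀ r,
      S.metric ((extChartAt (𝓡 n) x).symm y) (chartVec x y w) (chartVec x y w) < 0 ∧
      S.metric ((extChartAt (𝓡 n) x).symm y) (S.time _) (chartVec x y w) < 0)
    {z₁ w : EuclideanSpace ℝ (Fin n)} (h₁ : z₁ ∈ Metric.ball y₀ r)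
    (h₂ : z₁ + ε • w ∈ Metric.ball y₀ r) (hw : w ∈ Metric.ball u₀ r) :
    S.CausalLE ((extChartAt (𝓡 n) x).symm z₁) ((extChartAt (𝓡 n) x).symm (z₁ + ε • w)) := by
  let l : ℝ → EuclideanSpace ℝ (Fin n) := fun t => z₁ + t • (ε • w)
  have hl : ∀ t ∈ Icc (0 : ℝ) 1, l t ∈ Metric.ball y₀ r := by
    intro t ht
    have := (convex_ball y₀ r).add_smul_sub_mem h₁ h₂ ht
    rwa [add_sub_cancel_left] at this
  have hld : ContDiff ℝ 1 l := by fun_prop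
  have hl' : ∀ t, HasDerivAt l (ε • w) t := fun t => by
    have h := ((hasDerivAt_id t).smul_const (ε • w)).const_add z₁
    rwa [one_smul] at h
  refine Relation.ReflTransGen.single ⟨fun t => (extChartAt (𝓡 n) x).symm (l t), ?_, ?_, ?_, ?_⟩
  · simp [l]
  · simp [l]
  · refine ((contMDiffOn_extChartAt_symm (I := 𝓡 n) (n := ∞) x).of_le (by norm_num)).comp
      hld.contMDiff.contMDiffOn fun t ht => hT (hl t ht)
  · intro t ht
    have hy := hl t ht
    have hd : mfderivWithin 𝓘(ℝ, ℝ) (𝓡 n) (fun t => (extChartAt (𝓡 n) x).symm (l t)) (Icc 0 1) t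
        (1 : ℝ) = chartVec x (l t) (ε • w) := by
      have hu : UniqueMDiffWithinAt 𝓘(ℝ, ℝ) (Icc (0 : ℝ) 1) t :=
        (uniqueDiffOn_Icc zero_lt_one t ht).uniqueMDiffWithinAt
      have hs : MDifferentiableAt 𝓘(ℝ, EuclideanSpace ℝ (Fin n)) (𝓡 n)
          (extChartAt (𝓡 n) x).symm (l t) :=
        (((contMDiffOn_extChartAt_symm (I := 𝓡 n) (n := ∞) x) _ (hT hy)).contMDiffAt
          ((isOpen_extChartAt_target x).mem_nhds (hT hy))).mdifferentiableAt (by norm_num)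
      have hm : HasMFDerivAt 𝓘(ℝ, ℝ) 𝓘(ℝ, EuclideanSpace ℝ (Fin n)) l t
          (ContinuousLinearMap.toSpanSingleton ℝ (ε • w)) :=
        (hl' t).hasFDerivAt.hasMFDerivAt
      have := (hs.hasMFDerivAt.comp t hm).hasMFDerivWithinAt (s := Icc 0 1)
      have h3 := this.mfderivWithin hu
      have h4 := congrArg (fun f => f (1 : ℝ)) h3
      refine h4.trans ?_
      change mfderiv _ _ _ (l t) ((1 : ℝ) • ε • w) = _
      rw [one_smul]
      rfl
    have hs : chartVec x (l t) (ε • w) = ε • chartVec x (l t) w := map_smul _ ε w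
    obtain ⟨h3, h4⟩ := h _ hy w hw
    have h5 : S.metric ((extChartAt (𝓡 n) x).symm (l t)) (ε • chartVec x (l t) w)
        (ε • chartVec x (l t) w) < 0 := by
      rw [map_smul, map_smul, _root_.smul_apply, smul_eq_mul, smul_eq_mul]
      exact mul_neg_of_pos_of_neg hε (mul_neg_of_pos_of_neg hε h3)
    rw [hd, hs]
    refine ⟨fun h0 => ?_, h5.le, ?_⟩
    · rw [h0, map_zero] at h5; exact lt_irrefl _ h5
    · rw [map_smul, smul_eq_mul]; exact mul_neg_of_pos_of_neg hε h4

/-- The point p is obtained from x by stepping back ε u₀ in coordinates, u₀ being the direction of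
the time vector; ε is small enough for p to stay in the ball. Points near x are then reached from p
in a direction close to u₀. These neighbourhoods are what allows a compact set to be covered by
finitely many futures of points. -/
theorem exists_future_mem_nhds (x : M) : ∃ p, {y | S.CausalLE p y} ∈ 𝓝 x := by
  obtain ⟨u₀, r, hr, hT, h⟩ := S.exists_timelike_ball x
  set e := extChartAt (𝓡 n) x
  obtain ⟨ε, hε, hεr⟩ : ∃ ε > 0, ε * ‖u₀‖ < r :=
    ⟨r / (‖u₀‖ + 1), by positivity, by
      rw [div_mul_eq_mul_div, div_lt_iff₀ (by positivity)]; nlinarith [norm_nonneg u₀]⟩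
  have hz : e x - ε • u₀ ∈ Metric.ball (e x) r := by
    rw [mem_ball_iff_norm]; simpa [norm_smul, abs_of_pos hε] using hεr
  refine ⟨e.symm (e x - ε • u₀), ?_⟩
  have hc : ContinuousAt e x := continuousAt_extChartAt x
  -- The radius ε r makes the direction u₀ + ε⁻¹ (e y - e x) lie in the ball of timelike directions;
  -- the radius r keeps e y among the admissible base points.
  have hmem : ∀ᶠ y in 𝓝 x, y ∈ e.source ∧ e y ∈ Metric.ball (e x) (min r (ε * r)) :=
    Filter.Eventually.and (extChartAt_source_mem_nhds (I := 𝓡 n) x)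
      (hc.eventually (Metric.ball_mem_nhds _ (lt_min hr (mul_pos hε hr))))
  filter_upwards [hmem] with y ⟨hys, hy⟩
  have hw : u₀ + ε⁻¹ • (e y - e x) ∈ Metric.ball u₀ r := by
    have h2 : ‖e y - e x‖ < ε * r := (mem_ball_iff_norm.1 hy).trans_le (min_le_right _ _)
    rw [mem_ball_iff_norm, add_sub_cancel_left, norm_smul, norm_inv, Real.norm_of_nonneg hε.le,
      inv_mul_lt_iff₀ hε]
    exact h2
  have he : e x - ε • u₀ + ε • (u₀ + ε⁻¹ • (e y - e x)) = e y := by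
    rw [smul_add, smul_inv_smul₀ hε.ne']; abel
  have := S.causalLE_of_segment hε hT h hz
    (w := u₀ + ε⁻¹ • (e y - e x)) (by
      rw [he]; exact Metric.ball_subset_ball (min_le_left _ _) hy) hw
  rw [he] at this
  have h6 : e.symm (e y) = y := e.left_inv hys
  rwa [h6] at this

theorem exists_past_mem_nhds (x : M) : ∃ q, {y | S.CausalLE y q} ∈ 𝓝 x := by
  obtain ⟨u₀, r, hr, hT, h⟩ := S.exists_timelike_ball x
  set e := extChartAt (𝓡 n) x
  obtain ⟨ε, hε, hεr⟩ : ∃ ε > 0, ε * ‖u₀‖ < r :=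
    ⟨r / (‖u₀‖ + 1), by positivity, by
      rw [div_mul_eq_mul_div, div_lt_iff₀ (by positivity)]; nlinarith [norm_nonneg u₀]⟩
  have hz : e x + ε • u₀ ∈ Metric.ball (e x) r := by
    rw [mem_ball_iff_norm]; simpa [norm_smul, abs_of_pos hε] using hεr
  refine ⟨e.symm (e x + ε • u₀), ?_⟩
  have hc : ContinuousAt e x := continuousAt_extChartAt x
  have hmem : ∀ᶠ y in 𝓝 x, y ∈ e.source ∧ e y ∈ Metric.ball (e x) (min r (ε * r)) :=
    Filter.Eventually.and (extChartAt_source_mem_nhds (I := 𝓡 n) x)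
      (hc.eventually (Metric.ball_mem_nhds _ (lt_min hr (mul_pos hε hr))))
  filter_upwards [hmem] with y ⟨hys, hy⟩
  have hw : u₀ - ε⁻¹ • (e y - e x) ∈ Metric.ball u₀ r := by
    have h2 : ‖e y - e x‖ < ε * r := (mem_ball_iff_norm.1 hy).trans_le (min_le_right _ _)
    rw [mem_ball_iff_norm, sub_sub_cancel_left, norm_neg, norm_smul, norm_inv,
      Real.norm_of_nonneg hε.le, inv_mul_lt_iff₀ hε]
    exact h2
  have he : e y + ε • (u₀ - ε⁻¹ • (e y - e x)) = e x + ε • u₀ := by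
    rw [smul_sub, smul_inv_smul₀ hε.ne']; abel
  have := S.causalLE_of_segment hε hT h (z₁ := e y)
    (Metric.ball_subset_ball (min_le_left _ _) hy)
    (w := u₀ - ε⁻¹ • (e y - e x)) (by rw [he]; exact hz) hw
  rw [he] at this
  have h6 : e.symm (e y) = y := e.left_inv hys
  rwa [h6] at this

/-- In a globally hyperbolic spacetime `J⁺(A) ∩ J⁻(B)` is relatively compact for compact `A`, `B`. -/
theorem GloballyHyperbolic.exists_compact {S : Spacetime n M} (hS : S.GloballyHyperbolic)
    {A B : Set M} (hA : IsCompact A) (hB : IsCompact B) :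
    ∃ Q, IsCompact Q ∧ S.future A ∩ S.past B ⊆ Q := by
  choose p hp using S.exists_future_mem_nhds
  choose q hq using S.exists_past_mem_nhds
  obtain ⟨a, -, ha⟩ := hA.elim_nhds_subcover _ fun x _ => hp x
  obtain ⟨b, -, hb⟩ := hB.elim_nhds_subcover _ fun x _ => hq x
  refine ⟨⋃ x ∈ a, ⋃ y ∈ b, {z | S.CausalLE (p x) z ∧ S.CausalLE z (q y)},
    a.isCompact_biUnion fun x _ => b.isCompact_biUnion fun y _ => hS.2 _ _, ?_⟩
  rintro z ⟨⟨s, hs, hsz⟩, t, ht, hzt⟩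
  obtain ⟨x, hx, hxs⟩ := mem_iUnion₂.1 (ha hs)
  obtain ⟨y, hy, hyt⟩ := mem_iUnion₂.1 (hb ht)
  exact mem_iUnion₂.2 ⟨x, hx, mem_iUnion₂.2 ⟨y, hy, Relation.ReflTransGen.trans hxs hsz,
    Relation.ReflTransGen.trans hzt hyt⟩⟩

theorem future_mono {A B : Set M} (h : A ⊆ B) : S.future A ⊆ S.future B :=
  fun _ ⟨p, hp, hpq⟩ => ⟨p, h hp, hpq⟩

theorem past_mono {A B : Set M} (h : A ⊆ B) : S.past A ⊆ S.past B :=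
  fun _ ⟨p, hp, hpq⟩ => ⟨p, h hp, hpq⟩

end Spacetime
end Causality

/-! ### Cut-offs, locality of differential operators, and existence of sections. -/

section Sections
variable {n : ℕ} {M : Type u} [TopologicalSpace M] [ChartedSpace (EuclideanSpace ℝ (Fin n)) M]

theorem notMem_supp {E : HermBundle.{u, v} n M} {s : ∀ x, E.V x} {x : M} (h : x ∉ supp s) :
    s x = 0 := by
  by_contra h'
  exact h (subset_closure h')

theorem mem_supp {E : HermBundle.{u, v} n M} {s : ∀ x, E.V x} {x : M} (h : s x ≠ 0) :
    x ∈ supp s := subset_closure h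

theorem supp_sub_subset {E : HermBundle.{u, v} n M} (s t : ∀ x, E.V x) :
    supp (s - t) ⊆ supp s ∪ supp t := by
  rw [supp, supp, supp, ← closure_union]
  refine closure_mono fun x hx => ?_
  by_contra h
  simp only [mem_union, mem_ofPred_eq, not_or, not_not] at h
  exact hx (by simp [h.1, h.2])

theorem DiffOp.toSec_onC {E : HermBundle.{u, v₁} n M} {E' : HermBundle.{u, v₂} n M}
    (A : DiffOp E E') (s : SecC E) : toSec E' (A.onC s) = A.toLin (toSec E s) := rfl

theorem DiffOp.onC_val {E : HermBundle.{u, v₁} n M} {E' : HermBundle.{u, v₂} n M}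
    (A : DiffOp E E') (s : SecC E) : (A.onC s).1 = (A.toLin (toSec E s)).1 := rfl

theorem toSec_val {E : HermBundle.{u, v} n M} (s : SecC E) : (toSec E s).1 = s.1 := rfl

theorem toSec_injective {E : HermBundle.{u, v} n M} : Function.Injective (toSec E) :=
  fun _ _ h => Subtype.ext (congrArg (fun t : Sec E => t.1) h)

theorem DiffOp.ext' {E : HermBundle.{u, v₁} n M} {E' : HermBundle.{u, v₂} n M}
    {A B : DiffOp E E'} (h : A.toLin = B.toLin) : A = B := by
  cases A; cases B; cases h; rfl

/-- Values of a differential operator are local. -/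
theorem DiffOp.apply_eq_of_eventuallyEq {E : HermBundle.{u, v₁} n M} {E' : HermBundle.{u, v₂} n M}
    (A : DiffOp E E') {s t : Sec E} {x : M} (h : ∀ᶠ y in 𝓝 x, s.1 y = t.1 y) :
    (A.toLin s).1 x = (A.toLin t).1 x := by
  have h1 : x ∉ supp (s - t).1 := by
    intro hx
    obtain ⟨y, hy, hy'⟩ := mem_closure_iff_nhds.1 hx _ h
    exact hy' (sub_eq_zero.2 hy)
  have h2 := notMem_supp fun h => h1 (A.supp_subset _ h)
  rw [map_sub] at h2
  exact sub_eq_zero.1 h2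

theorem mulSec_val {E : HermBundle.{u, v} n M} (f : C^∞⟮𝓡 n, M; 𝓘(ℝ, ℂ), ℂ⟯) (s : Sec E) (x : M) :
    (mulSec E f s).1 x = f x • s.1 x := rfl

/-- The product of a section with a compactly supported smooth function. -/
def cutSec {E : HermBundle.{u, v} n M} (f : C^∞⟮𝓡 n, M; 𝓘(ℝ, ℂ), ℂ⟯) (hf : HasCompactSupport f)
    (s : Sec E) : SecC E :=
  ⟨fun x => f x • s.1 x, IsSmooth.mul f.contMDiff s.2,
    hf.isCompact.of_isClosed_subset isClosed_closure (closure_mono fun x hx h => hx (by simp [h]))⟩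

theorem cutSec_val {E : HermBundle.{u, v} n M} (f : C^∞⟮𝓡 n, M; 𝓘(ℝ, ℂ), ℂ⟯)
    (hf : HasCompactSupport f) (s : Sec E) (x : M) : (cutSec f hf s).1 x = f x • s.1 x := rfl

variable [IsManifold (𝓡 n) ∞ M] [T2Space M] [SigmaCompactSpace M]

theorem exists_cutoff {Q U : Set M} (hQ : IsCompact Q) (hU : IsOpen U) (h : Q ⊆ U) :
    ∃ f : C^∞⟮𝓡 n, M; 𝓘(ℝ, ℂ), ℂ⟯, (∀ᶠ x in 𝓝ˢ Q, f x = 1) ∧ HasCompactSupport f ∧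
      tsupport f ⊆ U ∧ ∀ x, ∃ r : ℝ, 0 ≤ r ∧ f x = r := by
  have : LocallyCompactSpace M := Manifold.locallyCompact_of_finiteDimensional (𝓡 n)
  obtain ⟨L, hL, hQL, hLU⟩ := exists_compact_between hQ hU h
  obtain ⟨g, hg1, hg0, hg⟩ := exists_contMDiffMap_one_nhds_of_subset_interior (n := ⊤) (𝓡 n)
    hQ.isClosed hQL
  let f : C^∞⟮𝓡 n, M; 𝓘(ℝ, ℂ), ℂ⟯ :=
    ⟨fun x => (g x : ℂ), Complex.ofRealCLM.contDiff.contMDiff.comp g.contMDiff⟩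
  have hf : tsupport f ⊆ L := by
    refine closure_minimal (fun x hx => ?_) hL.isClosed
    by_contra hxL
    exact hx (show ((g x : ℝ) : ℂ) = 0 by rw [hg0 x hxL, Complex.ofReal_zero])
  refine ⟨f, ?_, hL.of_isClosed_subset (isClosed_tsupport _) hf, hf.trans hLU,
    fun x => ⟨g x, (hg x).1, rfl⟩⟩
  filter_upwards [hg1] with x hx
  change ((g x : ℝ) : ℂ) = 1
  rw [hx, Complex.ofReal_one]

/-- Every compactly supported section near a compact set. -/
theorem exists_secC_eq {E : HermBundle.{u, v} n M} (s : Sec E) {Q : Set M} (hQ : IsCompact Q) :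
    ∃ t : SecC E, (∀ᶠ x in 𝓝ˢ Q, t.1 x = s.1 x) ∧ supp t.1 ⊆ supp s.1 := by
  obtain ⟨f, hf1, hfc, -, -⟩ := exists_cutoff (n := n) hQ isOpen_univ (subset_univ _)
  refine ⟨cutSec f hfc s, ?_, supp_mul_subset _ _⟩
  filter_upwards [hf1] with x hx
  rw [cutSec_val, hx, one_smul]

/-- By locality, the value at a point depends only on a compactly supported modification of the
section. -/
theorem DiffOp.ext_onC {E : HermBundle.{u, v₁} n M} {E' : HermBundle.{u, v₂} n M}
    {A B : DiffOp E E'} (h : ∀ s, A.onC s = B.onC s) : A = B := by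
  refine DiffOp.ext' (LinearMap.ext fun s => Subtype.ext (funext fun x => ?_))
  obtain ⟨t, ht, -⟩ := exists_secC_eq s (isCompact_singleton (x := x))
  rw [nhdsSet_singleton] at ht
  rw [A.apply_eq_of_eventuallyEq (t := toSec E t) (ht.mono fun _ h => h.symm),
    B.apply_eq_of_eventuallyEq (t := toSec E t) (ht.mono fun _ h => h.symm)]
  exact congrFun (congrArg Subtype.val (h t)) x

/-- Every vector of a fibre is the value of a smooth section. -/
theorem exists_sec_apply_eq {E : HermBundle.{u, v} n M} (x : M) (w : E.V x) :
    ∃ s : Sec E, s.1 x = w := by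
  set e := trivializationAt E.F E.V x
  have hx : x ∈ e.baseSet := FiberBundle.mem_baseSet_trivializationAt' x
  obtain ⟨f, hf1, -, hfU, -⟩ := exists_cutoff (n := n) (isCompact_singleton (x := x))
    e.open_baseSet (singleton_subset_iff.2 hx)
  have hfx : f x = 1 := hf1.self_of_nhdsSet x rfl
  let s : ∀ y, E.V y := fun y => f y • e.symm y (e ⟨x, w⟩).2
  refine ⟨⟨s, isSmooth_iff.2 fun y => ?_⟩, ?_⟩
  · by_cases hy : y ∈ tsupport f
    · refine smul_smooth_at f.contMDiff.contMDiffAt ?_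
      have h1 : ContMDiffOn (𝓡 n) ((𝓡 n).prod 𝓘(ℝ, E.F)) ∞
          (fun y => TotalSpace.mk' E.F y (e.symm y (e ⟨x, w⟩).2)) e.baseSet := by
        have h2 : ContMDiffOn (𝓡 n) ((𝓡 n).prod 𝓘(ℝ, E.F)) ∞
            (fun y : M => (y, (e ⟨x, w⟩).2)) e.baseSet :=
          contMDiffOn_id.prodMk contMDiffOn_const
        refine ((e.contMDiffOn_symm (IB := 𝓡 n) (n := ∞)).comp h2 fun y hy => ?_).congr
          fun y hy => ?_
        · rw [e.target_eq]; exact ⟨hy, mem_univ _⟩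
        · exact e.mk_symm hy _
      exact (contMDiffAt_section y).1 ((h1 y (hfU hy)).contMDiffAt (e.open_baseSet.mem_nhds (hfU hy)))
    · have h0 := isSmooth_iff.1 (Sec E).zero_mem y
      refine h0.congr_of_eventuallyEq ?_
      filter_upwards [(isClosed_tsupport f).isOpen_compl.mem_nhds hy] with z hz
      have : s z = 0 := by simp [s, image_eq_zero_of_notMem_tsupport hz]
      simp [this]
  · change f x • e.symm x (e ⟨x, w⟩).2 = w
    rw [hfx, one_smul]
    exact e.symm_apply_apply_mk hx w

end Sections

/-! ### The hermitian pairing and formal adjoints. -/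

section Pairing

variable {n : ℕ} {M : Type u} [TopologicalSpace M] [ChartedSpace (EuclideanSpace ℝ (Fin n)) M]
  [IsManifold (𝓡 n) ∞ M] [T2Space M] [SigmaCompactSpace M] [MeasurableSpace M]
  (S : Spacetime n M)

theorem pair_conj {E : HermBundle.{u, v} n M} (s t : ∀ x, E.V x) :
    star (pair S E s t) = pair S E t s := by
  refine (integral_conj (μ := S.vol) (f := fun x => E.form x (s x) (t x))).symm.trans ?_
  exact integral_congr_ae (ae_of_all _ fun x => E.form_symm x (s x) (t x))

theorem pair_eq_zero {E : HermBundle.{u, v} n M} {s t : ∀ x, E.V x}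
    (h : ∀ x, s x = 0 ∨ t x = 0) : pair S E s t = 0 := by
  refine (integral_congr_ae (ae_of_all _ fun x => ?_)).trans (integral_zero M ℂ)
  change E.form x (s x) (t x) = 0
  rcases h x with h | h
  · rw [h, map_zero, LinearMap.zero_apply]
  · rw [h, map_zero]

theorem pair_congr {E : HermBundle.{u, v} n M} {s t s' t' : ∀ x, E.V x}
    (h : ∀ x, E.form x (s x) (t x) = E.form x (s' x) (t' x)) : pair S E s t = pair S E s' t' :=
  integral_congr_ae (ae_of_all _ h)

section

variable {S} {E : HermBundle.{u, v₁} n M} {E' : HermBundle.{u, v₂} n M}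
  {E'' : HermBundle.{u, v₃} n M}

theorem IsFormalAdjoint.symm {A : DiffOp E E'} {B : DiffOp E' E} (h : IsFormalAdjoint S A B) :
    IsFormalAdjoint S B A := fun s t => by
  rw [← pair_conj, ← h, pair_conj]

theorem IsFormalAdjoint.comp {A : DiffOp E' E''} {B : DiffOp E'' E'} {A' : DiffOp E E'} {B' : DiffOp E' E}
    (h : IsFormalAdjoint S A B) (h' : IsFormalAdjoint S A' B') :
    IsFormalAdjoint S (A.comp A') (B'.comp B) := fun s t =>
  (h (A'.onC s) t).trans (h' s (B.onC t))

/-- The adjoint relation for sections whose supports have compact intersection. -/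
theorem IsFormalAdjoint.pair_eq {A : DiffOp E E'} {B : DiffOp E' E} (h : IsFormalAdjoint S A B) (s : Sec E)
    (t : Sec E') {Q : Set M} (hQ : IsCompact Q) (hst : supp s.1 ∩ supp t.1 ⊆ Q) :
    pair S E' (A.toLin s).1 t.1 = pair S E s.1 (B.toLin t).1 := by
  obtain ⟨s', hs', hss'⟩ := exists_secC_eq s hQ
  obtain ⟨t', ht', htt'⟩ := exists_secC_eq t hQ
  have h1 : ∀ x ∈ Q, (A.toLin s).1 x = (A.toLin (toSec E s')).1 x ∧ t.1 x = t'.1 x ∧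
      s.1 x = s'.1 x ∧ (B.toLin t).1 x = (B.toLin (toSec E' t')).1 x := by
    intro x hx
    have h2 := hs'.filter_mono (nhds_le_nhdsSet hx)
    have h3 := ht'.filter_mono (nhds_le_nhdsSet hx)
    exact ⟨A.apply_eq_of_eventuallyEq (h2.mono fun _ h => h.symm), h3.self_of_nhds.symm,
      h2.self_of_nhds.symm, B.apply_eq_of_eventuallyEq (h3.mono fun _ h => h.symm)⟩
  have h4 : pair S E' (A.toLin s).1 t.1 = pair S E' (A.onC s').1 t'.1 := by
    refine pair_congr S fun x => ?_
    -- On Q the cut-off sections agree with the original ones near x. Off Q one of the two supports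
    -- misses x, and differential operators and cut-offs do not enlarge supports, so both integrands
    -- vanish.
    by_cases hx : x ∈ Q
    · rw [(h1 x hx).1, (h1 x hx).2.1]; rfl
    · by_cases hs : x ∈ supp s.1
      · have ht : x ∉ supp t.1 := fun ht => hx (hst ⟨hs, ht⟩)
        rw [notMem_supp ht, notMem_supp fun h => ht (htt' h), map_zero, map_zero]
      · rw [DiffOp.onC_val, notMem_supp fun h => hs (A.supp_subset _ h),
          notMem_supp fun h => hs (hss' (A.supp_subset (toSec E s') h)), map_zero,
          LinearMap.zero_apply, LinearMap.zero_apply]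
  have h5 : pair S E s.1 (B.toLin t).1 = pair S E s'.1 (B.onC t').1 := by
    refine pair_congr S fun x => ?_
    by_cases hx : x ∈ Q
    · rw [(h1 x hx).2.2.1, (h1 x hx).2.2.2]; rfl
    · by_cases hs : x ∈ supp s.1
      · have ht : x ∉ supp t.1 := fun ht => hx (hst ⟨hs, ht⟩)
        rw [DiffOp.onC_val, notMem_supp fun h => ht (B.supp_subset _ h),
          notMem_supp fun h => ht (htt' (B.supp_subset (toSec E' t') h)), map_zero, map_zero]
      · rw [notMem_supp hs, notMem_supp fun h => hs (hss' h), map_zero,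
          LinearMap.zero_apply, LinearMap.zero_apply]
  rw [h4, h5, h]

theorem IsFormalAdjoint.pair_left {A : DiffOp E E'} {B : DiffOp E' E} (h : IsFormalAdjoint S A B) (s : SecC E)
    (t : Sec E') : pair S E' (A.onC s).1 t.1 = pair S E s.1 (B.toLin t).1 :=
  h.pair_eq (toSec E s) t s.2.2 inter_subset_left

end

variable [BorelSpace M]

theorem integrable_form {E : HermBundle.{u, v} n M} (s t : Sec E) {Q : Set M} (hQ : IsCompact Q)
    (h : ∀ x, s.1 x ≠ 0 → t.1 x ≠ 0 → x ∈ Q) :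
    Integrable (fun x => E.form x (s.1 x) (t.1 x)) S.vol := by
  refine (E.form_smooth _ _ s.2 t.2).continuous.integrable_of_hasCompactSupport
    (HasCompactSupport.intro hQ fun x hx => ?_)
  by_cases hs : s.1 x = 0
  · rw [hs, map_zero, LinearMap.zero_apply]
  by_cases ht : t.1 x = 0
  · rw [ht, map_zero]
  exact absurd (h x hs ht) hx

/-- The pairing as a sesquilinear map. -/
def pairL (E : HermBundle.{u, v} n M) : SecC E →ₗ⋆[ℂ] Sec E →ₗ[ℂ] ℂ :=
  LinearMap.mk₂'ₛₗ (starRingEnd ℂ) (RingHom.id ℂ) (fun s t => pair S E s.1 t.1)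
    (fun s s' t => by
      refine Eq.trans ?_ (integral_add
        (integrable_form S (toSec E s) t s.2.2 fun x h _ => mem_supp h)
        (integrable_form S (toSec E s') t s'.2.2 fun x h _ => mem_supp h))
      refine integral_congr_ae (ae_of_all _ fun x => ?_)
      exact LinearMap.map_add₂ (E.form x) (s.1 x) (s'.1 x) (t.1 x))
    (fun c s t => by
      rw [pair, pair, smul_eq_mul, ← integral_const_mul]
      refine integral_congr_ae (ae_of_all _ fun x => ?_)
      exact LinearMap.map_smulₛₗ₂ (E.form x) c (s.1 x) (t.1 x))
    (fun s t t' => by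
      refine Eq.trans ?_ (integral_add
        (integrable_form S (toSec E s) t s.2.2 fun x h _ => mem_supp h)
        (integrable_form S (toSec E s) t' s.2.2 fun x h _ => mem_supp h))
      refine integral_congr_ae (ae_of_all _ fun x => ?_)
      exact map_add (E.form x (s.1 x)) (t.1 x) (t'.1 x))
    (fun c s t => by
      rw [pair, pair, smul_eq_mul, ← integral_const_mul]
      refine integral_congr_ae (ae_of_all _ fun x => ?_)
      exact map_smul (E.form x (s.1 x)) c (t.1 x))

/-- The pairing is non-degenerate. -/
theorem eq_zero_of_pair {E : HermBundle.{u, v} n M} (t : Sec E)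
    (h : ∀ s : SecC E, pair S E s.1 t.1 = 0) : t = 0 := by
  refine Subtype.ext (funext fun x => E.form_nondeg x (t.1 x) fun w => ?_)
  obtain ⟨s, hs⟩ := exists_sec_apply_eq x w
  have hsm := E.form_smooth _ _ s.2 t.2
  let g : C^∞⟮𝓡 n, M; 𝓘(ℝ, ℂ), ℂ⟯ := ⟨fun y => E.form y (s.1 y) (t.1 y), hsm⟩
  obtain ⟨f, hf1, hfc, -, hf⟩ := exists_cutoff (n := n) (isCompact_singleton (x := x)) isOpen_univ
    (subset_univ _)
  choose r hr0 hr using hf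
  -- With g = (s, t) and a cut-off f ≥ 0 equal to 1 at x, testing against f g s turns the integrand
  -- into f |g|², which is continuous, nonnegative and compactly supported. A vanishing integral
  -- then forces g(x) = 0.
  have h1 := h (cutSec f hfc (mulSec E g s))
  have h2 : ∀ y, E.form y ((cutSec f hfc (mulSec E g s)).1 y) (t.1 y) =
      ((r y * Complex.normSq (g y) : ℝ) : ℂ) := by
    intro y
    rw [cutSec_val, mulSec_val, LinearMap.map_smulₛₗ₂, LinearMap.map_smulₛₗ₂, hr,
      Complex.conj_ofReal, smul_eq_mul, smul_eq_mul, Complex.ofReal_mul,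
      Complex.normSq_eq_conj_mul_self]
    rfl
  have hcont : Continuous fun y => r y * Complex.normSq (g y) := by
    have : (fun y => r y * Complex.normSq (g y)) = fun y => (f y).re * Complex.normSq (g y) :=
      funext fun y => by rw [hr, Complex.ofReal_re]
    rw [this]
    exact (Complex.continuous_re.comp f.contMDiff.continuous).mul
      (Complex.continuous_normSq.comp g.contMDiff.continuous)
  have hz : r x * Complex.normSq (g x) = 0 := by
    by_contra hne
    have hc : HasCompactSupport fun y => r y * Complex.normSq (g y) :=
      hfc.mono fun y hy h0 => hy <| by
        have : r y = 0 := by exact_mod_cast (hr y).symm.trans h0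
        simp [this]
    refine (hcont.integral_pos_of_hasCompactSupport_nonneg_nonzero (μ := S.vol) hc
      (fun y => mul_nonneg (hr0 y) (Complex.normSq_nonneg _)) hne).ne' ?_
    have h4 : ((∫ y, r y * Complex.normSq (g y) ∂S.vol : ℝ) : ℂ) = 0 :=
      (integral_ofReal (𝕜 := ℂ)).symm.trans
        ((integral_congr_ae (ae_of_all _ fun y => (h2 y).symm)).trans h1)
    exact_mod_cast h4
  have hrx : r x = 1 := by
    have := hf1.self_of_nhdsSet x rfl
    rw [hr] at this
    exact_mod_cast this
  simp only [hrx, one_mul, Complex.normSq_eq_zero] at hz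
  have h5 : E.form x (s.1 x) (t.1 x) = 0 := hz
  rw [← E.form_symm, ← hs, h5, star_zero]

section Adjoints

variable {E : HermBundle.{u, v₁} n M} {E' : HermBundle.{u, v₂} n M} {E'' : HermBundle.{u, v₃} n M}

theorem pair_sub_right (s : SecC E) (t t' : Sec E) :
    pair S E s.1 (t - t').1 = pair S E s.1 t.1 - pair S E s.1 t'.1 :=
  map_sub (pairL S E s) t t'

theorem pair_add_right (s : SecC E) (t t' : Sec E) :
    pair S E s.1 (t + t').1 = pair S E s.1 t.1 + pair S E s.1 t'.1 :=
  map_add (pairL S E s) t t'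

theorem pair_smul_right (c : ℂ) (s : SecC E) (t : Sec E) :
    pair S E s.1 (c • t).1 = c * pair S E s.1 t.1 :=
  map_smul (pairL S E s) c t

theorem pair_add_left (s s' : SecC E) (t : Sec E) :
    pair S E (s + s').1 t.1 = pair S E s.1 t.1 + pair S E s'.1 t.1 :=
  LinearMap.map_add₂ (pairL S E) s s' t

theorem pair_smul_left (c : ℂ) (s : SecC E) (t : Sec E) :
    pair S E (c • s).1 t.1 = star c * pair S E s.1 t.1 :=
  LinearMap.map_smulₛₗ₂ (pairL S E) c s t

theorem eq_of_pair {t t' : Sec E} (h : ∀ s : SecC E, pair S E s.1 t.1 = pair S E s.1 t'.1) :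
    t = t' :=
  sub_eq_zero.1 (eq_zero_of_pair S _ fun s => by rw [pair_sub_right, h, sub_self])

variable {S}

namespace IsFormalAdjoint

theorem unique {A : DiffOp E E'} {B B' : DiffOp E' E} (h : IsFormalAdjoint S A B)
    (h' : IsFormalAdjoint S A B') : B = B' :=
  DiffOp.ext_onC fun t => toSec_injective (eq_of_pair S fun s => by
    rw [toSec_val, toSec_val, ← h, ← h'])

/-- `adj` is obtained by choice; by uniqueness any explicitly known adjoint may replace it. -/
theorem adj_eq {A : DiffOp E E'} {B : DiffOp E' E} (h : IsFormalAdjoint S A B) :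
    adj S A = B := by
  have hex : ∃ B, IsFormalAdjoint S A B := ⟨B, h⟩
  rw [adj, dif_pos hex]
  exact hex.choose_spec.unique h

theorem add {A A' : DiffOp E E'} {B B' : DiffOp E' E} (h : IsFormalAdjoint S A B)
    (h' : IsFormalAdjoint S A' B') : IsFormalAdjoint S (A + A') (B + B') := fun s t =>
  (pair_add_left S (A.onC s) (A'.onC s) (toSec E' t)).trans
    ((congrArg₂ (· + ·) (h s t) (h' s t)).trans
      (pair_add_right S s (toSec E (B.onC t)) (toSec E (B'.onC t))).symm)

theorem smul {A : DiffOp E E'} {B : DiffOp E' E} (h : IsFormalAdjoint S A B) (c : ℂ) :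
    IsFormalAdjoint S (DiffOp.smul c A) (DiffOp.smul (star c) B) := fun s t =>
  (pair_smul_left S c (A.onC s) (toSec E' t)).trans
    ((congrArg (star c * ·) (h s t)).trans
      (pair_smul_right S (star c) s (toSec E (B.onC t))).symm)

end IsFormalAdjoint

end Adjoints

end Pairing

/-! ### Uniqueness and intertwining of propagators. -/

section Propagators

variable {n : ℕ} {M : Type u} [TopologicalSpace M] [ChartedSpace (EuclideanSpace ℝ (Fin n)) M]
  [IsManifold (𝓡 n) ∞ M]

/-- The sets `J(A)` and `J'(B)` have relatively compact intersection for compact `A`, `B`. -/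
def CompactlyMeet (J J' : Set M → Set M) : Prop :=
  ∀ A B, IsCompact A → IsCompact B → ∃ Q, IsCompact Q ∧ J A ∩ J' B ⊆ Q

theorem Spacetime.GloballyHyperbolic.future_past {S : Spacetime n M} (hS : S.GloballyHyperbolic) :
    CompactlyMeet S.future S.past := fun _ _ hA hB => hS.exists_compact hA hB

theorem Spacetime.GloballyHyperbolic.past_future {S : Spacetime n M} (hS : S.GloballyHyperbolic) :
    CompactlyMeet S.past S.future := fun _ _ hA hB => by
  rw [inter_comm]; exact hS.exists_compact hB hA

variable [T2Space M] [SigmaCompactSpace M] [MeasurableSpace M] [BorelSpace M] {S : Spacetime n M}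
  {E : HermBundle.{u, v₁} n M} {E' : HermBundle.{u, v₂} n M} {J J' : Set M → Set M}

/-- For a test section s one has (s | w) = (D G s | w) = (G s | D w) = 0. The propagator G has
support on the causal side opposite to w, so the supports of G s and w meet in a compact set and the
integration by parts is justified. -/
theorem IsPropagator.eq_zero_of_supp (hJ : CompactlyMeet J' J) {D : DiffOp E E}
    (hD : IsFormalAdjoint S D D) {G : SecC E →ₗ[ℂ] Sec E} (hG : IsPropagator J' D G) {w : Sec E}
    {C : Set M} (hC : IsCompact C) (hw : supp w.1 ⊆ J C) (h0 : D.toLin w = 0) : w = 0 := by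
  refine eq_zero_of_pair S w fun s => ?_
  obtain ⟨Q, hQ, hQs⟩ := hJ _ _ s.2.2 hC
  have h := hD.pair_eq (G s) w hQ ((inter_subset_inter (hG.supp_subset s) hw).trans hQs)
  rw [hG.right_inv, h0] at h
  exact h.trans (pair_eq_zero S fun x => Or.inr rfl)

/-- The difference T H s - G T s is annihilated by D, because D T = T R, and it is supported in
J(supp s); hence it vanishes. -/
theorem IsPropagator.intertwine (hJ : CompactlyMeet J' J) (hmono : ∀ A B, A ⊆ B → J A ⊆ J B)
    {D : DiffOp E E} (hD : IsFormalAdjoint S D D) {G' : SecC E →ₗ[ℂ] Sec E}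
    (hG' : IsPropagator J' D G') {G : SecC E →ₗ[ℂ] Sec E} (hG : IsPropagator J D G)
    {R : DiffOp E' E'} {H : SecC E' →ₗ[ℂ] Sec E'} (hH : IsPropagator J R H) {T : DiffOp E' E}
    (hT : D.comp T = T.comp R) (s : SecC E') : T.toLin (H s) = G (T.onC s) := by
  refine sub_eq_zero.1 (hG'.eq_zero_of_supp hJ hD (C := supp s.1) s.2.2 ?_ ?_)
  · refine (supp_sub_subset _ _).trans (union_subset ?_ ?_)
    · exact (T.supp_subset _).trans (hH.supp_subset s)
    · exact (hG.supp_subset _).trans (hmono _ _ (T.supp_subset (toSec E' s)))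
  · have h1 : D.toLin (T.toLin (H s)) = T.toLin (R.toLin (H s)) :=
      congrArg (fun A : DiffOp E' E => A.toLin (H s)) hT
    rw [map_sub, h1, hH.right_inv, hG.right_inv, DiffOp.toSec_onC, sub_self]

theorem IsPropagator.unique (hJ : CompactlyMeet J' J)
    {D : DiffOp E E} (hD : IsFormalAdjoint S D D) {G' : SecC E →ₗ[ℂ] Sec E}
    (hG' : IsPropagator J' D G') {G H : SecC E →ₗ[ℂ] Sec E} (hG : IsPropagator J D G)
    (hH : IsPropagator J D H) : G = H := by
  refine LinearMap.ext fun s => sub_eq_zero.1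
    (hG'.eq_zero_of_supp hJ hD (C := supp s.1) s.2.2 ?_ ?_)
  · exact (supp_sub_subset _ _).trans (union_subset (hG.supp_subset s) (hH.supp_subset s))
  · rw [map_sub, hG.right_inv, hH.right_inv, sub_self]

theorem IsPropagator.propagator_eq (hJ : CompactlyMeet J' J)
    {D : DiffOp E E} (hD : IsFormalAdjoint S D D) {G' : SecC E →ₗ[ℂ] Sec E}
    (hG' : IsPropagator J' D G') {G : SecC E →ₗ[ℂ] Sec E} (hG : IsPropagator J D G) :
    propagator J D = G := by
  have hex : ∃ G, IsPropagator J D G := ⟨G, hG⟩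
  rw [propagator, dif_pos hex]
  exact hG'.unique hJ hD hex.choose_spec hG

theorem isPropagator_propagator {D : DiffOp E E} (h : ∃ G, IsPropagator J D G) :
    IsPropagator J D (propagator J D) := by
  rw [propagator, dif_pos h]; exact h.choose_spec

end Propagators

/-! ### Consequences of PK = 0. -/

section Subsidiary

variable {n : ℕ} {M : Type u} [TopologicalSpace M] [ChartedSpace (EuclideanSpace ℝ (Fin n)) M]
  [IsManifold (𝓡 n) ∞ M] [T2Space M] [SigmaCompactSpace M] [MeasurableSpace M] [BorelSpace M]
  {S : Spacetime n M} {V₀ : HermBundle.{u, v₂} n M} {V₁ : HermBundle.{u, v₁} n M}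
  {P : DiffOp V₁ V₁} {K : DiffOp V₀ V₁}

/-- `adj` takes the default value 0 when there is no adjoint. In that case K*K would be 0, and a
propagator of the zero operator forces every compactly supported section to vanish, hence K = 0.
This is where K ≠ 0 enters. -/
theorem isFormalAdjoint_adj_of_green (hK : K.toLin ≠ 0)
    (hR : IsGreenHyperbolic S ((adj S K).comp K)) : IsFormalAdjoint S K (adj S K) := by
  by_cases h : ∃ B, IsFormalAdjoint S K B
  · rw [adj, dif_pos h]; exact h.choose_spec
  refine absurd ?_ hK
  obtain ⟨G, hG⟩ := hR.1.1
  have h0 : K = 0 := DiffOp.ext_onC fun s => by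
    have h1 := hG.right_inv s
    rw [adj, dif_neg h] at h1
    have h2 : s = 0 := toSec_injective (h1.symm.trans (map_zero (toSec V₀)).symm)
    rw [h2, map_zero, map_zero]
  rw [h0]; rfl

namespace IsSubsidiary

theorem adjK (h : IsSubsidiary S P K K) : IsFormalAdjoint S K (adj S K) := isFormalAdjoint_adj_of_green h.K_ne h.green_R

/-- This is the adjoint of PK = 0, since P is formally self-adjoint and the zero operator has the
unique adjoint 0. -/
theorem adjK_P (h : IsSubsidiary S P K K) : (adj S K).comp P = 0 := by
  have h1 := h.selfadj.comp h.adjK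
  have h2 : P.comp K = 0 := DiffOp.ext' h.PK
  rw [h2] at h1
  exact h1.unique fun s t => (pair_eq_zero S fun x => Or.inl rfl).trans
    (pair_eq_zero S fun x => Or.inr rfl).symm

theorem P_K (h : IsSubsidiary S P K K) (s : Sec V₀) : P.toLin (K.toLin s) = 0 := LinearMap.congr_fun h.PK s

theorem adjK_P_apply (h : IsSubsidiary S P K K) (s : Sec V₁) : (adj S K).toLin (P.toLin s) = 0 :=
  congrArg (fun A : DiffOp V₁ V₀ => A.toLin s) h.adjK_P

theorem selfadj_R (h : IsSubsidiary S P K K) : IsFormalAdjoint S ((adj S K).comp K) ((adj S K).comp K) :=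
  h.adjK.symm.comp h.adjK

theorem selfadj_D (h : IsSubsidiary S P K K) : IsFormalAdjoint S (P + K.comp (adj S K)) (P + K.comp (adj S K)) :=
  h.selfadj.add (h.adjK.comp h.adjK.symm)

/-- The cross term PK drops out. With `R_adjK` this is the pair of intertwining relations from which
the propagators inherit theirs. -/
theorem D_K (h : IsSubsidiary S P K K) : (P + K.comp (adj S K)).comp K = K.comp ((adj S K).comp K) :=
  DiffOp.ext' <| LinearMap.ext fun s => by
    change P.toLin (K.toLin s) + _ = _
    rw [h.P_K, zero_add]; rfl

theorem R_adjK (h : IsSubsidiary S P K K) : ((adj S K).comp K).comp (adj S K) = (adj S K).comp (P + K.comp (adj S K)) :=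
  DiffOp.ext' <| LinearMap.ext fun s => by
    change _ = (adj S K).toLin (P.toLin s + K.toLin ((adj S K).toLin s))
    rw [map_add, h.adjK_P_apply, zero_add]; rfl

end IsSubsidiary

end Subsidiary

/-! ### Block operators on V₁ ⊕ V₀ ⊕ V₀ ⊕ V₀ and their adjoints. -/

section Blocks

variable {n : ℕ} {M : Type u} [TopologicalSpace M] [ChartedSpace (EuclideanSpace ℝ (Fin n)) M]
  [IsManifold (𝓡 n) ∞ M] [T2Space M] [SigmaCompactSpace M] [MeasurableSpace M]
  {S : Spacetime n M} {V₀ : HermBundle.{u, v₂} n M} {V₁ : HermBundle.{u, v₁} n M}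
  {P : DiffOp V₁ V₁} {K : DiffOp V₀ V₁}

/-- The section `(a, b, c, d)` of the total bundle. -/
def mk4 : Sec V₁ × Sec V₀ × Sec V₀ × Sec V₀ → Sec (totalBundle V₁ V₀) := fun p =>
  (inclA V₁ V₀).toLin p.1 + (inclB V₁ V₀).toLin p.2.1 + (inclC V₁ V₀).toLin p.2.2.1 +
    (inclD V₁ V₀).toLin p.2.2.2

theorem mk4_apply (a : Sec V₁) (b c d : Sec V₀) (x : M) :
    (mk4 (a, b, c, d)).1 x = ((a.1 x, b.1 x, c.1 x, d.1 x) : V₁.V x × V₀.V x × V₀.V x × V₀.V x) := by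
  change (((a.1 x + 0 + 0 + 0, 0 + b.1 x + 0 + 0, 0 + 0 + c.1 x + 0, 0 + 0 + 0 + d.1 x)) :
    V₁.V x × V₀.V x × V₀.V x × V₀.V x) = _
  simp only [add_zero, zero_add]

theorem projA_mk4 (a : Sec V₁) (b c d : Sec V₀) : (projA V₁ V₀).toLin (mk4 (a, b, c, d)) = a :=
  Subtype.ext (funext fun x => congrArg Prod.fst (mk4_apply a b c d x))

theorem projB_mk4 (a : Sec V₁) (b c d : Sec V₀) : (projB V₁ V₀).toLin (mk4 (a, b, c, d)) = b :=
  Subtype.ext (funext fun x => congrArg (fun p => p.2.1) (mk4_apply a b c d x))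

theorem projC_mk4 (a : Sec V₁) (b c d : Sec V₀) : (projC V₁ V₀).toLin (mk4 (a, b, c, d)) = c :=
  Subtype.ext (funext fun x => congrArg (fun p => p.2.2.1) (mk4_apply a b c d x))

theorem projD_mk4 (a : Sec V₁) (b c d : Sec V₀) : (projD V₁ V₀).toLin (mk4 (a, b, c, d)) = d :=
  Subtype.ext (funext fun x => congrArg (fun p => p.2.2.2) (mk4_apply a b c d x))

theorem mk4_proj (s : Sec (totalBundle V₁ V₀)) :
    mk4 ((projA V₁ V₀).toLin s, (projB V₁ V₀).toLin s, (projC V₁ V₀).toLin s,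
      (projD V₁ V₀).toLin s) = s :=
  Subtype.ext (funext fun x => mk4_apply _ _ _ _ x)

theorem mk4_zero : mk4 ((0, 0, 0, 0) : Sec V₁ × Sec V₀ × Sec V₀ × Sec V₀) = 0 := by
  simp [mk4]

theorem inclB_eq (b : Sec V₀) : (inclB V₁ V₀).toLin b = mk4 (0, b, 0, 0) := by
  simp [mk4]

theorem inclC_eq (c : Sec V₀) : (inclC V₁ V₀).toLin c = mk4 (0, 0, c, 0) := by
  simp [mk4]

theorem mk4_add (a a' : Sec V₁) (b c d b' c' d' : Sec V₀) :
    mk4 (a, b, c, d) + mk4 (a', b', c', d') = mk4 (a + a', b + b', c + c', d + d') := by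
  simp only [mk4, map_add]; abel

theorem smul_mk4 (k : ℂ) (a : Sec V₁) (b c d : Sec V₀) :
    k • mk4 (a, b, c, d) = mk4 (k • a, k • b, k • c, k • d) := by
  simp only [mk4, map_smul, smul_add]

theorem brstL_eq (α : ℝ) (s : Sec (totalBundle V₁ V₀)) : (brstL S P K α).toLin s =
    mk4 (P.toLin ((projA V₁ V₀).toLin s) + K.toLin ((projB V₁ V₀).toLin s),
      (adj S K).toLin ((projA V₁ V₀).toLin s) + (-(α : ℂ)) • (projB V₁ V₀).toLin s,
      (adj S K).toLin (K.toLin ((projD V₁ V₀).toLin s)),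
      (adj S K).toLin (K.toLin ((projC V₁ V₀).toLin s))) := by
  have : (brstL S P K α).toLin s = (inclA V₁ V₀).toLin (P.toLin ((projA V₁ V₀).toLin s)) +
    (inclA V₁ V₀).toLin (K.toLin ((projB V₁ V₀).toLin s)) +
    (inclB V₁ V₀).toLin ((adj S K).toLin ((projA V₁ V₀).toLin s)) +
    (-(α : ℂ)) • (inclB V₁ V₀).toLin ((projB V₁ V₀).toLin s) +
    (inclC V₁ V₀).toLin ((adj S K).toLin (K.toLin ((projD V₁ V₀).toLin s))) +
    (inclD V₁ V₀).toLin ((adj S K).toLin (K.toLin ((projC V₁ V₀).toLin s))) := rfl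
  rw [this]
  simp only [mk4, map_add, map_smul]
  abel

theorem brstGamma_eq (s : Sec (totalBundle V₁ V₀)) : (brstGamma K).toLin s =
    mk4 (K.toLin ((projC V₁ V₀).toLin s), 0, 0, (projB V₁ V₀).toLin s) := by
  have : (brstGamma K).toLin s = (inclA V₁ V₀).toLin (K.toLin ((projC V₁ V₀).toLin s)) +
    (inclD V₁ V₀).toLin ((projB V₁ V₀).toLin s) := rfl
  rw [this]
  simp [mk4]

theorem brstTwoPoint_eq (ε : ℂ) (lD : SecC V₁ →ₗ[ℂ] Sec V₁) (lR : SecC V₀ →ₗ[ℂ] Sec V₀)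
    (s : SecC (totalBundle V₁ V₀)) : brstTwoPoint S K ε lD lR s =
    mk4 (lD ((projA V₁ V₀).onC s) + K.toLin (lR ((projB V₁ V₀).onC s)),
      lR ((adj S K).onC ((projA V₁ V₀).onC s)),
      ε • lR ((projD V₁ V₀).onC s), ε • lR ((projC V₁ V₀).onC s)) := by
  have : brstTwoPoint S K ε lD lR s = (inclA V₁ V₀).toLin (lD ((projA V₁ V₀).onC s)) +
    (inclA V₁ V₀).toLin (K.toLin (lR ((projB V₁ V₀).onC s))) +
    (inclB V₁ V₀).toLin (lR ((adj S K).onC ((projA V₁ V₀).onC s))) +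
    ε • (inclC V₁ V₀).toLin (lR ((projD V₁ V₀).onC s)) +
    ε • (inclD V₁ V₀).toLin (lR ((projC V₁ V₀).onC s)) := rfl
  rw [this]
  simp only [mk4, map_add, map_smul]

/-- The formal adjoint of `γ`. -/
def brstGammaAdj (S : Spacetime n M) (K : DiffOp V₀ V₁) :
    DiffOp (totalBundle V₁ V₀) (totalBundle V₁ V₀) :=
  (inclC V₁ V₀).comp ((adj S K).comp (projA V₁ V₀)) + (inclB V₁ V₀).comp (projD V₁ V₀)

theorem brstGammaAdj_eq (s : Sec (totalBundle V₁ V₀)) : (brstGammaAdj S K).toLin s =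
    mk4 (0, (projD V₁ V₀).toLin s, (adj S K).toLin ((projA V₁ V₀).toLin s), 0) := by
  have : (brstGammaAdj S K).toLin s = (inclC V₁ V₀).toLin ((adj S K).toLin
    ((projA V₁ V₀).toLin s)) + (inclB V₁ V₀).toLin ((projD V₁ V₀).toLin s) := rfl
  rw [this, inclC_eq, inclB_eq, mk4_add]
  simp only [add_zero, zero_add]

theorem adj_inclA : IsFormalAdjoint S (inclA V₁ V₀) (projA V₁ V₀) := fun s t =>
  integral_congr_ae (ae_of_all _ fun x => by
    change V₁.form x (s.1 x) (t.1 x).1 + (V₀.form x 0 _ + (V₀.form x 0 _ + V₀.form x 0 _)) = _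
    simp only [map_zero, LinearMap.zero_apply, add_zero]
    rfl)

theorem adj_inclB : IsFormalAdjoint S (inclB V₁ V₀) (projB V₁ V₀) := fun s t =>
  integral_congr_ae (ae_of_all _ fun x => by
    change V₁.form x 0 _ + (V₀.form x (s.1 x) (t.1 x).2.1 + (V₀.form x 0 _ + V₀.form x 0 _)) = _
    simp only [map_zero, LinearMap.zero_apply, add_zero, zero_add]
    rfl)

theorem adj_inclC : IsFormalAdjoint S (inclC V₁ V₀) (projC V₁ V₀) := fun s t =>
  integral_congr_ae (ae_of_all _ fun x => by
    change V₁.form x 0 _ + (V₀.form x 0 _ + (V₀.form x (s.1 x) (t.1 x).2.2.1 + V₀.form x 0 _)) = _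
    simp only [map_zero, LinearMap.zero_apply, add_zero, zero_add]
    rfl)

theorem adj_inclD : IsFormalAdjoint S (inclD V₁ V₀) (projD V₁ V₀) := fun s t =>
  integral_congr_ae (ae_of_all _ fun x => by
    change V₁.form x 0 _ + (V₀.form x 0 _ + (V₀.form x 0 _ + V₀.form x (s.1 x) (t.1 x).2.2.2)) = _
    simp only [map_zero, LinearMap.zero_apply, zero_add]
    rfl)

variable [BorelSpace M]

theorem adj_brstGamma (hK : IsFormalAdjoint S K (adj S K)) :
    IsFormalAdjoint S (brstGamma K) (brstGammaAdj S K) :=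
  (adj_inclA.comp (hK.comp adj_inclC.symm)).add (adj_inclD.comp adj_inclB.symm)

theorem adj_brstL (hP : IsFormalAdjoint S P P) (hK : IsFormalAdjoint S K (adj S K)) :
    IsFormalAdjoint S (brstL S P K 1) (brstL S P K 1) := by
  have hR := hK.symm.comp hK
  have h1 := (adj_inclA.comp (hP.comp (adj_inclA (V₀ := V₀)).symm)).add
    (adj_inclA.comp (hK.comp adj_inclB.symm)) |>.add
    (adj_inclB.comp (hK.symm.comp adj_inclA.symm)) |>.add
    ((adj_inclB.comp (adj_inclB (V₁ := V₁)).symm).smul (-((1 : ℝ) : ℂ))) |>.add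
    (adj_inclC.comp (hR.comp adj_inclD.symm)) |>.add
    (adj_inclD.comp (hR.comp adj_inclC.symm))
  -- Taking adjoints term by term exchanges the two blocks K, K* and the two ghost blocks; it
  -- remains to reorder the sum.
  refine (congrArg (IsFormalAdjoint S (brstL S P K 1)) (Eq.symm ?_)).mp h1
  refine DiffOp.ext' (LinearMap.ext fun s => ?_)
  have : (brstL S P K 1).toLin s = (inclA V₁ V₀).toLin (P.toLin ((projA V₁ V₀).toLin s)) +
    (inclA V₁ V₀).toLin (K.toLin ((projB V₁ V₀).toLin s)) +
    (inclB V₁ V₀).toLin ((adj S K).toLin ((projA V₁ V₀).toLin s)) +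
    (-((1 : ℝ) : ℂ)) • (inclB V₁ V₀).toLin ((projB V₁ V₀).toLin s) +
    (inclC V₁ V₀).toLin ((adj S K).toLin (K.toLin ((projD V₁ V₀).toLin s))) +
    (inclD V₁ V₀).toLin ((adj S K).toLin (K.toLin ((projC V₁ V₀).toLin s))) := rfl
  refine this.trans (Eq.trans ?_ (show
    (inclA V₁ V₀).toLin (P.toLin ((projA V₁ V₀).toLin s)) +
    (inclB V₁ V₀).toLin ((adj S K).toLin ((projA V₁ V₀).toLin s)) +
    (inclA V₁ V₀).toLin (K.toLin ((projB V₁ V₀).toLin s)) +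
    (star (-((1 : ℝ) : ℂ))) • (inclB V₁ V₀).toLin ((projB V₁ V₀).toLin s) +
    (inclD V₁ V₀).toLin ((adj S K).toLin (K.toLin ((projC V₁ V₀).toLin s))) +
    (inclC V₁ V₀).toLin ((adj S K).toLin (K.toLin ((projD V₁ V₀).toLin s))) = _ from rfl))
  have h2 : star (-((1 : ℝ) : ℂ)) = -((1 : ℝ) : ℂ) := by simp
  rw [h2]
  abel

end Blocks

/-! ### Continuity of compositions with differential operators. -/

section Continuity

variable {n : ℕ} {M : Type u} [TopologicalSpace M] [ChartedSpace (EuclideanSpace ℝ (Fin n)) M]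
  {E : HermBundle.{u, v₁} n M} {E' : HermBundle.{u, v₂} n M} {E'' : HermBundle.{u, v₃} n M}

/-- Convergence is tested by all scalar differential operators, a class stable under composition on
the right with B. -/
theorem TendstoZero.map {s : ℕ → Sec E} (hs : TendstoZero s) (B : DiffOp E E') :
    TendstoZero fun k => B.toLin (s k) := fun A C hC => hs (A.comp B) C hC

theorem TendstoZero.add {s t : ℕ → Sec E} (hs : TendstoZero s) (ht : TendstoZero t) :
    TendstoZero fun k => s k + t k := fun A C hC => by
  have h := (hs A C hC).fun_add (ht A C hC)
  simp only [add_zero] at h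
  refine h.congr (Eventually.of_forall fun k x _ => ?_)
  change _ = (A.toLin (s k + t k)).1 x
  rw [map_add]; rfl

theorem TendstoZero.smul (c : ℂ) {s : ℕ → Sec E} (hs : TendstoZero s) :
    TendstoZero fun k => c • s k := fun A C hC => by
  refine (hs (DiffOp.smul c A) C hC).congr (Eventually.of_forall fun k x _ => ?_)
  change _ = (A.toLin (c • s k)).1 x
  rw [map_smul]; rfl

theorem IsContinuousOp.comp_right {T : SecC E' →ₗ[ℂ] Sec E''} (hT : IsContinuousOp T)
    (A : DiffOp E E') : IsContinuousOp (T ∘ₗ A.onC) := fun s ⟨C, hC, hs⟩ h0 =>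
  hT _ ⟨C, hC, fun k => (A.supp_subset (toSec E (s k))).trans (hs k)⟩ (h0.map A)

theorem IsContinuousOp.comp_left {T : SecC E →ₗ[ℂ] Sec E'} (hT : IsContinuousOp T)
    (B : DiffOp E' E'') : IsContinuousOp (B.toLin ∘ₗ T) := fun s hs h0 => (hT s hs h0).map B

theorem IsContinuousOp.add {T T' : SecC E →ₗ[ℂ] Sec E'} (hT : IsContinuousOp T)
    (hT' : IsContinuousOp T') : IsContinuousOp (T + T') := fun s hs h0 =>
  (hT s hs h0).add (hT' s hs h0)

theorem IsContinuousOp.smul (c : ℂ) {T : SecC E →ₗ[ℂ] Sec E'} (hT : IsContinuousOp T) :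
    IsContinuousOp (c • T) := fun s hs h0 => (hT s hs h0).smul c

end Continuity

/-! ### Propagators of L. -/

section Blocks

variable {n : ℕ} {M : Type u} [TopologicalSpace M] [ChartedSpace (EuclideanSpace ℝ (Fin n)) M]
  [IsManifold (𝓡 n) ∞ M] [T2Space M] [SigmaCompactSpace M] [MeasurableSpace M] [BorelSpace M]
  {S : Spacetime n M} {V₀ : HermBundle.{u, v₂} n M} {V₁ : HermBundle.{u, v₁} n M}
  {P : DiffOp V₁ V₁} {K : DiffOp V₀ V₁}

theorem supp_mk4_subset (a : Sec V₁) (b c d : Sec V₀) {Z : Set M} (ha : supp a.1 ⊆ Z)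
    (hb : supp b.1 ⊆ Z) (hc : supp c.1 ⊆ Z) (hd : supp d.1 ⊆ Z) :
    supp (mk4 (a, b, c, d)).1 ⊆ Z := by
  refine (supp_add_subset _ _).trans (union_subset ((supp_add_subset _ _).trans
    (union_subset ((supp_add_subset _ _).trans (union_subset ?_ ?_)) ?_)) ?_)
  · exact ((inclA V₁ V₀).supp_subset a).trans ha
  · exact ((inclB V₁ V₀).supp_subset b).trans hb
  · exact ((inclC V₁ V₀).supp_subset c).trans hc
  · exact ((inclD V₁ V₀).supp_subset d).trans hd

theorem projA_onC_brstL (s : SecC (totalBundle V₁ V₀)) :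
    (projA V₁ V₀).onC ((brstL S P K 1).onC s) =
      P.onC ((projA V₁ V₀).onC s) + K.onC ((projB V₁ V₀).onC s) := by
  refine toSec_injective ?_
  rw [DiffOp.toSec_onC, DiffOp.toSec_onC, brstL_eq, projA_mk4]; rfl

theorem projB_onC_brstL (s : SecC (totalBundle V₁ V₀)) :
    (projB V₁ V₀).onC ((brstL S P K 1).onC s) =
      (adj S K).onC ((projA V₁ V₀).onC s) - (projB V₁ V₀).onC s := by
  refine toSec_injective ?_
  rw [DiffOp.toSec_onC, DiffOp.toSec_onC, brstL_eq, projB_mk4, Complex.ofReal_one, neg_one_smul,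
    ← sub_eq_add_neg]
  rfl

theorem projC_onC_brstL (s : SecC (totalBundle V₁ V₀)) :
    (projC V₁ V₀).onC ((brstL S P K 1).onC s) =
      ((adj S K).comp K).onC ((projD V₁ V₀).onC s) := by
  refine toSec_injective ?_
  rw [DiffOp.toSec_onC, DiffOp.toSec_onC, brstL_eq, projC_mk4]; rfl

theorem projD_onC_brstL (s : SecC (totalBundle V₁ V₀)) :
    (projD V₁ V₀).onC ((brstL S P K 1).onC s) =
      ((adj S K).comp K).onC ((projC V₁ V₀).onC s) := by
  refine toSec_injective ?_
  rw [DiffOp.toSec_onC, DiffOp.toSec_onC, brstL_eq, projD_mk4]; rfl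

theorem adjK_onC_P (h : IsSubsidiary S P K K) (s : SecC V₁) : (adj S K).onC (P.onC s) = 0 :=
  toSec_injective (by
    rw [DiffOp.toSec_onC, DiffOp.toSec_onC, h.adjK_P_apply, map_zero])

theorem onC_D (s : SecC V₁) : (P + K.comp (adj S K)).onC s =
    P.onC s + K.onC ((adj S K).onC s) := rfl

/-- The block operator of operators `lD`, `lR` intertwined by `K` applied to `Ran L`. -/
theorem brstTwoPoint_brstL (h : IsSubsidiary S P K K) (ε : ℂ) {lD : SecC V₁ →ₗ[ℂ] Sec V₁}
    {lR : SecC V₀ →ₗ[ℂ] Sec V₀} (hK : ∀ s, K.toLin (lR s) = lD (K.onC s))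
    (s : SecC (totalBundle V₁ V₀)) : brstTwoPoint S K ε lD lR ((brstL S P K 1).onC s) =
      mk4 (lD ((P + K.comp (adj S K)).onC ((projA V₁ V₀).onC s)),
        lR (((adj S K).comp K).onC ((projB V₁ V₀).onC s)),
        ε • lR (((adj S K).comp K).onC ((projC V₁ V₀).onC s)),
        ε • lR (((adj S K).comp K).onC ((projD V₁ V₀).onC s))) := by
  rw [brstTwoPoint_eq, projA_onC_brstL, projB_onC_brstL, projC_onC_brstL, projD_onC_brstL]
  congr 2
  · simp only [hK, onC_D, map_add, map_sub]; abel
  · rw [map_add, adjK_onC_P h, zero_add]; rfl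

/-- For L on the left: PG + KHK* = PG + KK*G = DG = 1, PKH = 0, K*G - HK* = 0 and K*KH = 1, so only
the intertwining relations and PK = 0 are needed. For L on the right this is `brstTwoPoint_brstL`.
-/
theorem isPropagator_brst (h : IsSubsidiary S P K K) {J : Set M → Set M}
    (hmono : ∀ A B, A ⊆ B → J A ⊆ J B) {G : SecC V₁ →ₗ[ℂ] Sec V₁} {H : SecC V₀ →ₗ[ℂ] Sec V₀}
    (hG : IsPropagator J (P + K.comp (adj S K)) G) (hH : IsPropagator J ((adj S K).comp K) H)
    (hKH : ∀ s, K.toLin (H s) = G (K.onC s))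
    (hKG : ∀ s, (adj S K).toLin (G s) = H ((adj S K).onC s)) :
    IsPropagator J (brstL S P K 1) (brstTwoPoint S K 1 G H) where
  right_inv s := by
    have hD := hG.right_inv ((projA V₁ V₀).onC s)
    have hR (t : SecC V₀) : (adj S K).toLin (K.toLin (H t)) = toSec V₀ t := hH.right_inv t
    have hD' : P.toLin (G ((projA V₁ V₀).onC s)) + K.toLin ((adj S K).toLin
      (G ((projA V₁ V₀).onC s))) = toSec V₁ ((projA V₁ V₀).onC s) := hD
    rw [brstTwoPoint_eq, brstL_eq, projA_mk4, projB_mk4, projC_mk4, projD_mk4, one_smul, one_smul,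
      hR, hR, map_add, map_add, hR, h.P_K, add_zero, ← hKG, hD', Complex.ofReal_one, neg_one_smul,
      add_neg_cancel_comm]
    exact mk4_proj (toSec _ s)
  left_inv s := by
    rw [brstTwoPoint_brstL h 1 hKH, hG.left_inv, hH.left_inv, hH.left_inv, hH.left_inv, one_smul,
      one_smul]
    exact mk4_proj (toSec _ s)
  supp_subset s := by
    rw [brstTwoPoint_eq]
    have hA : supp ((projA V₁ V₀).onC s).1 ⊆ supp s.1 := (projA V₁ V₀).supp_subset (toSec _ s)
    have hB : supp ((projB V₁ V₀).onC s).1 ⊆ supp s.1 := (projB V₁ V₀).supp_subset (toSec _ s)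
    have hC : supp ((projC V₁ V₀).onC s).1 ⊆ supp s.1 := (projC V₁ V₀).supp_subset (toSec _ s)
    have hD : supp ((projD V₁ V₀).onC s).1 ⊆ supp s.1 := (projD V₁ V₀).supp_subset (toSec _ s)
    refine supp_mk4_subset _ _ _ _ ?_ ?_ ?_ ?_
    · refine (supp_add_subset _ _).trans (union_subset ?_ ?_)
      · exact (hG.supp_subset _).trans (hmono _ _ hA)
      · exact (K.supp_subset _).trans ((hH.supp_subset _).trans (hmono _ _ hB))
    · exact (hH.supp_subset _).trans (hmono _ _ (((adj S K).supp_subset (toSec _ _)).trans hA))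
    · rw [one_smul]; exact (hH.supp_subset _).trans (hmono _ _ hD)
    · rw [one_smul]; exact (hH.supp_subset _).trans (hmono _ _ hC)

/-- The opposite propagators (for J') enter only through uniqueness, which gives the two
intertwining relations. -/
theorem isPropagator_brstL (h : IsSubsidiary S P K K) {J J' : Set M → Set M}
    (hJ : CompactlyMeet J' J) (hmono : ∀ A B, A ⊆ B → J A ⊆ J B)
    (hD : ∃ G, IsPropagator J (P + K.comp (adj S K)) G)
    (hD' : ∃ G, IsPropagator J' (P + K.comp (adj S K)) G)
    (hR : ∃ G, IsPropagator J ((adj S K).comp K) G)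
    (hR' : ∃ G, IsPropagator J' ((adj S K).comp K) G) :
    IsPropagator J (brstL S P K 1) (brstTwoPoint S K 1 (propagator J (P + K.comp (adj S K)))
      (propagator J ((adj S K).comp K))) := by
  have h1 := isPropagator_propagator hD
  have h2 := isPropagator_propagator hR
  obtain ⟨G', hG'⟩ := hD'
  obtain ⟨H', hH'⟩ := hR'
  exact isPropagator_brst h hmono h1 h2
    (hG'.intertwine hJ hmono h.selfadj_D h1 h2 h.D_K)
    (hH'.intertwine hJ hmono h.selfadj_R h2 h1 h.R_adjK)

theorem hasPropagators_brstL (hS : S.GloballyHyperbolic) (h : IsSubsidiary S P K K) :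
    HasPropagators S (brstL S P K 1) :=
  ⟨⟨_, isPropagator_brstL h hS.past_future (fun _ _ => S.future_mono) h.green_D.1.1 h.green_D.1.2
    h.green_R.1.1 h.green_R.1.2⟩,
  ⟨_, isPropagator_brstL h hS.future_past (fun _ _ => S.past_mono) h.green_D.1.2 h.green_D.1.1
    h.green_R.1.2 h.green_R.1.1⟩⟩

theorem isGreenHyperbolic_brstL (hS : S.GloballyHyperbolic) (h : IsSubsidiary S P K K) :
    IsGreenHyperbolic S (brstL S P K 1) := by
  refine ⟨hasPropagators_brstL hS h, ?_⟩
  rw [(adj_brstL h.selfadj h.adjK).adj_eq]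
  exact hasPropagators_brstL hS h

/-- The propagators chosen in the definition of G_L are the block ones by uniqueness, and the block
operator is linear in the pair (lD, lR) for fixed ε. -/
theorem causalPropagator_brstL (hS : S.GloballyHyperbolic) (h : IsSubsidiary S P K K) :
    causalPropagator S (brstL S P K 1) =
      brstTwoPoint S K 1 (causalPropagator S (P + K.comp (adj S K)))
        (causalPropagator S ((adj S K).comp K)) := by
  have h1 := isPropagator_brstL h hS.past_future (fun _ _ => S.future_mono) h.green_D.1.1
    h.green_D.1.2 h.green_R.1.1 h.green_R.1.2
  have h2 := isPropagator_brstL h hS.future_past (fun _ _ => S.past_mono) h.green_D.1.2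
    h.green_D.1.1 h.green_R.1.2 h.green_R.1.1
  have hL := adj_brstL h.selfadj h.adjK
  rw [causalPropagator, h2.propagator_eq hS.past_future hL h1,
    h1.propagator_eq hS.future_past hL h2, causalPropagator, causalPropagator]
  refine LinearMap.ext fun s => ?_
  rw [LinearMap.sub_apply, brstTwoPoint_eq, brstTwoPoint_eq, brstTwoPoint_eq]
  simp only [LinearMap.sub_apply, mk4, map_sub, map_add, one_smul]
  abel

end Blocks

/-! ### Ghost grading, BRST hypotheses and bosonic two-point functions for L. -/

section Ghost

variable {n : ℕ} {M : Type u} [TopologicalSpace M] [ChartedSpace (EuclideanSpace ℝ (Fin n)) M]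
  [IsManifold (𝓡 n) ∞ M] [T2Space M] [SigmaCompactSpace M] [MeasurableSpace M] [BorelSpace M]
  {S : Spacetime n M} {V₀ : HermBundle.{u, v₂} n M} {V₁ : HermBundle.{u, v₁} n M}
  {P : DiffOp V₁ V₁} {K : DiffOp V₀ V₁}

theorem single_proj_apply {E : HermBundle.{u, v} n M} (i d : ℤ) (x : M) (v : E.V x) :
    (Grading.single E d).proj i x v = if i = d then v else 0 := by
  change (if i = d then LinearMap.id else 0 : E.V x →ₗ[ℂ] E.V x) v = _
  split_ifs <;> rfl

theorem ghost_proj_mk4 (i : ℤ) (x : M) (a : Sec V₁) (b c d : Sec V₀) :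
    (ghostGrading V₁ V₀).proj i x ((mk4 (a, b, c, d)).1 x) =
      (mk4 (if i = 0 then a else 0, if i = 0 then b else 0, if i = 1 then c else 0,
        if i = -1 then d else 0)).1 x := by
  rw [mk4_apply, mk4_apply]
  change (((Grading.single V₁ 0).proj i x (a.1 x), (Grading.single V₀ 0).proj i x (b.1 x),
    (Grading.single V₀ 1).proj i x (c.1 x), (Grading.single V₀ (-1)).proj i x (d.1 x)) :
    V₁.V x × V₀.V x × V₀.V x × V₀.V x) = _
  simp only [single_proj_apply]
  split_ifs <;> rfl

theorem mk4_inj {a a' : Sec V₁} {b c d b' c' d' : Sec V₀}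
    (h : mk4 (a, b, c, d) = mk4 (a', b', c', d')) : a = a' ∧ b = b' ∧ c = c' ∧ d = d' := by
  refine ⟨?_, ?_, ?_, ?_⟩
  · rw [← projA_mk4 a b c d, h, projA_mk4]
  · rw [← projB_mk4 a b c d, h, projB_mk4]
  · rw [← projC_mk4 a b c d, h, projC_mk4]
  · rw [← projD_mk4 a b c d, h, projD_mk4]

theorem hasDegree_mk4 (i : ℤ) (a : Sec V₁) (b c d : Sec V₀) :
    (ghostGrading V₁ V₀).HasDegree i (mk4 (a, b, c, d)).1 ↔
      (i ≠ 0 → a = 0) ∧ (i ≠ 0 → b = 0) ∧ (i ≠ 1 → c = 0) ∧ (i ≠ -1 → d = 0) := by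
  have h : (ghostGrading V₁ V₀).HasDegree i (mk4 (a, b, c, d)).1 ↔
      mk4 (if i = 0 then a else 0, if i = 0 then b else 0, if i = 1 then c else 0,
        if i = -1 then d else 0) = mk4 (a, b, c, d) :=
    ⟨fun h => Subtype.ext (funext fun x => (ghost_proj_mk4 i x a b c d).symm.trans (h x)),
      fun h x => (ghost_proj_mk4 i x a b c d).trans (congrArg (fun s : Sec _ => s.1 x) h)⟩
  rw [h]
  constructor
  · intro h
    obtain ⟨h1, h2, h3, h4⟩ := mk4_inj h
    refine ⟨fun hi => ?_, fun hi => ?_, fun hi => ?_, fun hi => ?_⟩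
    · rw [if_neg hi] at h1; exact h1.symm
    · rw [if_neg hi] at h2; exact h2.symm
    · rw [if_neg hi] at h3; exact h3.symm
    · rw [if_neg hi] at h4; exact h4.symm
  · rintro ⟨h1, h2, h3, h4⟩
    have e1 : (if i = 0 then a else 0) = a := by split_ifs with hi <;> [rfl; exact (h1 hi).symm]
    have e2 : (if i = 0 then b else 0) = b := by split_ifs with hi <;> [rfl; exact (h2 hi).symm]
    have e3 : (if i = 1 then c else 0) = c := by split_ifs with hi <;> [rfl; exact (h3 hi).symm]
    have e4 : (if i = -1 then d else 0) = d := by split_ifs with hi <;> [rfl; exact (h4 hi).symm]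
    rw [e1, e2, e3, e4]

theorem hasDegree_iff (i : ℤ) (s : Sec (totalBundle V₁ V₀)) :
    (ghostGrading V₁ V₀).HasDegree i s.1 ↔
      (i ≠ 0 → (projA V₁ V₀).toLin s = 0) ∧ (i ≠ 0 → (projB V₁ V₀).toLin s = 0) ∧
      (i ≠ 1 → (projC V₁ V₀).toLin s = 0) ∧ (i ≠ -1 → (projD V₁ V₀).toLin s = 0) := by
  rw [← hasDegree_mk4, mk4_proj]

theorem toSec_eq_zero {E : HermBundle.{u, v} n M} {t : SecC E} : toSec E t = 0 ↔ t = 0 :=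
  ⟨fun h => toSec_injective (h.trans (map_zero _).symm), fun h => by rw [h, map_zero]⟩

theorem hasDegree_onC_iff (i : ℤ) (s : SecC (totalBundle V₁ V₀)) :
    (ghostGrading V₁ V₀).HasDegree i s.1 ↔
      (i ≠ 0 → (projA V₁ V₀).onC s = 0) ∧ (i ≠ 0 → (projB V₁ V₀).onC s = 0) ∧
      (i ≠ 1 → (projC V₁ V₀).onC s = 0) ∧ (i ≠ -1 → (projD V₁ V₀).onC s = 0) := by
  rw [← toSec_eq_zero, ← toSec_eq_zero, ← toSec_eq_zero, ← toSec_eq_zero]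
  exact hasDegree_iff i (toSec _ s)

theorem ghostGrading_idx : (ghostGrading V₁ V₀).idx = {-1, 0, 1} := by
  change ({0} ∪ ({0} ∪ ({1} ∪ {-1})) : Finset ℤ) = _
  decide

theorem single_orthogonal {i j : ℤ} (hij : i ≠ j) {E : HermBundle.{u, v} n M} (d : ℤ) {x : M}
    (v w : E.V x) :
    E.form x ((Grading.single E d).proj i x v) ((Grading.single E d).proj j x w) = 0 := by
  rw [single_proj_apply, single_proj_apply]
  by_cases hi : i = d
  · have hj : j ≠ d := fun h => hij (hi.trans h.symm)
    rw [if_neg hj, map_zero]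
  · rw [if_neg hi, map_zero, LinearMap.zero_apply]

theorem ghost_orthogonal (i j : ℤ) (hij : i ≠ j) (x : M) (v w : (totalBundle V₁ V₀).V x) :
    (totalBundle V₁ V₀).form x ((ghostGrading V₁ V₀).proj i x v)
      ((ghostGrading V₁ V₀).proj j x w) = 0 := by
  have h1 := single_orthogonal hij (E := V₁) 0 v.1 w.1
  have h2 := single_orthogonal hij (E := V₀) 0 v.2.1 w.2.1
  have h3 := single_orthogonal hij (E := V₀) 1 v.2.2.1 w.2.2.1
  have h4 := single_orthogonal hij (E := V₀) (-1) v.2.2.2 w.2.2.2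
  change V₁.form x ((Grading.single V₁ 0).proj i x v.1) ((Grading.single V₁ 0).proj j x w.1) +
    (V₀.form x ((Grading.single V₀ 0).proj i x v.2.1) ((Grading.single V₀ 0).proj j x w.2.1) +
    (V₀.form x ((Grading.single V₀ 1).proj i x v.2.2.1) ((Grading.single V₀ 1).proj j x w.2.2.1) +
    V₀.form x ((Grading.single V₀ (-1)).proj i x v.2.2.2)
      ((Grading.single V₀ (-1)).proj j x w.2.2.2))) = 0
  rw [h1, h2, h3, h4]; simp

/-- The identity γ*L = Lγ reduces to PK = 0 and K*P = 0: both sides send (a, b, c, d) to (0, K*K c,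
K*K b, 0). -/
theorem isBRST (hS : S.GloballyHyperbolic) (h : IsSubsidiary S P K K) :
    IsBRST S (ghostGrading V₁ V₀) (brstL S P K 1) (brstGamma K) where
  idx_eq := ghostGrading_idx
  orthogonal := ghost_orthogonal
  γ_sq := LinearMap.ext fun s => by
    rw [LinearMap.comp_apply, brstGamma_eq, brstGamma_eq, projB_mk4, projC_mk4, map_zero, mk4_zero]
    rfl
  γ_degree i hi s hs := by
    obtain ⟨h1, h2, h3, h4⟩ := (hasDegree_iff i s).1 hs
    rw [brstGamma_eq, hasDegree_mk4]
    refine ⟨fun h' => ?_, fun _ => rfl, fun _ => rfl, fun h' => ?_⟩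
    · rw [h3 (by omega), map_zero]
    · exact h2 (by omega)
  homology s hs _ := by
    -- A section of degree -1 is (0, 0, 0, d), and γ (0, d, 0, 0) = (0, 0, 0, d).
    refine ⟨(inclB V₁ V₀).onC ((projD V₁ V₀).onC s), toSec_injective ?_⟩
    obtain ⟨h1, h2, h3, -⟩ := (hasDegree_iff (-1) (toSec _ s)).1 hs
    rw [DiffOp.toSec_onC, DiffOp.toSec_onC, brstGamma_eq, inclB_eq, projB_mk4, projC_mk4, map_zero,
      ← mk4_proj (toSec _ s), h1 (by omega), h2 (by omega), h3 (by omega)]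
    rfl
  L_green := isGreenHyperbolic_brstL hS h
  L_selfadj := adj_brstL h.selfadj h.adjK
  L_γ := LinearMap.ext fun s => by
    rw [(adj_brstGamma h.adjK).adj_eq, LinearMap.comp_apply, LinearMap.comp_apply, brstGammaAdj_eq,
      brstL_eq, brstL_eq, brstGamma_eq, projA_mk4, projD_mk4, projA_mk4, projB_mk4, projC_mk4,
      projD_mk4]
    simp only [map_add, map_zero, smul_zero, add_zero, h.P_K, h.adjK_P_apply, zero_add]
  L_degree i hi s hs := by
    obtain ⟨h1, h2, h3, h4⟩ := (hasDegree_iff i s).1 hs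
    rw [brstL_eq, hasDegree_mk4]
    refine ⟨fun h' => ?_, fun h' => ?_, fun h' => ?_, fun h' => ?_⟩
    · rw [h1 (by omega), h2 (by omega), map_zero, map_zero, add_zero]
    · rw [h1 (by omega), h2 (by omega), map_zero, smul_zero, add_zero]
    · rw [h4 (by omega), map_zero, map_zero]
    · rw [h3 (by omega), map_zero, map_zero]

theorem pair_mk4 (s : SecC (totalBundle V₁ V₀)) (a : Sec V₁) (b c d : Sec V₀) :
    pair S _ s.1 (mk4 (a, b, c, d)).1 = pair S V₁ ((projA V₁ V₀).onC s).1 a.1 +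
      pair S V₀ ((projB V₁ V₀).onC s).1 b.1 + pair S V₀ ((projC V₁ V₀).onC s).1 c.1 +
      pair S V₀ ((projD V₁ V₀).onC s).1 d.1 := by
  rw [mk4, pair_add_right, pair_add_right, pair_add_right, adj_inclA.symm.pair_left,
    adj_inclB.symm.pair_left, adj_inclC.symm.pair_left, adj_inclD.symm.pair_left]

/-- Hermiticity pairs the block K lR with lR K*, and each ghost block with the other one, for which
ε has to be real. The equation of motion is `brstTwoPoint_brstL`. -/
theorem isTwoPointPart_brst (h : IsSubsidiary S P K K) {ε : ℂ} (hε : star ε = ε)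
    {lD : SecC V₁ →ₗ[ℂ] Sec V₁} {lR : SecC V₀ →ₗ[ℂ] Sec V₀}
    (hD : IsTwoPointPart S (Grading.single V₁ 0) (P + K.comp (adj S K)) lD)
    (hR : IsTwoPointPart S (Grading.single V₀ 0) ((adj S K).comp K) lR)
    (hK : ∀ s, K.toLin (lR s) = lD (K.onC s)) :
    IsTwoPointPart S (ghostGrading V₁ V₀) (brstL S P K 1) (brstTwoPoint S K ε lD lR) where
  continuous :=
    ((((hD.continuous.comp_right (projA V₁ V₀)).comp_left (inclA V₁ V₀)).add
      (((hR.continuous.comp_right (projB V₁ V₀)).comp_left K).comp_left (inclA V₁ V₀))).add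
      (((hR.continuous.comp_right (adj S K)).comp_right (projA V₁ V₀)).comp_left (inclB V₁ V₀))
      |>.add (((hR.continuous.comp_right (projD V₁ V₀)).comp_left (inclC V₁ V₀)).smul ε)).add
      (((hR.continuous.comp_right (projC V₁ V₀)).comp_left (inclD V₁ V₀)).smul ε)
  herm s t := by
    have e1 (a b : SecC V₁) : star (pair S V₁ a.1 (lD b).1) = pair S V₁ b.1 (lD a).1 := by
      rw [pair_conj, hD.herm]
    have e2 (a b : SecC V₀) : star (pair S V₀ a.1 (lR b).1) = pair S V₀ b.1 (lR a).1 := by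
      rw [pair_conj, hR.herm]
    -- `pair_mk4` expands only the second argument of the pairing, so (l s | t) is rewritten as the
    -- conjugate of (t | l s).
    rw [← pair_conj S (t.1), brstTwoPoint_eq, brstTwoPoint_eq, pair_mk4, pair_mk4]
    simp only [pair_add_right, pair_smul_right, star_add, star_mul', hε, e1, e2,
      ← h.adjK.symm.pair_left]
    ring
  eom s := by
    rw [brstTwoPoint_brstL h ε hK, hD.eom, hR.eom, hR.eom, hR.eom, smul_zero, mk4_zero]
  degree i hi s hs := by
    obtain ⟨h1, h2, h3, h4⟩ := (hasDegree_onC_iff i s).1 hs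
    rw [brstTwoPoint_eq, hasDegree_mk4]
    refine ⟨fun h' => ?_, fun h' => ?_, fun h' => ?_, fun h' => ?_⟩
    · rw [h1 (by omega), h2 (by omega), map_zero, map_zero, map_zero, add_zero]
    · rw [h1 (by omega), map_zero, map_zero]
    · rw [h4 (by omega), map_zero, smul_zero]
    · rw [h3 (by omega), map_zero, smul_zero]

/-- In degree 0 the sign (-1)^{ij} is 1 and the projection is the identity. -/
theorem IsBosonicTwoPoint.single_ccr {E : HermBundle.{u, v} n M} {D : DiffOp E E}
    {lp lm : SecC E →ₗ[ℂ] Sec E} (h : IsBosonicTwoPoint S (Grading.single E 0) D lp lm)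
    (s : SecC E) : lp s - lm s = Complex.I⁻¹ • causalPropagator S D s := by
  refine Subtype.ext (funext fun x => ?_)
  have h0 : (0 : ℤ) ∈ (Grading.single E 0).idx := Finset.mem_singleton_self 0
  have h1 := h.ccr 0 h0 0 h0 s (fun y => by rw [single_proj_apply, if_pos rfl]) x
  simpa [single_proj_apply] using h1

/-- In the blocks with i = 0 the sign (-1)^{ij} is 1. The ghost blocks have ij = -1, and this sign
cancels the ε = -1 of λ⁻, leaving λ_R⁺ - λ_R⁻ = i⁻¹ G_R there. -/
theorem isBosonicTwoPoint_brst (hS : S.GloballyHyperbolic) (h : IsSubsidiary S P K K)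
    {lDp lDm : SecC V₁ →ₗ[ℂ] Sec V₁} {lRp lRm : SecC V₀ →ₗ[ℂ] Sec V₀}
    (hD : IsBosonicTwoPoint S (Grading.single V₁ 0) (P + K.comp (adj S K)) lDp lDm)
    (hR : IsBosonicTwoPoint S (Grading.single V₀ 0) ((adj S K).comp K) lRp lRm)
    (hKp : ∀ s : SecC V₀, K.toLin (lRp s) = lDp (K.onC s))
    (hKm : ∀ s : SecC V₀, K.toLin (lRm s) = lDm (K.onC s)) :
    IsBosonicTwoPoint S (ghostGrading V₁ V₀) (brstL S P K 1)
      (brstTwoPoint S K 1 lDp lRp) (brstTwoPoint S K (-1) lDm lRm) where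
  green := isGreenHyperbolic_brstL hS h
  pos := isTwoPointPart_brst h (star_one ℂ) hD.pos hR.pos hKp
  neg := isTwoPointPart_brst h (by simp) hD.neg hR.neg hKm
  ccr i hi j hj s hs x := by
    obtain ⟨h1, h2, h3, h4⟩ := (hasDegree_onC_iff j s).1 hs
    have cD := hD.single_ccr ((projA V₁ V₀).onC s)
    have cR (t : SecC V₀) : lRp t - lRm t = _ := hR.single_ccr t
    rw [causalPropagator_brstL hS h, brstTwoPoint_eq, brstTwoPoint_eq, brstTwoPoint_eq,
      ghost_proj_mk4, ghost_proj_mk4, ghost_proj_mk4]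
    set k : ℂ := (-1 : ℂ) ^ (i * j)
    refine congrArg (fun s : Sec (totalBundle V₁ V₀) => s.1 x) (?_ : mk4 _ - k • mk4 _ =
      Complex.I⁻¹ • mk4 _)
    rw [sub_eq_add_neg, ← neg_smul, smul_mk4, smul_mk4, mk4_add]
    congr 2
    · by_cases hi0 : i = 0
      · have hk : k = 1 := by simp [k, hi0]
        have e : K.toLin (lRp ((projB V₁ V₀).onC s)) - K.toLin (lRm ((projB V₁ V₀).onC s)) =
          Complex.I⁻¹ • K.toLin (causalPropagator S ((adj S K).comp K) ((projB V₁ V₀).onC s)) := by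
          rw [← map_sub, cR, map_smul]
        simp only [hi0, if_true, hk, neg_smul, one_smul, smul_add, ← e, ← cD]
        abel
      · simp only [hi0, if_false, smul_zero, add_zero]
    · congr 1
      · by_cases hi0 : i = 0
        · have hk : k = 1 := by simp [k, hi0]
          simp only [hi0, if_true, hk, neg_smul, one_smul, ← cR]
          abel
        · simp only [hi0, if_false, smul_zero, add_zero]
      · congr 1
        · by_cases hi0 : i = 1
          -- The row of degree 1 reads only the component of degree -1; unless j = -1 that component
          -- of s vanishes. The row of degree -1 below is treated symmetrically.
          · by_cases hj0 : j = -1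
            · have hk : k = -1 := by simp [k, hi0, hj0]
              simp only [hi0, if_true, hk, neg_neg, one_smul, neg_smul, ← cR]
              abel
            · simp only [h4 hj0, map_zero, smul_zero, ite_self, add_zero]
          · simp only [hi0, if_false, smul_zero, add_zero]
        · by_cases hi0 : i = -1
          · by_cases hj0 : j = 1
            · have hk : k = -1 := by simp [k, hi0, hj0]
              simp only [hi0, if_true, hk, neg_neg, one_smul, neg_smul, ← cR]
              abel
            · simp only [h3 hj0, map_zero, smul_zero, ite_self, add_zero]
          · simp only [hi0, if_false, smul_zero, add_zero]

end Ghost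

/-- Taylor expansion of an entire function with entire remainder. -/
theorem exists_taylor {f : ℂ → ℂ} (hf : Differentiable ℂ f) (m : ℕ) :
    ∃ (a : ℕ → ℂ) (g : ℂ → ℂ), Differentiable ℂ g ∧
      ∀ z, f z = ∑ k ∈ Finset.range m, a k * z ^ k + z ^ m * g z := by
  induction m with
  | zero => exact ⟨0, f, hf, fun z => by simp⟩
  | succ m ih =>
    obtain ⟨a, g, hg, h⟩ := ih
    -- The next coefficient is g(0), and the next remainder is the divided difference (g(z) -
    -- g(0))/z, entire by removability of singularities.
    refine ⟨Function.update a m (g 0), dslope g 0, ?_, fun z => ?_⟩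
    · have := (Complex.differentiableOn_dslope (s := univ) (c := 0) univ_mem).2 hg.differentiableOn
      exact differentiableOn_univ.1 this
    · have h1 : ∑ k ∈ Finset.range m, Function.update a m (g 0) k * z ^ k =
          ∑ k ∈ Finset.range m, a k * z ^ k := by
        refine Finset.sum_congr rfl fun k hk => ?_
        rw [Function.update_of_ne (Finset.mem_range.1 hk).ne]
      have h2 : z * dslope g 0 z = g z - g 0 := by
        have := sub_smul_dslope g 0 z
        rwa [sub_zero, smul_eq_mul] at this
      rw [h, Finset.sum_range_succ, h1, Function.update_self, pow_succ, mul_assoc, h2]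
      ring

/-! ### Conjugation of differential operators with oscillating exponentials. -/

section Expansion

variable {n : ℕ} {M : Type u} [TopologicalSpace M] [ChartedSpace (EuclideanSpace ℝ (Fin n)) M]
  {E : HermBundle.{u, v₁} n M} {E' : HermBundle.{u, v₂} n M}

/-- The composition of a smooth complex function with an entire function. -/
def entireComp {f : ℂ → ℂ} (hf : Differentiable ℂ f) (φ : C^∞⟮𝓡 n, M; 𝓘(ℝ, ℂ), ℂ⟯) :
    C^∞⟮𝓡 n, M; 𝓘(ℝ, ℂ), ℂ⟯ :=
  ⟨fun x => f (φ x), by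
    have h : ContDiff ℝ ∞ f := (hf.contDiff (n := ∞)).restrict_scalars ℝ
    exact h.contMDiff.comp φ.contMDiff⟩

/-- The `k`-fold commutator of `A` with a function. -/
def iterComm (φ : C^∞⟮𝓡 n, M; 𝓘(ℝ, ℂ), ℂ⟯) : ℕ → (Sec E →ₗ[ℂ] Sec E') → (Sec E →ₗ[ℂ] Sec E')
  | 0, A => A
  | k + 1, A => iterComm φ k (comm A φ)

theorem OrderLT.iterComm_eq_zero (φ : C^∞⟮𝓡 n, M; 𝓘(ℝ, ℂ), ℂ⟯) {m : ℕ} :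
    ∀ {A : Sec E →ₗ[ℂ] Sec E'}, OrderLT m A → iterComm φ m A = 0 := by
  induction m with
  | zero => exact fun h => h
  | succ m ih => exact fun h => ih (h φ)

/-- The function `φ - c`. -/
def subConst (φ : C^∞⟮𝓡 n, M; 𝓘(ℝ, ℂ), ℂ⟯) (c : ℂ) : C^∞⟮𝓡 n, M; 𝓘(ℝ, ℂ), ℂ⟯ :=
  entireComp (f := fun z => z - c) (by fun_prop) φ

/-- Evaluated at x, A((φ - φ(x)) w) is (A φ - φ A) w, since φ(x) is a constant for A while the outer
multiplication by φ becomes φ(x) at x. Thus a factor φ - φ(x) under A counts as a commutator, which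
connects the algebraic notion of order with vanishing at x without any local coordinates. -/
theorem apply_iterate_mulSec (φ : C^∞⟮𝓡 n, M; 𝓘(ℝ, ℂ), ℂ⟯) (x : M) (k : ℕ) :
    ∀ (A : Sec E →ₗ[ℂ] Sec E') (s : Sec E),
      (A ((mulSec E (subConst φ (φ x)))^[k] s)).1 x = (iterComm φ k A s).1 x := by
  induction k with
  | zero => exact fun A s => rfl
  | succ k ih =>
    intro A s
    rw [Function.iterate_succ_apply', iterComm, ← ih]
    set w := (mulSec E (subConst φ (φ x)))^[k] s
    have h : mulSec E (subConst φ (φ x)) w = mulSec E φ w - φ x • w :=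
      Subtype.ext (funext fun y => sub_smul (φ y) (φ x) (w.1 y))
    rw [h, map_sub, map_smul]
    rfl

theorem iterate_mulSec_val (g : C^∞⟮𝓡 n, M; 𝓘(ℝ, ℂ), ℂ⟯) (k : ℕ) (s : Sec E) (x : M) :
    ((mulSec E g)^[k] s).1 x = g x ^ k • s.1 x := by
  induction k with
  | zero => simp
  | succ k ih => rw [Function.iterate_succ_apply', mulSec_val, ih, smul_smul, pow_succ']

theorem differentiable_cexp_I : Differentiable ℂ fun z => Complex.exp (Complex.I * z) := by
  fun_prop

/-- The function `exp(iφ)`. -/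
def expI (φ : C^∞⟮𝓡 n, M; 𝓘(ℝ, ℂ), ℂ⟯) : C^∞⟮𝓡 n, M; 𝓘(ℝ, ℂ), ℂ⟯ :=
  entireComp differentiable_cexp_I φ

/-- Conjugation of a differential operator with `exp(iφ)`. -/
theorem OrderLT.exists_expansion (m : ℕ) : ∃ a : ℕ → ℂ, ∀ (A : Sec E →ₗ[ℂ] Sec E'),
    OrderLT m A → ∀ (φ : C^∞⟮𝓡 n, M; 𝓘(ℝ, ℂ), ℂ⟯) (s : Sec E),
      A (mulSec E (expI φ) s) =
        mulSec E' (expI φ) (∑ k ∈ Finset.range m, a k • iterComm φ k A s) := by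
  obtain ⟨a, g, hg, h⟩ := exists_taylor differentiable_cexp_I m
  refine ⟨a, fun A hA φ s => Subtype.ext (funext fun x => ?_)⟩
  -- The point x is frozen and e^{iφ} = e^{iφ(x)} e^{iψ} is expanded in powers of ψ, which vanishes
  -- at x.
  set ψ := subConst φ (φ x)
  have h1 : mulSec E (expI φ) s = expI φ x • (∑ k ∈ Finset.range m, a k • (mulSec E ψ)^[k] s +
      (mulSec E ψ)^[m] (mulSec E (entireComp hg ψ) s)) := by
    refine Subtype.ext (funext fun y => ?_)
    have h2 : (∑ k ∈ Finset.range m, a k • (mulSec E ψ)^[k] s).1 y =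
        (∑ k ∈ Finset.range m, a k * ψ y ^ k) • s.1 y := by
      rw [Finset.sum_smul]
      have : (∑ k ∈ Finset.range m, a k • (mulSec E ψ)^[k] s).1 =
          ∑ k ∈ Finset.range m, (a k • (mulSec E ψ)^[k] s).1 := map_sum (Sec E).subtype _ _
      rw [this, Finset.sum_apply]
      refine Finset.sum_congr rfl fun k _ => ?_
      change a k • ((mulSec E ψ)^[k] s).1 y = _
      rw [iterate_mulSec_val, smul_smul]
    change Complex.exp (Complex.I * φ y) • s.1 y = Complex.exp (Complex.I * φ x) •
      ((∑ k ∈ Finset.range m, a k • (mulSec E ψ)^[k] s).1 y +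
        ((mulSec E ψ)^[m] (mulSec E (entireComp hg ψ) s)).1 y)
    rw [h2, iterate_mulSec_val, mulSec_val, smul_smul, ← add_smul, smul_smul]
    congr 1
    have h3 := h (ψ y)
    have h4 : entireComp hg ψ y = g (ψ y) := rfl
    rw [h4, ← h3]
    change _ = Complex.exp (Complex.I * φ x) * Complex.exp (Complex.I * (φ y - φ x))
    rw [← Complex.exp_add]
    congr 1; ring
  rw [h1, map_smul, map_add, map_sum]
  -- The Taylor remainder carries the factor ψ^m. At x this becomes an m-fold commutator of A, which
  -- vanishes because A has order less than m.
  have h5 : (A ((mulSec E ψ)^[m] (mulSec E (entireComp hg ψ) s))).1 x = 0 := by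
    rw [apply_iterate_mulSec, hA.iterComm_eq_zero]; rfl
  change expI φ x • ((∑ k ∈ Finset.range m, A (a k • (mulSec E ψ)^[k] s)).1 x +
    (A ((mulSec E ψ)^[m] (mulSec E (entireComp hg ψ) s))).1 x) = expI φ x • _
  rw [h5, add_zero]
  congr 1
  have hsum (f : ℕ → Sec E') : (∑ k ∈ Finset.range m, f k).1 x =
      ∑ k ∈ Finset.range m, (f k).1 x := by
    have : (∑ k ∈ Finset.range m, f k).1 = ∑ k ∈ Finset.range m, (f k).1 :=
      map_sum (Sec E').subtype _ _
    rw [this, Finset.sum_apply]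
  rw [hsum, hsum]
  refine Finset.sum_congr rfl fun k _ => ?_
  rw [map_smul]
  exact congrArg (a k • ·) (apply_iterate_mulSec φ x k A s)

/-- The commutator of a differential operator with a function. -/
def DiffOp.commOp (A : DiffOp E E') (f : C^∞⟮𝓡 n, M; 𝓘(ℝ, ℂ), ℂ⟯) : DiffOp E E' where
  toLin := comm A.toLin f
  supp_subset _ := (supp_sub_subset _ _).trans (union_subset
    ((A.supp_subset _).trans (supp_mul_subset _ _)) ((supp_mul_subset _ _).trans (A.supp_subset _)))
  finite_order := A.finite_order.imp fun _ h => h.succ f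

/-- Functions of polynomial growth. -/
def PolyGrowth (c : (Fin n → ℝ) → ℂ) : Prop :=
  ∃ (C : ℝ) (k : ℕ), ∀ η, ‖c η‖ ≤ C * (1 + ‖η‖) ^ k

theorem polyGrowth_const (z : ℂ) : PolyGrowth fun _ : Fin n → ℝ => z :=
  ⟨‖z‖, 0, fun η => by simp⟩

theorem PolyGrowth.mul_coord {c : (Fin n → ℝ) → ℂ} (hc : PolyGrowth c) (i : Fin n) :
    PolyGrowth fun η => c η * (η i : ℂ) := by
  obtain ⟨C, k, h⟩ := hc
  refine ⟨C, k + 1, fun η => ?_⟩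
  rw [norm_mul, pow_succ, ← mul_assoc]
  refine mul_le_mul (h η) ?_ (norm_nonneg _) ((norm_nonneg _).trans (h η))
  rw [Complex.norm_real]
  linarith [norm_le_pi_norm η i]

theorem PolyGrowth.const_mul {c : (Fin n → ℝ) → ℂ} (hc : PolyGrowth c) (z : ℂ) :
    PolyGrowth fun η => z * c η := by
  obtain ⟨C, k, h⟩ := hc
  refine ⟨‖z‖ * C, k, fun η => ?_⟩
  rw [norm_mul, mul_assoc]
  exact mul_le_mul_of_nonneg_left (h η) (norm_nonneg _)

/-- Finite sums of differential operators with coefficients of polynomial growth in a parameter. -/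
def PolyFam (F : (Fin n → ℝ) → Sec E →ₗ[ℂ] Sec E') : Prop :=
  ∃ (ι : Type) (_ : Fintype ι) (c : ι → (Fin n → ℝ) → ℂ) (B : ι → DiffOp E E'),
    (∀ j, PolyGrowth (c j)) ∧ ∀ η, F η = ∑ j, c j η • (B j).toLin

theorem polyFam_const (A : DiffOp E E') : PolyFam fun _ : Fin n → ℝ => A.toLin :=
  ⟨Unit, inferInstance, fun _ _ => 1, fun _ => A, fun _ => polyGrowth_const 1, fun η => by simp⟩

theorem PolyFam.add {F G : (Fin n → ℝ) → Sec E →ₗ[ℂ] Sec E'} (hF : PolyFam F) (hG : PolyFam G) :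
    PolyFam fun η => F η + G η := by
  obtain ⟨ι, _, c, B, hc, h⟩ := hF
  obtain ⟨ι', _, c', B', hc', h'⟩ := hG
  exact ⟨ι ⊕ ι', inferInstance, Sum.elim c c', Sum.elim B B', fun j => by cases j <;> simp [hc, hc'],
    fun η => by simp [h, h', Fintype.sum_sum_type]⟩

theorem PolyFam.smul {F : (Fin n → ℝ) → Sec E →ₗ[ℂ] Sec E'} (hF : PolyFam F) (z : ℂ) :
    PolyFam fun η => z • F η := by
  obtain ⟨ι, _, c, B, hc, h⟩ := hF
  exact ⟨ι, inferInstance, fun j η => z * c j η, B, fun j => (hc j).const_mul z,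
    fun η => by simp only [h, Finset.smul_sum, smul_smul]⟩

theorem polyFam_zero : PolyFam fun _ : Fin n → ℝ => (0 : Sec E →ₗ[ℂ] Sec E') :=
  ⟨Empty, inferInstance, fun j => j.elim, fun j => j.elim, fun j => j.elim, fun η => by simp⟩

theorem polyFam_sum {m : ℕ} {F : ℕ → (Fin n → ℝ) → Sec E →ₗ[ℂ] Sec E'} (hF : ∀ k, PolyFam (F k)) :
    PolyFam fun η => ∑ k ∈ Finset.range m, F k η := by
  induction m with
  | zero => simpa using polyFam_zero
  | succ m ih => simpa only [Finset.sum_range_succ] using ih.add (hF m)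

/-- The function `∑ i, η i • φ i`. -/
def phase (φ : Fin n → C^∞⟮𝓡 n, M; 𝓘(ℝ, ℂ), ℂ⟯) (η : Fin n → ℝ) : C^∞⟮𝓡 n, M; 𝓘(ℝ, ℂ), ℂ⟯ :=
  ⟨fun x => ∑ i, (η i : ℂ) * φ i x, contMDiff_finsetSum fun i _ => by
    have h : ContDiff ℝ ∞ fun z : ℂ => (η i : ℂ) * z := by fun_prop
    exact h.contMDiff.comp (φ i).contMDiff⟩

theorem mulSec_phase (E : HermBundle.{u, v} n M) (φ : Fin n → C^∞⟮𝓡 n, M; 𝓘(ℝ, ℂ), ℂ⟯)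
    (η : Fin n → ℝ) : mulSec E (phase φ η) = ∑ i, (η i : ℂ) • mulSec E (φ i) := by
  refine LinearMap.ext fun s => Subtype.ext (funext fun x => ?_)
  have : ((∑ i, (η i : ℂ) • mulSec E (φ i)) s).1 x = ∑ i, (η i : ℂ) • φ i x • s.1 x := by
    rw [LinearMap.sum_apply]
    have : (∑ i, ((η i : ℂ) • mulSec E (φ i)) s).1 = ∑ i, (((η i : ℂ) • mulSec E (φ i)) s).1 :=
      map_sum (Sec E).subtype _ _
    rw [this, Finset.sum_apply]; rfl
  rw [this]
  change (∑ i, (η i : ℂ) * φ i x) • s.1 x = _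
  rw [Finset.sum_smul]
  exact Finset.sum_congr rfl fun i _ => mul_smul _ _ _

theorem comm_phase (A : Sec E →ₗ[ℂ] Sec E') (φ : Fin n → C^∞⟮𝓡 n, M; 𝓘(ℝ, ℂ), ℂ⟯)
    (η : Fin n → ℝ) : comm A (phase φ η) = ∑ i, (η i : ℂ) • comm A (φ i) := by
  refine LinearMap.ext fun s => ?_
  simp only [comm, mulSec_phase, LinearMap.sub_apply, LinearMap.comp_apply, LinearMap.sum_apply,
    LinearMap.smul_apply, map_sum, map_smul, smul_sub, Finset.sum_sub_distrib]

/-- The phase is linear in η, so each commutator with it contributes one more power of a coordinate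
of η. -/
theorem PolyFam.comm_phase {F : (Fin n → ℝ) → Sec E →ₗ[ℂ] Sec E'} (hF : PolyFam F)
    (φ : Fin n → C^∞⟮𝓡 n, M; 𝓘(ℝ, ℂ), ℂ⟯) : PolyFam fun η => comm (F η) (phase φ η) := by
  obtain ⟨ι, _, c, B, hc, h⟩ := hF
  refine ⟨ι × Fin n, inferInstance, fun j η => c j.1 η * (η j.2 : ℂ),
    fun j => (B j.1).commOp (φ j.2), fun j => (hc j.1).mul_coord j.2, fun η => ?_⟩
  simp only [Fintype.sum_prod_type, h]
  have h1 : comm (∑ j, c j η • (B j).toLin) (phase φ η) =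
      ∑ j, c j η • comm (B j).toLin (phase φ η) := by
    refine LinearMap.ext fun s => ?_
    simp only [comm, LinearMap.sub_apply, LinearMap.comp_apply, LinearMap.sum_apply,
      LinearMap.smul_apply, map_sum, map_smul, smul_sub, Finset.sum_sub_distrib]
  rw [h1]
  refine Finset.sum_congr rfl fun j _ => ?_
  rw [BRST.comm_phase, Finset.smul_sum]
  exact Finset.sum_congr rfl fun i _ => smul_smul _ _ _

theorem polyFam_iterComm (φ : Fin n → C^∞⟮𝓡 n, M; 𝓘(ℝ, ℂ), ℂ⟯) (k : ℕ) :
    ∀ {F : (Fin n → ℝ) → Sec E →ₗ[ℂ] Sec E'}, PolyFam F →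
      PolyFam fun η => iterComm (phase φ η) k (F η) := by
  induction k with
  | zero => exact fun h => h
  | succ k ih => exact fun h => ih (h.comm_phase φ)

/-- The number of terms in `OrderLT.exists_expansion` and their coefficients do not depend on the
phase; only the iterated commutators do, polynomially in η. -/
theorem DiffOp.exists_polyFam (A : DiffOp E E') (φ : Fin n → C^∞⟮𝓡 n, M; 𝓘(ℝ, ℂ), ℂ⟯) :
    ∃ F : (Fin n → ℝ) → Sec E →ₗ[ℂ] Sec E', PolyFam F ∧ ∀ η s,
      A.toLin (mulSec E (expI (phase φ η)) s) = mulSec E' (expI (phase φ η)) (F η s) := by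
  obtain ⟨m, hm⟩ := A.finite_order
  obtain ⟨a, ha⟩ := OrderLT.exists_expansion (E := E) (E' := E') m
  refine ⟨fun η => ∑ k ∈ Finset.range m, a k • iterComm (phase φ η) k A.toLin,
    polyFam_sum fun k => (polyFam_iterComm φ k (polyFam_const A)).smul (a k), fun η s => ?_⟩
  rw [ha _ hm, LinearMap.sum_apply]; rfl

end Expansion

/-! ### Stability of microlocal smoothness under differential operators. -/

section Oscillating

variable {n : ℕ} {M : Type u} [TopologicalSpace M] [ChartedSpace (EuclideanSpace ℝ (Fin n)) M]
  [IsManifold (𝓡 n) ∞ M] [MeasurableSpace M] [T2Space M] [SigmaCompactSpace M]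
  {E : HermBundle.{u, v₁} n M} {E' : HermBundle.{u, v₂} n M} {E'' : HermBundle.{u, v₃} n M}

/-- The chart coordinates, cut off outside a neighbourhood of a compact set. -/
theorem exists_coordinates (x₀ : M) {Z : Set M} (hZ : IsCompact Z)
    (h : Z ⊆ (extChartAt (𝓡 n) x₀).source) :
    ∃ φ : Fin n → C^∞⟮𝓡 n, M; 𝓘(ℝ, ℂ), ℂ⟯, ∀ i, ∀ y ∈ Z,
      φ i y = (((extChartAt (𝓡 n) x₀ y : EuclideanSpace ℝ (Fin n)) i : ℝ) : ℂ) := by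
  obtain ⟨f, hf1, hfc, hft, -⟩ := exists_cutoff (n := n) hZ (isOpen_extChartAt_source (I := 𝓡 n) x₀) h
  refine ⟨fun i => ⟨fun y => f y * (((extChartAt (𝓡 n) x₀ y : EuclideanSpace ℝ (Fin n)) i : ℝ) : ℂ),
    fun y => ?_⟩, fun i y hy => ?_⟩
  · by_cases hy : y ∈ tsupport f
    · have h1 : ContMDiffAt (𝓡 n) 𝓘(ℝ, EuclideanSpace ℝ (Fin n)) ∞ (extChartAt (𝓡 n) x₀) y :=
        contMDiffAt_extChartAt' (by simpa using hft hy)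
      have h2 : ContDiff ℝ ∞ (fun z : EuclideanSpace ℝ (Fin n) => ((z i : ℝ) : ℂ)) :=
        Complex.ofRealCLM.contDiff.comp (EuclideanSpace.proj (𝕜 := ℝ) i).contDiff
      have h3 := h2.contMDiff.contMDiffAt.comp y h1
      have hb : ContDiff ℝ ∞ (fun p : ℂ × ℂ => p.1 * p.2) := contDiff_fst.mul contDiff_snd
      exact hb.contMDiff.contMDiffAt.comp y ((f.contMDiff y).prodMk_space h3)
    · refine (contMDiffAt_const (c := (0 : ℂ))).congr_of_eventuallyEq ?_
      filter_upwards [(isClosed_tsupport f).isOpen_compl.mem_nhds hy] with z hz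
      rw [image_eq_zero_of_notMem_tsupport hz, zero_mul]
  · change f y * _ = _
    rw [hf1.self_of_nhdsSet y hy, one_mul]

/-- The components of a covector in the chart. -/
def coords {x₀ : M} (ξ : TangentSpace (𝓡 n) x₀ →L[ℝ] ℝ) (i : Fin n) : ℝ :=
  (ξ : EuclideanSpace ℝ (Fin n) →L[ℝ] ℝ) (EuclideanSpace.single i 1)

theorem continuous_coords (x₀ : M) :
    Continuous (coords : (TangentSpace (𝓡 n) x₀ →L[ℝ] ℝ) → Fin n → ℝ) :=
  continuous_pi fun i => continuous_eval_const (F := TangentSpace (𝓡 n) x₀ →L[ℝ] ℝ)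
    (EuclideanSpace.single i 1 : EuclideanSpace ℝ (Fin n))

theorem sum_coords {x₀ : M} (ξ : TangentSpace (𝓡 n) x₀ →L[ℝ] ℝ) (z : EuclideanSpace ℝ (Fin n)) :
    ∑ i, coords ξ i * z i = (ξ : EuclideanSpace ℝ (Fin n) →L[ℝ] ℝ) z := by
  have h := (EuclideanSpace.basisFun (Fin n) ℝ).sum_repr z
  conv_rhs => rw [← h]
  refine Eq.trans ?_ (map_sum (id ξ : EuclideanSpace ℝ (Fin n) →L[ℝ] ℝ) _ _).symm
  refine Finset.sum_congr rfl fun i _ => ?_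
  refine Eq.trans ?_ (map_smul (id ξ : EuclideanSpace ℝ (Fin n) →L[ℝ] ℝ) _ _).symm
  rw [EuclideanSpace.basisFun_apply, EuclideanSpace.basisFun_repr, smul_eq_mul, mul_comm]
  rfl

/-- The chart coordinates are not globally defined smooth functions; on the support of s they agree
with the cut-off coordinates φ, to which the expansion applies. -/
theorem osc_val {x₀ : M} {Z : Set M} {φ : Fin n → C^∞⟮𝓡 n, M; 𝓘(ℝ, ℂ), ℂ⟯}
    (hφ : ∀ i, ∀ y ∈ Z, φ i y = (((extChartAt (𝓡 n) x₀ y : EuclideanSpace ℝ (Fin n)) i : ℝ) : ℂ))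
    (ξ : TangentSpace (𝓡 n) x₀ →L[ℝ] ℝ) (s : SecC E)
    (hs : supp s.1 ⊆ (extChartAt (𝓡 n) x₀).source) (hsZ : supp s.1 ⊆ Z) :
    toSec E (osc x₀ ξ s hs) = mulSec E (expI (phase φ (coords ξ))) (toSec E s) := by
  refine Subtype.ext (funext fun y => ?_)
  by_cases hy : s.1 y = 0
  · have h (z z' : ℂ) : z • s.1 y = z' • s.1 y := by rw [hy, smul_zero, smul_zero]
    exact h _ _
  · have hyZ := hsZ (mem_supp hy)
    change Complex.exp (Complex.I * _) • s.1 y =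
      Complex.exp (Complex.I * ∑ i, (coords ξ i : ℂ) * φ i y) • s.1 y
    congr 3
    rw [← sum_coords, Complex.ofReal_sum]
    refine Finset.sum_congr rfl fun i _ => ?_
    rw [hφ i y hyZ, Complex.ofReal_mul]

/-- A differential operator applied to an oscillating section is a finite sum of oscillating
sections with coefficients of polynomial growth. -/
theorem DiffOp.exists_osc_expansion (A : DiffOp E E') (x₀ : M) (t : SecC E)
    (ht : supp t.1 ⊆ (extChartAt (𝓡 n) x₀).source) :
    ∃ (ι : Type) (_ : Fintype ι) (c : ι → (Fin n → ℝ) → ℂ) (r : ι → SecC E')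
      (hr : ∀ j, supp (r j).1 ⊆ (extChartAt (𝓡 n) x₀).source),
      (∀ j, supp (r j).1 ⊆ supp t.1) ∧ (∀ j, PolyGrowth (c j)) ∧
      ∀ ξ : TangentSpace (𝓡 n) x₀ →L[ℝ] ℝ,
        A.onC (osc x₀ ξ t ht) = ∑ j, c j (coords ξ) • osc x₀ ξ (r j) (hr j) := by
  obtain ⟨φ, hφ⟩ := exists_coordinates x₀ t.2.2 ht
  obtain ⟨F, ⟨ι, _, c, B, hc, hF⟩, hA⟩ := A.exists_polyFam φ
  have hsupp (j : ι) : supp ((B j).onC t).1 ⊆ supp t.1 := (B j).supp_subset (toSec E t)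
  refine ⟨ι, inferInstance, c, fun j => (B j).onC t, fun j => (hsupp j).trans ht, hsupp, hc,
    fun ξ => toSec_injective ?_⟩
  rw [DiffOp.toSec_onC, osc_val hφ ξ t ht subset_rfl, hA, hF, map_sum, LinearMap.sum_apply, map_sum]
  refine Finset.sum_congr rfl fun j _ => ?_
  rw [LinearMap.smul_apply, map_smul, map_smul, osc_val hφ ξ _ _ (hsupp j), DiffOp.toSec_onC]

/-- A coefficient growing like τ^k is absorbed by using the decay of its factor with exponent N + k;
the bound R on the frequencies makes the estimate uniform on W. -/
theorem rapid_sum {X ι : Type*} [Fintype ι] {W : Set X} {κ : X → Fin n → ℝ} {R : ℝ}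
    (hR : ∀ w ∈ W, ‖κ w‖ ≤ R) {c : ι → (Fin n → ℝ) → ℂ} (hc : ∀ j, PolyGrowth (c j))
    {G : ι → X → ℝ → ℂ} (hG : ∀ j, ∀ N : ℕ, ∃ C : ℝ, ∀ w ∈ W, ∀ τ : ℝ, 1 ≤ τ →
      ‖G j w τ‖ * τ ^ N ≤ C) (N : ℕ) :
    ∃ C : ℝ, ∀ w ∈ W, ∀ τ : ℝ, 1 ≤ τ →
      (∑ j, ‖c j (τ • κ w)‖ * ‖G j w τ‖) * τ ^ N ≤ C := by
  choose C k hk using hc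
  choose C' hC' using fun j => hG j (N + k j)
  refine ⟨∑ j, |C j| * (1 + R) ^ k j * C' j, fun w hw τ hτ => ?_⟩
  rw [Finset.sum_mul]
  refine Finset.sum_le_sum fun j _ => ?_
  have h0 : 0 ≤ R := (norm_nonneg _).trans (hR w hw)
  -- For τ ≥ 1 one has 1 + τ ‖κ w‖ ≤ (1 + R) τ.
  have h1 : ‖c j (τ • κ w)‖ ≤ |C j| * (1 + R) ^ k j * τ ^ k j := by
    refine (hk j _).trans ?_
    rw [mul_assoc, ← mul_pow]
    refine mul_le_mul (le_abs_self _) (pow_le_pow_left₀ (by positivity) ?_ _) (by positivity)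
      (abs_nonneg _)
    rw [norm_smul, Real.norm_of_nonneg (by linarith)]
    nlinarith [hR w hw]
  calc ‖c j (τ • κ w)‖ * ‖G j w τ‖ * τ ^ N
      ≤ |C j| * (1 + R) ^ k j * τ ^ k j * ‖G j w τ‖ * τ ^ N := by gcongr
    _ = |C j| * (1 + R) ^ k j * (‖G j w τ‖ * τ ^ (N + k j)) := by ring
    _ ≤ _ := mul_le_mul_of_nonneg_left (hC' j w hw τ hτ) (by positivity)

variable (S : Spacetime n M)

/-- The operator `T` between sections of two bundles is microlocally smoothing at a point of
`T*M × T*M`. -/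
def MicrosmoothAt (T : SecC E →ₗ[ℂ] Sec E') (p q : Cotangent n M) : Prop :=
  ∃ U ∈ 𝓝 p.1, ∃ U' ∈ 𝓝 q.1, ∃ W ∈ 𝓝 (p.2, q.2), ∀ (s : SecC E') (t : SecC E)
    (hs : supp s.1 ⊆ (extChartAt (𝓡 n) p.1).source)
    (ht : supp t.1 ⊆ (extChartAt (𝓡 n) q.1).source), supp s.1 ⊆ U → supp t.1 ⊆ U' →
    ∀ N : ℕ, ∃ C : ℝ, ∀ w ∈ W, ∀ τ : ℝ, 1 ≤ τ →
      ‖pair S E' (osc p.1 (τ • w.1) s hs).1 (T (osc q.1 (τ • w.2) t ht)).1‖ * τ ^ N ≤ C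

variable {S} {p q : Cotangent n M}

theorem exists_coords_bound (p : Cotangent n M) :
    ∃ R : ℝ, ∀ᶠ ξ in 𝓝 p.2, ‖coords ξ‖ ≤ R :=
  ⟨‖coords p.2‖ + 1, ((continuous_coords p.1).norm.tendsto p.2).eventually_le_const (lt_add_one _)⟩

variable [BorelSpace M]

theorem MicrosmoothAt.add {T T' : SecC E →ₗ[ℂ] Sec E'} (h : MicrosmoothAt S T p q)
    (h' : MicrosmoothAt S T' p q) : MicrosmoothAt S (T + T') p q := by
  obtain ⟨U, hU, U', hU', W, hW, h⟩ := h
  obtain ⟨Y, hY, Y', hY', Z, hZ, h'⟩ := h'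
  refine ⟨U ∩ Y, inter_mem hU hY, U' ∩ Y', inter_mem hU' hY', W ∩ Z, inter_mem hW hZ,
    fun s t hs ht hsU htU N => ?_⟩
  obtain ⟨C, hC⟩ := h s t hs ht (hsU.trans inter_subset_left) (htU.trans inter_subset_left) N
  obtain ⟨C', hC'⟩ := h' s t hs ht (hsU.trans inter_subset_right) (htU.trans inter_subset_right) N
  refine ⟨C + C', fun w hw τ hτ => ?_⟩
  refine le_trans ?_ (add_le_add (hC w hw.1 τ hτ) (hC' w hw.2 τ hτ))
  rw [← add_mul]
  refine mul_le_mul_of_nonneg_right ?_ (by positivity)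
  refine le_trans (le_of_eq ?_) (norm_add_le _ _)
  rw [← pair_add_right]; rfl

theorem MicrosmoothAt.smul {T : SecC E →ₗ[ℂ] Sec E'} (h : MicrosmoothAt S T p q) (z : ℂ) :
    MicrosmoothAt S (z • T) p q := by
  obtain ⟨U, hU, U', hU', W, hW, h⟩ := h
  refine ⟨U, hU, U', hU', W, hW, fun s t hs ht hsU htU N => ?_⟩
  obtain ⟨C, hC⟩ := h s t hs ht hsU htU N
  refine ⟨‖z‖ * C, fun w hw τ hτ => ?_⟩
  refine le_trans (le_of_eq ?_) (mul_le_mul_of_nonneg_left (hC w hw τ hτ) (norm_nonneg z))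
  rw [← mul_assoc, ← norm_mul, ← pair_smul_right]; rfl

/-- A applied to an oscillating section is a finite sum of oscillating sections with the same
frequency, supports no larger and coefficients of polynomial growth; rapid decay survives this. The
neighbourhood W is shrunk so that the frequencies stay bounded. -/
theorem MicrosmoothAt.comp_right {T : SecC E →ₗ[ℂ] Sec E'} (h : MicrosmoothAt S T p q)
    (A : DiffOp E'' E) : MicrosmoothAt S (T ∘ₗ A.onC) p q := by
  obtain ⟨U, hU, U', hU', W, hW, h⟩ := h
  obtain ⟨R, hR⟩ := exists_coords_bound q
  refine ⟨U, hU, U', hU', W ∩ {w | ‖coords w.2‖ ≤ R},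
    inter_mem hW (hR.prod_inr_nhds p.2), fun s t hs ht hsU htU N => ?_⟩
  obtain ⟨ι, _, c, r, hr, hrt, hc, hA⟩ := A.exists_osc_expansion q.1 t ht
  obtain ⟨C, hC⟩ := rapid_sum (W := W ∩ {w | ‖coords w.2‖ ≤ R}) (κ := fun w => coords w.2)
    (fun w hw => hw.2) hc
    (G := fun j w τ => pair S E' (osc p.1 (τ • w.1) s hs).1 (T (osc q.1 (τ • w.2) (r j) (hr j))).1)
    (fun j N => (h s (r j) hs (hr j) hsU ((hrt j).trans htU) N).imp fun C hC w hw => hC w hw.1) N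
  refine ⟨C, fun w hw τ hτ => (mul_le_mul_of_nonneg_right ?_ (by positivity)).trans (hC w hw τ hτ)⟩
  have h1 : pair S E' (osc p.1 (τ • w.1) s hs).1 ((T ∘ₗ A.onC) (osc q.1 (τ • w.2) t ht)).1 =
      ∑ j, c j (τ • coords w.2) *
        pair S E' (osc p.1 (τ • w.1) s hs).1 (T (osc q.1 (τ • w.2) (r j) (hr j))).1 := by
    rw [LinearMap.comp_apply, hA, map_sum]
    change pairL S E' _ _ = _
    rw [map_sum]
    refine Finset.sum_congr rfl fun j _ => ?_
    rw [map_smul, map_smul]; rfl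
  rw [h1]
  refine (norm_sum_le _ _).trans (le_of_eq (Finset.sum_congr rfl fun j _ => norm_mul _ _))

/-- The operator B is moved to the left test section as its adjoint B', and the argument of
`MicrosmoothAt.comp_right` applies there. -/
theorem MicrosmoothAt.comp_left {T : SecC E →ₗ[ℂ] Sec E'} (h : MicrosmoothAt S T p q)
    {B : DiffOp E' E''} {B' : DiffOp E'' E'} (hB : IsFormalAdjoint S B' B) :
    MicrosmoothAt S (B.toLin ∘ₗ T) p q := by
  obtain ⟨U, hU, U', hU', W, hW, h⟩ := h
  obtain ⟨R, hR⟩ := exists_coords_bound p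
  refine ⟨U, hU, U', hU', W ∩ {w | ‖coords w.1‖ ≤ R},
    inter_mem hW (hR.prod_inl_nhds q.2), fun s t hs ht hsU htU N => ?_⟩
  obtain ⟨ι, _, c, r, hr, hrs, hc, hA⟩ := B'.exists_osc_expansion p.1 s hs
  obtain ⟨C, hC⟩ := rapid_sum (W := W ∩ {w | ‖coords w.1‖ ≤ R}) (κ := fun w => coords w.1)
    (fun w hw => hw.2) hc
    (G := fun j w τ => pair S E' (osc p.1 (τ • w.1) (r j) (hr j)).1 (T (osc q.1 (τ • w.2) t ht)).1)
    (fun j N => (h (r j) t (hr j) ht ((hrs j).trans hsU) htU N).imp fun C hC w hw => hC w hw.1) N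
  refine ⟨C, fun w hw τ hτ => (mul_le_mul_of_nonneg_right ?_ (by positivity)).trans (hC w hw τ hτ)⟩
  have h1 : pair S E'' (osc p.1 (τ • w.1) s hs).1 ((B.toLin ∘ₗ T) (osc q.1 (τ • w.2) t ht)).1 =
      ∑ j, star (c j (τ • coords w.1)) *
        pair S E' (osc p.1 (τ • w.1) (r j) (hr j)).1 (T (osc q.1 (τ • w.2) t ht)).1 := by
    rw [LinearMap.comp_apply, ← hB.pair_left, hA]
    change pairL S E' _ _ = _
    rw [map_sum, LinearMap.sum_apply]
    refine Finset.sum_congr rfl fun j _ => ?_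
    rw [LinearMap.map_smulₛₗ]; rfl
  rw [h1]
  refine (norm_sum_le _ _).trans (le_of_eq (Finset.sum_congr rfl fun j _ => ?_))
  rw [norm_mul, norm_star]

end Oscillating

/-! ### Wave front sets of the block operators. -/

section Wavefront

variable {n : ℕ} {M : Type u} [TopologicalSpace M] [ChartedSpace (EuclideanSpace ℝ (Fin n)) M]
  [IsManifold (𝓡 n) ∞ M] [MeasurableSpace M] [T2Space M] [SigmaCompactSpace M] [BorelSpace M]
  {S : Spacetime n M} {V₁ : HermBundle.{u, v₁} n M} {V₀ : HermBundle.{u, v₂} n M}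
  {K : DiffOp V₀ V₁} {p q : Cotangent n M}

/-- All blocks arise from lD and lR by composition with differential operators. Conversely lD is the
corner of the summand a, and ε lR is the block from c̄ to c. -/
theorem isMicrosmooth_brstTwoPoint (hK : IsFormalAdjoint S K (adj S K)) {ε : ℂ} (hε : ε ≠ 0)
    (lD : SecC V₁ →ₗ[ℂ] Sec V₁) (lR : SecC V₀ →ₗ[ℂ] Sec V₀) :
    IsMicrosmooth S (brstTwoPoint S K ε lD lR) p q ↔
      IsMicrosmooth S lD p q ∧ IsMicrosmooth S lR p q := by
  constructor
  · intro h
    have h : MicrosmoothAt S (brstTwoPoint S K ε lD lR) p q := h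
    have h1 := (h.comp_right (inclA V₁ V₀)).comp_left adj_inclA
    have h2 := ((h.comp_right (inclD V₁ V₀)).comp_left adj_inclC).smul ε⁻¹
    have e1 : (projA V₁ V₀).toLin ∘ₗ brstTwoPoint S K ε lD lR ∘ₗ (inclA V₁ V₀).onC = lD := by
      refine LinearMap.ext fun s => ?_
      have hA : (projA V₁ V₀).onC ((inclA V₁ V₀).onC s) = s := rfl
      have hB : (projB V₁ V₀).onC ((inclA V₁ V₀).onC s) = 0 := rfl
      simp only [LinearMap.comp_apply, brstTwoPoint_eq, projA_mk4, hA, hB, map_zero, add_zero]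
    have e2 : ε⁻¹ • ((projC V₁ V₀).toLin ∘ₗ brstTwoPoint S K ε lD lR ∘ₗ (inclD V₁ V₀).onC) = lR := by
      refine LinearMap.ext fun s => ?_
      have hD : (projD V₁ V₀).onC ((inclD V₁ V₀).onC s) = s := rfl
      simp only [LinearMap.comp_apply, LinearMap.smul_apply, brstTwoPoint_eq, projC_mk4, hD,
        smul_smul, inv_mul_cancel₀ hε, one_smul]
    rw [e1] at h1
    rw [e2] at h2
    exact ⟨h1, h2⟩
  · rintro ⟨h1, h2⟩
    have h1 : MicrosmoothAt S lD p q := h1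
    have h2 : MicrosmoothAt S lR p q := h2
    exact (((((h1.comp_right (projA V₁ V₀)).comp_left adj_inclA.symm).add
      (((h2.comp_right (projB V₁ V₀)).comp_left hK.symm).comp_left adj_inclA.symm)).add
      (((h2.comp_right (adj S K)).comp_right (projA V₁ V₀)).comp_left adj_inclB.symm)).add
      (((h2.comp_right (projD V₁ V₀)).comp_left adj_inclC.symm).smul ε)).add
      (((h2.comp_right (projC V₁ V₀)).comp_left adj_inclD.symm).smul ε)

theorem WFprime_brstTwoPoint (hK : IsFormalAdjoint S K (adj S K)) {ε : ℂ} (hε : ε ≠ 0)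
    (lD : SecC V₁ →ₗ[ℂ] Sec V₁) (lR : SecC V₀ →ₗ[ℂ] Sec V₀) :
    WFprime S (brstTwoPoint S K ε lD lR) = WFprime S lD ∪ WFprime S lR := by
  ext z
  simp only [WFprime, mem_union, mem_ofPred_eq, isMicrosmooth_brstTwoPoint hK hε, not_and_or]
  tauto

/-- Both λ_L^± and G_L are block operators, so their wave front sets are unions of those for D and
R, and intersecting with N^± × N^± distributes over the union. -/
theorem isHadamard_brst (hS : S.GloballyHyperbolic) {P : DiffOp V₁ V₁} (h : IsSubsidiary S P K K)
    {lDp lDm : SecC V₁ →ₗ[ℂ] Sec V₁} {lRp lRm : SecC V₀ →ₗ[ℂ] Sec V₀}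
    (hD : IsHadamard S (P + K.comp (adj S K)) lDp lDm)
    (hR : IsHadamard S ((adj S K).comp K) lRp lRm) :
    IsHadamard S (brstL S P K 1) (brstTwoPoint S K 1 lDp lRp) (brstTwoPoint S K (-1) lDm lRm) := by
  have hK := h.adjK
  have h1 : (-1 : ℂ) ≠ 0 := by norm_num
  rw [IsHadamard, causalPropagator_brstL hS h, WFprime_brstTwoPoint hK one_ne_zero,
    WFprime_brstTwoPoint hK one_ne_zero, WFprime_brstTwoPoint hK h1, hD.1, hD.2, hR.1, hR.2,
    ← inter_union_distrib_left, ← inter_union_distrib_left]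
  exact ⟨rfl, rfl⟩

end Wavefront

/-! ### Gram representation of positive semidefinite forms. -/

section Gram

variable {𝒱 : Type v} [AddCommGroup 𝒱] [Module ℂ 𝒱]

/-- The Cauchy–Schwarz inequality for a positive semidefinite hermitian form. -/
theorem cauchy_schwarz {Λ : 𝒱 →ₗ⋆[ℂ] 𝒱 →ₗ[ℂ] ℂ} (hs : ∀ v w, star (Λ v w) = Λ w v)
    (hp : ∀ v, 0 ≤ Λ v v) (v w : 𝒱) : ‖Λ v w‖ ^ 2 ≤ (Λ v v).re * (Λ w w).re := by
  let core : PreInnerProductSpace.Core ℂ 𝒱 :=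
    { inner := fun v w => Λ v w
      conj_inner_symm := fun v w => hs w v
      re_inner_nonneg := fun v => (Complex.le_def.1 (hp v)).1
      add_left := fun v w z => LinearMap.map_add₂ Λ v w z
      smul_left := fun v w c => LinearMap.map_smulₛₗ₂ Λ c v w }
  have h := InnerProductSpace.Core.inner_mul_inner_self_le (𝕜 := ℂ) (F := 𝒱) v w
  have h1 : ‖Λ w v‖ = ‖Λ v w‖ := by rw [← hs v w, norm_star]
  change ‖Λ v w‖ * ‖Λ w v‖ ≤ (Λ v v).re * (Λ w w).re at h
  rwa [h1, ← sq] at h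

theorem star_mul_self_eq (z : ℂ) : star z * z = ((‖z‖ ^ 2 : ℝ) : ℂ) := by
  rw [Complex.ofReal_pow]; exact Complex.conj_mul' z

/-- One step of the Gram–Schmidt process. -/
theorem exists_gram_step {Λ : 𝒱 →ₗ⋆[ℂ] 𝒱 →ₗ[ℂ] ℂ} (hs : ∀ v w, star (Λ v w) = Λ w v)
    (hp : ∀ v, 0 ≤ Λ v v) (u : 𝒱) : ∃ T : 𝒱 →ₗ[ℂ] ℂ,
    (∀ v, 0 ≤ Λ v v - star (T v) * T v) ∧ (∀ w, Λ u w = star (T u) * T w) ∧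
      ∀ v, Λ v = 0 → T v = 0 := by
  have hre (v : 𝒱) : ((Λ v v).re : ℂ) = Λ v v := by
    have := (Complex.le_def.1 (hp v)).2
    exact Complex.ext rfl (by simpa using this)
  -- If Λ(u, u) = 0, then Λ(u, ·) = 0 by Cauchy–Schwarz and T = 0 works. Otherwise T = Λ(u, ·)/√Λ(u,
  -- u), and Cauchy–Schwarz gives the positivity of the remainder.
  rcases eq_or_ne (Λ u u) 0 with h | h
  · refine ⟨0, fun v => by simpa using hp v, fun w => ?_, fun _ _ => rfl⟩
    have := cauchy_schwarz hs hp u w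
    rw [h, Complex.zero_re, zero_mul] at this
    have h0 : ‖Λ u w‖ = 0 := pow_eq_zero_iff two_ne_zero |>.1 (le_antisymm this (sq_nonneg _))
    simpa using h0
  · set r := (Λ u u).re with hr
    have hr0 : 0 < r := lt_of_le_of_ne (Complex.le_def.1 (hp u)).1 fun h0 => h (by
      rw [← hre u, ← hr, ← h0, Complex.ofReal_zero])
    have hsq : ((√r : ℝ) : ℂ)⁻¹ * ((√r : ℝ) : ℂ)⁻¹ = (r : ℂ)⁻¹ := by
      rw [← mul_inv, ← Complex.ofReal_mul, Real.mul_self_sqrt hr0.le]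
    refine ⟨((√r : ℝ) : ℂ)⁻¹ • Λ u, fun v => ?_, fun w => ?_, fun v hv => ?_⟩
    · have h1 : star ((((√r : ℝ) : ℂ)⁻¹ • Λ u) v) * (((√r : ℝ) : ℂ)⁻¹ • Λ u) v =
          ((r⁻¹ * ‖Λ u v‖ ^ 2 : ℝ) : ℂ) := by
        rw [star_mul_self_eq, LinearMap.smul_apply, norm_smul, mul_pow, norm_inv, Complex.norm_real,
          Real.norm_of_nonneg (Real.sqrt_nonneg r), inv_pow, Real.sq_sqrt hr0.le]
      rw [h1, ← hre v, ← Complex.ofReal_sub]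
      refine Complex.zero_le_real.2 (sub_nonneg.2 ?_)
      rw [inv_mul_le_iff₀ hr0]
      exact cauchy_schwarz hs hp u v
    · rw [LinearMap.smul_apply, LinearMap.smul_apply, smul_eq_mul, smul_eq_mul, star_mul']
      have h2 : star ((√r : ℝ) : ℂ)⁻¹ = ((√r : ℝ) : ℂ)⁻¹ := by
        rw [← Complex.ofReal_inv]; exact Complex.conj_ofReal _
      rw [h2, hs, ← hre u, ← hr]
      have h3 : (r : ℂ) ≠ 0 := Complex.ofReal_ne_zero.2 hr0.ne'
      calc Λ u w = (r : ℂ)⁻¹ * r * Λ u w := by rw [inv_mul_cancel₀ h3, one_mul]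
        _ = _ := by rw [← hsq]; ring
    · rw [LinearMap.smul_apply, ← hs, hv, LinearMap.zero_apply, star_zero, smul_zero]

/-- On finitely many vectors, a positive semidefinite form is a Gram form. -/
theorem exists_gram {Λ : 𝒱 →ₗ⋆[ℂ] 𝒱 →ₗ[ℂ] ℂ} (hs : ∀ v w, star (Λ v w) = Λ w v)
    (hp : ∀ v, 0 ≤ Λ v v) (A : Set 𝒱) (hA : A.Finite) :
    ∃ (κ : Type) (_ : Fintype κ) (T : κ → 𝒱 →ₗ[ℂ] ℂ),
      ∀ v ∈ A, ∀ w, Λ v w = ∑ k, star (T k v) * T k w := by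
  suffices h : ∃ (κ : Type) (_ : Fintype κ) (T : κ → 𝒱 →ₗ[ℂ] ℂ),
      (∀ v, 0 ≤ Λ v v - ∑ k, star (T k v) * T k v) ∧
      ∀ v ∈ A, ∀ w, Λ v w = ∑ k, star (T k v) * T k w by
    obtain ⟨κ, i, T, -, h⟩ := h
    exact ⟨κ, i, T, h⟩
  induction A, hA using Set.Finite.induction_on with
  | empty => exact ⟨Empty, inferInstance, fun k => k.elim, fun v => by simpa using hp v, by simp⟩
  | @insert u A _ _ ih =>
    obtain ⟨κ, _, T, h1, h2⟩ := ih
    -- The part of Λ not yet represented; it is again hermitian and positive, so the Gram–Schmidt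
    -- step applies to it and the new vector u.
    let r : 𝒱 →ₗ⋆[ℂ] 𝒱 →ₗ[ℂ] ℂ := LinearMap.mk₂'ₛₗ (starRingEnd ℂ) (RingHom.id ℂ)
      (fun v w => Λ v w - ∑ k, star (T k v) * T k w)
      (fun v v' w => by
        simp only [map_add, LinearMap.add_apply, star_add, add_mul, Finset.sum_add_distrib]; ring)
      (fun c v w => by
        simp only [LinearMap.map_smulₛₗ, LinearMap.smul_apply, smul_eq_mul, star_mul',
          RingHom.id_apply, mul_assoc, ← Finset.mul_sum, mul_sub]; rfl)
      (fun v w w' => by simp only [map_add, mul_add, Finset.sum_add_distrib]; ring)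
      (fun c v w => by
        simp only [map_smul, smul_eq_mul, RingHom.id_apply, mul_left_comm _ c, ← Finset.mul_sum,
          mul_sub])
    have hr (v w : 𝒱) : r v w = Λ v w - ∑ k, star (T k v) * T k w := rfl
    obtain ⟨T', h3, h4, h5⟩ := exists_gram_step (Λ := r) (fun v w => by
      rw [hr, hr, star_sub, hs, star_sum]
      congr 1
      refine Finset.sum_congr rfl fun k _ => ?_
      rw [star_mul', star_star, mul_comm]) h1 u
    refine ⟨Option κ, inferInstance, fun k => k.elim T' T, fun v => ?_, fun v hv w => ?_⟩
    · rw [Fintype.sum_option]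
      convert h3 v using 1
      rw [hr]; simp only [Option.elim_none, Option.elim_some]; ring
    · rw [Fintype.sum_option]
      simp only [Option.elim_none, Option.elim_some]
      rcases hv with rfl | hv
      · rw [← h4, hr]; ring
      -- Vectors treated earlier lie in the kernel of r, where the new functional vanishes, so their
      -- identities persist.
      · have h6 : r v = 0 := LinearMap.ext fun w => by
          rw [hr, ← h2 v hv w, sub_self, LinearMap.zero_apply]
        rw [h5 v h6, star_zero, zero_mul, zero_add]
        exact h2 v hv w

end Gram

/-! ### Polynomial Fock space in finitely many variables. -/

section Fock

open MvPolynomial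

variable {J : Type*}

/-- The derivation of the polynomial ring with `X j ↦ d j`. -/
def der (d : J → ℂ) : Derivation ℂ (MvPolynomial J ℂ) (MvPolynomial J ℂ) :=
  mkDerivation ℂ fun j => C (d j)

theorem der_X (d : J → ℂ) (j : J) : der d (X j) = C (d j) := mkDerivation_X _ _ _

/-- The commutator is again a derivation, and it kills the variables because their derivatives are
constants. -/
theorem der_comm (d d' : J → ℂ) (p : MvPolynomial J ℂ) :
    der d (der d' p) = der d' (der d p) := by
  have h : ⁅der d, der d'⁆ = 0 := derivation_ext fun j => by
    rw [Derivation.commutator_apply, der_X, der_X]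
    simp [derivation_C]
  have h1 := congrArg (fun D => D p) h
  rw [Derivation.commutator_apply] at h1
  exact sub_eq_zero.1 h1

/-- The sum of the derivation `der d` and the multiplication by `m`. -/
def fieldOp (d : J → ℂ) (m : MvPolynomial J ℂ) : Module.End ℂ (MvPolynomial J ℂ) :=
  (der d).toLinearMap + LinearMap.mulLeft ℂ m

theorem fieldOp_apply (d : J → ℂ) (m p : MvPolynomial J ℂ) :
    fieldOp d m p = der d p + m * p := rfl

/-- Derivations commute among themselves, as do multiplications; only the Leibniz cross terms
survive in the commutator. -/
theorem fieldOp_mul (d d' : J → ℂ) (m m' : MvPolynomial J ℂ) :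
    fieldOp d m * fieldOp d' m' =
      fieldOp d' m' * fieldOp d m + LinearMap.mulLeft ℂ (der d m' - der d' m) := by
  refine LinearMap.ext fun p => ?_
  simp only [Module.End.mul_apply, LinearMap.add_apply, fieldOp_apply, LinearMap.mulLeft_apply,
    map_add, Derivation.leibniz, smul_eq_mul, der_comm d d']
  ring

variable [Fintype J]

/-- The linear form `∑ j, m j X j`. -/
def linPoly (m : J → ℂ) : MvPolynomial J ℂ := ∑ j, C (m j) * X j

theorem der_linPoly (d m : J → ℂ) : der d (linPoly m) = C (∑ j, d j * m j) := by
  simp only [linPoly, map_sum, Derivation.leibniz, der_X, map_mul, smul_eq_mul]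
  refine Finset.sum_congr rfl fun j _ => ?_
  rw [der, derivation_C]; ring

theorem der_apply (d : J → ℂ) (p : MvPolynomial J ℂ) : der d p = ∑ j, C (d j) * pderiv j p := by
  have hs (p : MvPolynomial J ℂ) :
      (∑ j, d j • pderiv (R := ℂ) j) p = ∑ j, C (d j) * pderiv j p := by
    refine (congrFun (map_sum (Derivation.coeFnAddMonoidHom (R := ℂ) (A := MvPolynomial J ℂ)
      (M := MvPolynomial J ℂ)) (fun j => d j • pderiv (R := ℂ) j) Finset.univ) p).trans ?_
    rw [Finset.sum_apply]
    refine Finset.sum_congr rfl fun j _ => ?_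
    rw [← smul_eq_C_mul]; rfl
  have h : der d = ∑ j, d j • pderiv (R := ℂ) j := derivation_ext fun i => by
    classical
    rw [der_X, hs]
    simp only [pderiv_X]
    rw [Finset.sum_eq_single i (fun j _ hj => by rw [Pi.single_eq_of_ne hj.symm, mul_zero])
      (fun h => absurd (Finset.mem_univ i) h), Pi.single_eq_same, mul_one]
  rw [h, hs]

/-- The weight `α!` of a multi-index. -/
def multiFactorial (α : J →₀ ℕ) : ℕ := ∏ j, (α j).factorial

theorem multiFactorial_add_single (α : J →₀ ℕ) (i : J) :
    multiFactorial (α + Finsupp.single i 1) = (α i + 1) * multiFactorial α := by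
  classical
  have h (j : J) : ((α + Finsupp.single i 1 : J →₀ ℕ) j).factorial =
      (if i = j then α j + 1 else 1) * (α j).factorial := by
    rw [Finsupp.add_apply, Finsupp.single_apply]
    split_ifs
    · rw [Nat.factorial_succ]
    · rw [add_zero, one_mul]
  rw [multiFactorial, Finset.prod_congr rfl fun j _ => h j, Finset.prod_mul_distrib,
    Finset.prod_ite_eq]
  simp [multiFactorial]

/-- The bilinear form on polynomials with `⟨X^α, X^β⟩ = α! δ_{αβ}`. -/
def fockBilin : MvPolynomial J ℂ →ₗ[ℂ] MvPolynomial J ℂ →ₗ[ℂ] ℂ :=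
  (basisMonomials J ℂ).constr ℂ fun α => (multiFactorial α : ℂ) • lcoeff ℂ α

theorem fockBilin_monomial (α : J →₀ ℕ) (q : MvPolynomial J ℂ) :
    fockBilin (monomial α 1) q = multiFactorial α * coeff α q := by
  have h := (basisMonomials J ℂ).constr_basis ℂ
    (fun α => (multiFactorial α : ℂ) • (lcoeff ℂ α : MvPolynomial J ℂ →ₗ[ℂ] ℂ)) α
  rw [coe_basisMonomials] at h
  rw [fockBilin, h]; rfl

theorem fockBilin_eq_sum (p q : MvPolynomial J ℂ) :
    fockBilin p q = ∑ α ∈ p.support, multiFactorial α * (coeff α p * coeff α q) := by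
  conv_lhs => rw [p.as_sum]
  rw [map_sum, LinearMap.sum_apply]
  refine Finset.sum_congr rfl fun α _ => ?_
  have : monomial α (coeff α p) = coeff α p • monomial α (1 : ℂ) := by
    rw [smul_monomial, smul_eq_mul, mul_one]
  rw [this, map_smul, LinearMap.smul_apply, fockBilin_monomial, smul_eq_mul]; ring

/-- On monomials this is (α + e_j)! = (α_j + 1) α!, the reason for the weights α!. -/
theorem fockBilin_X_mul (j : J) (p q : MvPolynomial J ℂ) :
    fockBilin (X j * p) q = fockBilin p (pderiv j q) := by
  have h : (fockBilin.flip q) ∘ₗ LinearMap.mulLeft ℂ (X j) = fockBilin.flip (pderiv j q) := by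
    refine (basisMonomials J ℂ).ext fun α => ?_
    rw [coe_basisMonomials]
    simp only [LinearMap.comp_apply, LinearMap.flip_apply, LinearMap.mulLeft_apply]
    have h1 : (X j * monomial α 1 : MvPolynomial J ℂ) = monomial (α + Finsupp.single j 1) 1 := by
      rw [X, monomial_mul, one_mul, add_comm]
    rw [h1, fockBilin_monomial, fockBilin_monomial, multiFactorial_add_single, coeff_pderiv]
    push_cast; ring
  exact congrArg (fun f => f p) h

theorem fockBilin_symm (p q : MvPolynomial J ℂ) : fockBilin p q = fockBilin q p := by
  have h : (fockBilin : MvPolynomial J ℂ →ₗ[ℂ] _) = fockBilin.flip := by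
    classical
    refine (basisMonomials J ℂ).ext fun α => (basisMonomials J ℂ).ext fun β => ?_
    rw [coe_basisMonomials]
    simp only [LinearMap.flip_apply]
    rw [fockBilin_monomial, fockBilin_monomial, coeff_monomial, coeff_monomial]
    by_cases h : α = β
    · rw [h]
    · rw [if_neg (Ne.symm h), if_neg h, mul_zero, mul_zero]
  exact congrArg (fun f => f p q) h

/-- Complex conjugation of the coefficients. -/
def conjPoly : MvPolynomial J ℂ →+* MvPolynomial J ℂ := MvPolynomial.map (starRingEnd ℂ)

/-- The inner product on polynomials with `⟨X^α, X^β⟩ = α! δ_{αβ}`. -/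
def fockInner (p q : MvPolynomial J ℂ) : ℂ := fockBilin (conjPoly p) q

theorem fockInner_self_nonneg (p : MvPolynomial J ℂ) : 0 ≤ fockInner p p := by
  rw [fockInner, fockBilin_eq_sum]
  refine Finset.sum_nonneg fun α _ => mul_nonneg (Nat.cast_nonneg _) ?_
  rw [conjPoly, coeff_map]
  exact star_mul_self_nonneg (coeff α p)

theorem fockInner_one_left (p : MvPolynomial J ℂ) : fockInner 1 p = constantCoeff p := by
  rw [fockInner, map_one]
  have := fockBilin_monomial 0 p
  rw [← C_apply, C_1] at this
  rw [this, constantCoeff_eq]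
  simp [multiFactorial]

theorem fockInner_mul_linPoly (m : J → ℂ) (p q : MvPolynomial J ℂ) :
    fockInner (linPoly m * p) q = fockInner p (der (star m) q) := by
  rw [der_apply]
  simp only [fockInner, linPoly, conjPoly, map_mul, map_sum, Finset.sum_mul, map_C, map_X,
    LinearMap.sum_apply]
  refine Finset.sum_congr rfl fun j _ => ?_
  rw [mul_assoc, ← smul_eq_C_mul, ← smul_eq_C_mul, map_smul, map_smul, LinearMap.smul_apply,
    fockBilin_X_mul]
  rfl

theorem fockInner_conj (p q : MvPolynomial J ℂ) : star (fockInner p q) = fockInner q p := by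
  have h (p q : MvPolynomial J ℂ) : star (fockBilin p q) = fockBilin (conjPoly p) (conjPoly q) := by
    have hs : (conjPoly p).support = p.support := by
      ext α
      simp [conjPoly, mem_support_iff, coeff_map]
    rw [fockBilin_eq_sum, fockBilin_eq_sum, hs, star_sum]
    refine Finset.sum_congr rfl fun α _ => ?_
    rw [star_mul', star_mul', conjPoly, coeff_map, coeff_map, star_natCast]; rfl
  have h2 : conjPoly (conjPoly p) = p := by
    rw [conjPoly, MvPolynomial.map_map]
    convert MvPolynomial.map_id p
    ext z; simp
  rw [fockInner, h, h2, fockBilin_symm]; rfl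

theorem fockInner_der (d : J → ℂ) (p q : MvPolynomial J ℂ) :
    fockInner (der d p) q = fockInner p (linPoly (star d) * q) := by
  rw [← fockInner_conj, ← fockInner_conj (linPoly (star d) * q), fockInner_mul_linPoly, star_star]

theorem fockInner_fieldOp (d m : J → ℂ) (p q : MvPolynomial J ℂ) :
    fockInner (fieldOp d (linPoly m) p) q =
      fockInner p (fieldOp (star m) (linPoly (star d)) q) := by
  have h1 (p p' q : MvPolynomial J ℂ) : fockInner (p + p') q = fockInner p q + fockInner p' q := by
    simp [fockInner]
  have h2 (p q q' : MvPolynomial J ℂ) : fockInner p (q + q') = fockInner p q + fockInner p q' :=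
    map_add _ _ _
  rw [fieldOp_apply, fieldOp_apply, h1, h2, fockInner_der, fockInner_mul_linPoly, add_comm]

end Fock

section

open MvPolynomial

/-! ### Algebra of constant-coefficient derivations. -/

section Fields

variable {J J' : Type*}

theorem der_add (d d' : J → ℂ) : der (d + d') = der d + der d' :=
  derivation_ext fun j => by simp [der_X]

theorem der_smul (c : ℂ) (d : J → ℂ) : der (c • d) = c • der d :=
  derivation_ext fun j => by simp [der_X, smul_eq_C_mul]

theorem der_C (d : J → ℂ) (c : ℂ) : der d (C c) = 0 := derivation_C _ _

theorem fieldOp_add (d d' : J → ℂ) (m m' : MvPolynomial J ℂ) :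
    fieldOp (d + d') (m + m') = fieldOp d m + fieldOp d' m' := by
  refine LinearMap.ext fun p => ?_
  rw [LinearMap.add_apply, fieldOp_apply, fieldOp_apply, fieldOp_apply, der_add,
    Derivation.add_apply]
  ring

theorem fieldOp_smul (c : ℂ) (d : J → ℂ) (m : MvPolynomial J ℂ) :
    fieldOp (c • d) (c • m) = c • fieldOp d m := by
  refine LinearMap.ext fun p => ?_
  rw [LinearMap.smul_apply, fieldOp_apply, fieldOp_apply, der_smul, Derivation.smul_apply,
    smul_add, smul_mul_assoc]

/-- A homomorphism of polynomial rings intertwines derivations if it does so on the variables. -/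
theorem map_der (θ : MvPolynomial J ℂ →ₐ[ℂ] MvPolynomial J' ℂ) {d : J → ℂ} {d' : J' → ℂ}
    (h : ∀ j, der d' (θ (X j)) = C (d j)) (p : MvPolynomial J ℂ) :
    θ (der d p) = der d' (θ p) := by
  have hC (c : ℂ) : θ (C c) = C c := θ.commutes c
  induction p using MvPolynomial.induction_on with
  | C c => rw [der_C, hC, der_C, map_zero]
  | add p q hp hq => rw [map_add, map_add, map_add, map_add, hp, hq]
  | mul_X p j hp =>
    rw [Derivation.leibniz, map_mul, Derivation.leibniz, der_X, h]
    simp only [smul_eq_mul, map_add, map_mul, hp, hC]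

theorem map_fieldOp (θ : MvPolynomial J ℂ →ₐ[ℂ] MvPolynomial J' ℂ) {d : J → ℂ} {d' : J' → ℂ}
    (h : ∀ j, der d' (θ (X j)) = C (d j)) {m : MvPolynomial J ℂ} {m' : MvPolynomial J' ℂ}
    (hm : θ m = m') (p : MvPolynomial J ℂ) : θ (fieldOp d m p) = fieldOp d' m' (θ p) := by
  rw [fieldOp_apply, fieldOp_apply, map_add, map_mul, map_der θ h, hm]

theorem der_prod {κ : Type*} (d : J → ℂ) (s : Finset κ) (f : κ → MvPolynomial J ℂ)
    (c : κ → ℂ) (h : ∀ i, der d (f i) = C (c i)) [DecidableEq κ] :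
    der d (∏ i ∈ s, f i) = ∑ i ∈ s, C (c i) * ∏ j ∈ s.erase i, f j := by
  induction s using Finset.induction_on with
  | empty => simp
  | insert a s ha ih =>
    rw [Finset.prod_insert ha, Derivation.leibniz, ih, h, Finset.sum_insert ha,
      Finset.erase_insert ha, smul_eq_mul, smul_eq_mul, Finset.mul_sum, add_comm, mul_comm]
    congr 1
    refine Finset.sum_congr rfl fun i hi => ?_
    have hia : a ≠ i := fun e => ha (e ▸ hi)
    rw [Finset.erase_insert_of_ne hia, Finset.prod_insert (fun e => ha (Finset.mem_of_mem_erase e))]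
    ring

/-- The factors other than the i-th are enumerated through the transposition of 0 and i, which is
how `Equiv.Perm.decomposeFin` splits a permutation of `Fin (k + 1)`. -/
theorem der_prod_fin {k : ℕ} (d : J → ℂ) (f : Fin (k + 1) → MvPolynomial J ℂ)
    (c : Fin (k + 1) → ℂ) (h : ∀ i, der d (f i) = C (c i)) :
    der d (∏ i, f i) = ∑ i, C (c i) * ∏ j : Fin k, f (Equiv.swap 0 i j.succ) := by
  rw [der_prod d _ f c h]
  refine Finset.sum_congr rfl fun i _ => congrArg (C (c i) * ·) ?_
  have h1 : ∏ j : Fin k, f (Equiv.swap 0 i j.succ) =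
      ∏ j ∈ Finset.univ.erase (0 : Fin (k + 1)), f (Equiv.swap 0 i j) := by
    rw [Fin.univ_succ, Finset.erase_cons, Finset.prod_map]; rfl
  rw [h1]
  refine (Finset.prod_nbij' (Equiv.swap 0 i) (Equiv.swap 0 i) ?_ ?_ ?_ ?_ ?_).symm
  · intro j hj
    refine Finset.mem_erase.2 ⟨fun e => (Finset.ne_of_mem_erase hj) ?_, Finset.mem_univ _⟩
    exact (Equiv.swap 0 i).injective (e.trans (Equiv.swap_apply_left 0 i).symm)
  · intro j hj
    refine Finset.mem_erase.2 ⟨fun e => (Finset.ne_of_mem_erase hj) ?_, Finset.mem_univ _⟩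
    exact (Equiv.swap 0 i).injective (e.trans (Equiv.swap_apply_right 0 i).symm)
  · exact fun j _ => Equiv.swap_apply_self 0 i j
  · exact fun j _ => Equiv.swap_apply_self 0 i j
  · exact fun j _ => rfl

end Fields

/-! ### Representation of the CCR algebra on polynomials. -/

section Representation

variable {𝒱 : Type v} [AddCommGroup 𝒱] [Module ℂ 𝒱] {ι : Type*} (b : Module.Basis ι ℂ 𝒱)
  (Λp Λm : 𝒱 →ₗ⋆[ℂ] 𝒱 →ₗ[ℂ] ℂ)

/-- The vectors of `𝒱` as linear forms in the first set of variables. -/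
def linVar : 𝒱 →ₗ[ℂ] MvPolynomial (ι ⊕ ι) ℂ := b.constr ℂ fun i => X (Sum.inl i)

theorem linVar_basis (i : ι) : linVar b (b i) = X (Sum.inl i) := b.constr_basis ℂ _ i

/-- The vectors of `𝒱` as antilinear forms in the second set of variables. -/
def conjVar : 𝒱 →ₗ⋆[ℂ] MvPolynomial (ι ⊕ ι) ℂ where
  toFun v := MvPolynomial.map (starRingEnd ℂ) (b.constr ℂ (fun i => X (Sum.inr i)) v)
  map_add' v w := by rw [map_add, map_add]
  map_smul' c v := by rw [map_smul, smul_eq_C_mul, map_mul, map_C, ← smul_eq_C_mul]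

theorem conjVar_basis (i : ι) : conjVar b (b i) = X (Sum.inr i) := by
  change MvPolynomial.map _ (b.constr ℂ (fun i => X (Sum.inr i)) (b i)) = _
  rw [b.constr_basis, map_X]

theorem der_linVar (d : ι ⊕ ι → ℂ) (l : 𝒱 →ₗ[ℂ] ℂ) (h : ∀ i, d (Sum.inl i) = l (b i)) (v : 𝒱) :
    der d (linVar b v) = C (l v) := by
  have : (der d).toLinearMap ∘ₗ linVar b = Algebra.linearMap ℂ _ ∘ₗ l := b.ext fun i => by
    change der d (linVar b (b i)) = C (l (b i))
    rw [linVar_basis, der_X, h]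
  exact congrArg (fun f => f v) this

theorem der_conjVar (d : ι ⊕ ι → ℂ) (l : 𝒱 →ₗ⋆[ℂ] ℂ) (h : ∀ i, d (Sum.inr i) = l (b i)) (v : 𝒱) :
    der d (conjVar b v) = C (l v) := by
  have : (der d).toLinearMap.comp (conjVar b) =
      (Algebra.linearMap ℂ (MvPolynomial (ι ⊕ ι) ℂ)).comp l := b.ext fun i => by
    change der d (conjVar b (b i)) = C (l (b i))
    rw [conjVar_basis, der_X, h]
  exact congrArg (fun f => f v) this

/-- The coefficients of the annihilation part of `ψ(v)`. -/
def annCoeff (v : 𝒱) : ι ⊕ ι → ℂ := Sum.elim (fun i => Λp v (b i)) 0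

/-- The coefficients of the annihilation part of `ψ*(v)`. -/
def creCoeff (v : 𝒱) : ι ⊕ ι → ℂ := Sum.elim 0 fun i => Λm (b i) v

theorem der_annCoeff_linVar (v w : 𝒱) : der (annCoeff b Λp v) (linVar b w) = C (Λp v w) :=
  der_linVar b _ (Λp v) (fun _ => rfl) w

theorem der_annCoeff_conjVar (v w : 𝒱) : der (annCoeff b Λp v) (conjVar b w) = 0 := by
  rw [der_conjVar b _ 0 (fun _ => rfl) w, LinearMap.zero_apply, C_0]

theorem der_creCoeff_linVar (v w : 𝒱) : der (creCoeff b Λm v) (linVar b w) = 0 := by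
  rw [der_linVar b _ 0 (fun _ => rfl) w, LinearMap.zero_apply, C_0]

theorem der_creCoeff_conjVar (v w : 𝒱) : der (creCoeff b Λm v) (conjVar b w) = C (Λm w v) :=
  der_conjVar b _ (Λm.flip v) (fun _ => rfl) w

/-- The fields `ψ(v)` and `ψ*(v)` as operators on polynomials. -/
def genOp : CCRGen 𝒱 → Module.End ℂ (MvPolynomial (ι ⊕ ι) ℂ)
  | .ann v => fieldOp (annCoeff b Λp v) (conjVar b v)
  | .cre v => fieldOp (creCoeff b Λm v) (linVar b v)

/-- The representation of the free algebra on polynomials. -/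
def freeRep : FreeAlgebra ℂ (CCRGen 𝒱) →ₐ[ℂ] Module.End ℂ (MvPolynomial (ι ⊕ ι) ℂ) :=
  FreeAlgebra.lift ℂ (genOp b Λp Λm)

theorem freeRep_ι (g : CCRGen 𝒱) : freeRep b Λp Λm (FreeAlgebra.ι ℂ g) = genOp b Λp Λm g :=
  FreeAlgebra.lift_ι_apply _ g

/-- The derivation of ψ(v) sees only the first variables, that of ψ*(w) only the second. Hence
[ψ(v), ψ*(w)] = Λ⁺(v, w) - Λ⁻(v, w), while fields of the same type commute. -/
theorem freeRep_rel {q : HermForm 𝒱} (hq : ∀ v w, q.form v w = Λp v w - Λm v w)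
    {x y : FreeAlgebra ℂ (CCRGen 𝒱)} (h : CCRRel q x y) :
    freeRep b Λp Λm x = freeRep b Λp Λm y := by
  cases h with
  | ann_add v w =>
    rw [map_add, freeRep_ι, freeRep_ι, freeRep_ι, genOp, genOp, genOp, ← fieldOp_add, map_add]
    congr 1
    ext j; cases j <;> simp [annCoeff]
  | cre_add v w =>
    rw [map_add, freeRep_ι, freeRep_ι, freeRep_ι, genOp, genOp, genOp, ← fieldOp_add, map_add]
    congr 1
    ext j; cases j <;> simp [creCoeff]
  | ann_smul c v =>
    rw [← Algebra.smul_def, map_smul, freeRep_ι, freeRep_ι, genOp, genOp, ← fieldOp_smul,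
      LinearMap.map_smulₛₗ]
    congr 1
    ext j; cases j <;> simp [annCoeff]
  | cre_smul c v =>
    rw [← Algebra.smul_def, map_smul, freeRep_ι, freeRep_ι, genOp, genOp, ← fieldOp_smul, map_smul]
    congr 1
    ext j; cases j <;> simp [creCoeff]
  | ann_comm v w =>
    rw [map_mul, map_mul, freeRep_ι, freeRep_ι, genOp, genOp, fieldOp_mul, der_annCoeff_conjVar,
      der_annCoeff_conjVar, sub_zero, LinearMap.mulLeft_zero_eq_zero, add_zero]
  | cre_comm v w =>
    rw [map_mul, map_mul, freeRep_ι, freeRep_ι, genOp, genOp, fieldOp_mul, der_creCoeff_linVar,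
      der_creCoeff_linVar, sub_zero, LinearMap.mulLeft_zero_eq_zero, add_zero]
  | ccr v w =>
    rw [map_add, map_mul, map_mul, freeRep_ι, freeRep_ι, genOp, genOp, fieldOp_mul,
      der_annCoeff_linVar, der_creCoeff_conjVar, ← C_sub, ← hq, AlgHom.commutes]
    congr 1
    refine LinearMap.ext fun p => ?_
    rw [LinearMap.mulLeft_apply, ← smul_eq_C_mul]; rfl

variable {Λp Λm} in
/-- The representation of the CCR algebra on polynomials. -/
def ccrRep {q : HermForm 𝒱} (hq : ∀ v w, q.form v w = Λp v w - Λm v w) :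
    CCR q →ₐ[ℂ] Module.End ℂ (MvPolynomial (ι ⊕ ι) ℂ) :=
  RingQuot.liftAlgHom ℂ ⟨freeRep b Λp Λm, fun _ _ h => freeRep_rel b Λp Λm hq h⟩

theorem ccrRep_mk {q : HermForm 𝒱} (hq : ∀ v w, q.form v w = Λp v w - Λm v w)
    (x : FreeAlgebra ℂ (CCRGen 𝒱)) : ccrRep b hq (CCR.mk q x) = freeRep b Λp Λm x :=
  RingQuot.liftAlgHom_mkAlgHom_apply _ _ _ _

/-! ### Positivity -/

section Positivity

variable {J : Type*} [Fintype J]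

/-- The fields on a finite dimensional Fock space. -/
def fockGen (d m : 𝒱 → J → ℂ) : CCRGen 𝒱 → Module.End ℂ (MvPolynomial J ℂ)
  | .ann v => fieldOp (d v) (linPoly (m v))
  | .cre v => fieldOp (star (m v)) (linPoly (star (d v)))

/-- The representation of the free algebra on a finite dimensional Fock space. -/
def fockRep (d m : 𝒱 → J → ℂ) : FreeAlgebra ℂ (CCRGen 𝒱) →ₐ[ℂ] Module.End ℂ (MvPolynomial J ℂ) :=
  FreeAlgebra.lift ℂ (fockGen d m)

theorem fockRep_ι (d m : 𝒱 → J → ℂ) (g : CCRGen 𝒱) :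
    fockRep d m (FreeAlgebra.ι ℂ g) = fockGen d m g :=
  FreeAlgebra.lift_ι_apply _ g

/-- It suffices to check generators, for which `fockInner_fieldOp` says that ψ and ψ* are adjoint in
the Fock inner product. -/
theorem fockInner_fockRep (d m : 𝒱 → J → ℂ) (x : FreeAlgebra ℂ (CCRGen 𝒱)) :
    ∀ p r : MvPolynomial J ℂ,
      fockInner (fockRep d m x p) r = fockInner p (fockRep d m (CCR.preStar x).unop r) := by
  induction x using FreeAlgebra.induction with
  | grade0 c =>
    intro p r
    rw [CCR.preStar_algebraMap, MulOpposite.unop_op, AlgHom.commutes, AlgHom.commutes]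
    change fockInner (c • p) r = fockInner p (star c • r)
    simp only [fockInner, conjPoly, smul_eq_C_mul, map_mul, map_C]
    rw [← smul_eq_C_mul, ← smul_eq_C_mul, map_smul, map_smul]; rfl
  | grade1 g =>
    intro p r
    rw [CCR.preStar_ι, MulOpposite.unop_op, fockRep_ι, fockRep_ι]
    cases g with
    | ann v => exact fockInner_fieldOp _ _ _ _
    | cre v =>
      have := fockInner_fieldOp (star (m v)) (star (d v)) p r
      rwa [star_star, star_star] at this
  | mul x y hx hy =>
    intro p r
    rw [map_mul, map_mul, MulOpposite.unop_mul, map_mul]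
    exact (hx _ _).trans (hy _ _)
  | add x y hx hy =>
    intro p r
    rw [map_add, map_add, MulOpposite.unop_add, map_add, LinearMap.add_apply, LinearMap.add_apply]
    have h1 (p p' q : MvPolynomial J ℂ) : fockInner (p + p') q = fockInner p q + fockInner p' q := by
      simp [fockInner]
    have h2 (p q q' : MvPolynomial J ℂ) : fockInner p (q + q') = fockInner p q + fockInner p q' :=
      map_add _ _ _
    rw [h1, h2, hx, hy]

end Positivity

/-- The finite set of vectors occurring in x is fixed before the Fock space and θ, so that these may
afterwards be built from a Gram representation valid on that set. -/
theorem exists_finite_intertwine (x : FreeAlgebra ℂ (CCRGen 𝒱)) : ∃ A : Set 𝒱, A.Finite ∧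
    ∀ (J : Type) (_ : Fintype J) (d m : 𝒱 → J → ℂ)
      (θ : MvPolynomial (ι ⊕ ι) ℂ →ₐ[ℂ] MvPolynomial J ℂ),
      (∀ v ∈ A, ∀ p, θ (genOp b Λp Λm (.ann v) p) = fockGen d m (.ann v) (θ p)) →
      (∀ v ∈ A, ∀ p, θ (genOp b Λp Λm (.cre v) p) = fockGen d m (.cre v) (θ p)) →
      ∀ p, θ (freeRep b Λp Λm x p) = fockRep d m x (θ p) := by
  induction x using FreeAlgebra.induction with
  | grade0 c =>
    refine ⟨∅, Set.finite_empty, fun J _ d m θ _ _ p => ?_⟩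
    rw [AlgHom.commutes, AlgHom.commutes]
    exact map_smul θ c p
  | grade1 g =>
    cases g with
    | ann v =>
      refine ⟨{v}, Set.finite_singleton v, fun J _ d m θ h _ p => ?_⟩
      rw [freeRep_ι, fockRep_ι]
      exact h v rfl p
    | cre v =>
      refine ⟨{v}, Set.finite_singleton v, fun J _ d m θ _ h p => ?_⟩
      rw [freeRep_ι, fockRep_ι]
      exact h v rfl p
  | mul x y hx hy =>
    obtain ⟨A, hA, hx⟩ := hx
    obtain ⟨B, hB, hy⟩ := hy
    refine ⟨A ∪ B, hA.union hB, fun J _ d m θ h h' p => ?_⟩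
    rw [map_mul, map_mul, Module.End.mul_apply, Module.End.mul_apply,
      hx J _ d m θ (fun v hv => h v (Or.inl hv)) (fun v hv => h' v (Or.inl hv)),
      hy J _ d m θ (fun v hv => h v (Or.inr hv)) (fun v hv => h' v (Or.inr hv))]
  | add x y hx hy =>
    obtain ⟨A, hA, hx⟩ := hx
    obtain ⟨B, hB, hy⟩ := hy
    refine ⟨A ∪ B, hA.union hB, fun J _ d m θ h h' p => ?_⟩
    rw [map_add, map_add, LinearMap.add_apply, LinearMap.add_apply, map_add,
      hx J _ d m θ (fun v hv => h v (Or.inl hv)) (fun v hv => h' v (Or.inl hv)),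
      hy J _ d m θ (fun v hv => h v (Or.inr hv)) (fun v hv => h' v (Or.inr hv))]

end Representation

end

section

open MvPolynomial

/-! ### Homomorphisms from the polynomials over a basis to a finite Fock space. -/

section Intertwiner

variable {𝒱 : Type v} [AddCommGroup 𝒱] [Module ℂ 𝒱] {ι : Type*} (b : Module.Basis ι ℂ 𝒱)
  {J : Type*} [Fintype J]

theorem linPoly_add (m m' : J → ℂ) : linPoly (m + m') = linPoly m + linPoly m' := by
  simp [linPoly, add_mul, Finset.sum_add_distrib]

theorem linPoly_smul (c : ℂ) (m : J → ℂ) : linPoly (c • m) = c • linPoly m := by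
  simp only [linPoly, Finset.smul_sum, Pi.smul_apply, smul_eq_mul, map_mul, smul_eq_C_mul, mul_assoc]

theorem constantCoeff_linPoly (m : J → ℂ) : constantCoeff (linPoly m) = 0 := by
  simp [linPoly]

/-- The homomorphism of polynomial rings induced by a linear map and an antilinear map. -/
def fockMap (t : 𝒱 →ₗ[ℂ] J → ℂ) (t' : 𝒱 →ₗ⋆[ℂ] J → ℂ) :
    MvPolynomial (ι ⊕ ι) ℂ →ₐ[ℂ] MvPolynomial J ℂ :=
  aeval (Sum.elim (fun i => linPoly (t (b i))) fun i => linPoly (t' (b i)))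

variable (t : 𝒱 →ₗ[ℂ] J → ℂ) (t' : 𝒱 →ₗ⋆[ℂ] J → ℂ)

theorem fockMap_linVar (v : 𝒱) : fockMap b t t' (linVar b v) = linPoly (t v) := by
  let l : (J → ℂ) →ₗ[ℂ] MvPolynomial J ℂ :=
    { toFun := linPoly, map_add' := linPoly_add, map_smul' := linPoly_smul }
  have : (fockMap b t t').toLinearMap ∘ₗ linVar b = l ∘ₗ t := b.ext fun i => by
    change fockMap b t t' (linVar b (b i)) = linPoly (t (b i))
    rw [linVar_basis, fockMap, aeval_X]; rfl
  exact congrArg (fun f => f v) this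

theorem fockMap_conjVar (v : 𝒱) : fockMap b t t' (conjVar b v) = linPoly (t' v) := by
  let l : (J → ℂ) →ₗ[ℂ] MvPolynomial J ℂ :=
    { toFun := linPoly, map_add' := linPoly_add, map_smul' := linPoly_smul }
  have : (fockMap b t t').toLinearMap.comp (conjVar b) = l.comp t' := b.ext fun i => by
    change fockMap b t t' (conjVar b (b i)) = linPoly (t' (b i))
    rw [conjVar_basis, fockMap, aeval_X]; rfl
  exact congrArg (fun f => f v) this

/-- Variables go to linear forms without constant term, so vacuum expectations are preserved. -/
theorem constantCoeff_fockMap (p : MvPolynomial (ι ⊕ ι) ℂ) :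
    constantCoeff (fockMap b t t' p) = constantCoeff p := by
  have : (constantCoeff : MvPolynomial J ℂ →+* ℂ).comp (fockMap b t t').toRingHom =
      constantCoeff := by
    refine ringHom_ext (fun c => ?_) fun i => ?_
    · change constantCoeff (fockMap b t t' (algebraMap ℂ _ c)) = _
      rw [AlgHom.commutes, algebraMap_eq, constantCoeff_C, constantCoeff_C]
    · change constantCoeff (fockMap b t t' (X i)) = _
      rw [fockMap, aeval_X, constantCoeff_X]
      cases i <;> exact constantCoeff_linPoly _
  exact congrArg (fun f => f p) this

end Intertwiner

/-! ### The quasi-free state with given covariances. -/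

section QuasiFree

variable {𝒱 : Type v} [AddCommGroup 𝒱] [Module ℂ 𝒱] {ι : Type*} (b : Module.Basis ι ℂ 𝒱)
  {Λp Λm : 𝒱 →ₗ⋆[ℂ] 𝒱 →ₗ[ℂ] ℂ}

/-- After transport to a finite-dimensional Fock space, the constant term for x*x becomes the inner
product of x applied to 1 with itself. -/
theorem freeRep_nonneg (hsp : ∀ v w, star (Λp v w) = Λp w v) (hsm : ∀ v w, star (Λm v w) = Λm w v)
    (hp : ∀ v, 0 ≤ Λp v v) (hm : ∀ v, 0 ≤ Λm v v) (x : FreeAlgebra ℂ (CCRGen 𝒱)) :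
    0 ≤ constantCoeff (freeRep b Λp Λm ((CCR.preStar x).unop * x) 1) := by
  obtain ⟨A, hA, h⟩ := exists_finite_intertwine b Λp Λm ((CCR.preStar x).unop * x)
  obtain ⟨κ, _, T, hT⟩ := exists_gram hsp hp A hA
  obtain ⟨κ', _, T', hT'⟩ := exists_gram hsm hm A hA
  -- The Gram functionals of Λ⁺ and Λ⁻ use disjoint sets of modes. Those of Λ⁻ are conjugated,
  -- because the second set of variables depends antilinearly on the vector.
  let t : 𝒱 →ₗ[ℂ] κ ⊕ κ' → ℂ :=
    { toFun := fun v => Sum.elim (fun k => T k v) 0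
      map_add' := fun v w => by ext j; cases j <;> simp
      map_smul' := fun c v => by ext j; cases j <;> simp }
  let t' : 𝒱 →ₗ⋆[ℂ] κ ⊕ κ' → ℂ :=
    { toFun := fun v => Sum.elim 0 (fun k => star (T' k v))
      map_add' := fun v w => by ext j; cases j <;> simp
      map_smul' := fun c v => by ext j; cases j <;> simp }
  set θ := fockMap b t t' with hθ
  have hX (i : ι) : θ (X (Sum.inl i)) = linPoly (t (b i)) := by
    rw [← linVar_basis b i]; exact fockMap_linVar b t t' _
  have hX' (i : ι) : θ (X (Sum.inr i)) = linPoly (t' (b i)) := by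
    rw [← conjVar_basis b i]; exact fockMap_conjVar b t t' _
  -- With annihilation coefficients `star (t v)`, differentiating `linPoly (t (b i))` gives Λ⁺(v, b
  -- i), as `annCoeff` requires. Here v is in the finite set but b i is arbitrary, so the Gram
  -- identity is needed with its second argument unrestricted.
  have key := h (κ ⊕ κ') inferInstance (fun v => star (t v)) t' θ
    (fun v hv => map_fieldOp θ (fun j => by
      cases j with
      | inl i =>
        rw [hX, der_linPoly, annCoeff, Sum.elim_inl, hT v hv, Fintype.sum_sum_type]
        simp [t]
      | inr i =>
        rw [hX', der_linPoly, annCoeff, Sum.elim_inr, Fintype.sum_sum_type]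
        simp [t, t']) (fockMap_conjVar b t t' v))
    (fun v hv => map_fieldOp θ (fun j => by
      cases j with
      | inl i =>
        rw [hX, der_linPoly, creCoeff, Sum.elim_inl, Fintype.sum_sum_type]
        simp [t, t']
      | inr i =>
        rw [hX', der_linPoly, creCoeff, Sum.elim_inr, ← hsm, hT' v hv, Fintype.sum_sum_type]
        simp [t']) (by rw [star_star]; exact fockMap_linVar b t t' v)) 1
  rw [← constantCoeff_fockMap b t t', ← hθ, key, map_one, ← fockInner_one_left, map_mul,
    Module.End.mul_apply]
  have h3 := fockInner_fockRep (fun v => star (t v)) t' x 1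
    (fockRep (fun v => star (t v)) t' x 1)
  rw [← h3]
  exact fockInner_self_nonneg _

variable {q : HermForm 𝒱} (hq : ∀ v w, q.form v w = Λp v w - Λm v w)

/-- The quasi-free state with complex covariances `Λ^±`. -/
def quasiFreeState (hsp : ∀ v w, star (Λp v w) = Λp w v) (hsm : ∀ v w, star (Λm v w) = Λm w v)
    (hp : ∀ v, 0 ≤ Λp v v) (hm : ∀ v, 0 ≤ Λm v v) : State q where
  toLin := lcoeff ℂ 0 ∘ₗ LinearMap.applyₗ (1 : MvPolynomial (ι ⊕ ι) ℂ) ∘ₗ (ccrRep b hq).toLinearMap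
  map_one := by
    change coeff 0 (ccrRep b hq 1 1) = 1
    rw [_root_.map_one (ccrRep b hq)]
    exact coeff_zero_one
  nonneg a := by
    obtain ⟨x, rfl⟩ := CCR.mk_surjective q a
    have h1 : star (CCR.mk q x) = CCR.mk q (CCR.preStar x).unop :=
      congrArg MulOpposite.unop (CCR.starHom_mk q x)
    change 0 ≤ coeff 0 (ccrRep b hq (star (CCR.mk q x) * CCR.mk q x) 1)
    rw [h1, ← map_mul, ccrRep_mk]
    exact freeRep_nonneg b hsp hsm hp hm x

/-! ### Wick's theorem -/

theorem constantCoeff_linVar (v : 𝒱) : constantCoeff (linVar b v) = 0 := by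
  let l : MvPolynomial (ι ⊕ ι) ℂ →ₗ[ℂ] ℂ := lcoeff ℂ 0
  have : l ∘ₗ linVar b = 0 := b.ext fun i => by
    change constantCoeff (linVar b (b i)) = 0
    rw [linVar_basis, constantCoeff_X]
  exact congrArg (fun f => f v) this

theorem constantCoeff_conjVar (v : 𝒱) : constantCoeff (conjVar b v) = 0 := by
  let l : MvPolynomial (ι ⊕ ι) ℂ →ₗ[ℂ] ℂ := lcoeff ℂ 0
  have : l.comp (conjVar b) = 0 := b.ext fun i => by
    change constantCoeff (conjVar b (b i)) = 0
    rw [conjVar_basis, constantCoeff_X]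
  exact congrArg (fun f => f v) this

variable (Λp Λm) in
/-- The operator representing `ψ*(w₁)⋯ψ*(wₘ)`. -/
def creProd {m : ℕ} (w : Fin m → 𝒱) : Module.End ℂ (MvPolynomial (ι ⊕ ι) ℂ) :=
  (List.ofFn fun i => genOp b Λp Λm (.cre (w i))).prod

theorem creProd_zero (w : Fin 0 → 𝒱) : creProd b Λp Λm w = 1 := rfl

theorem creProd_succ {m : ℕ} (w : Fin (m + 1) → 𝒱) :
    creProd b Λp Λm w = genOp b Λp Λm (.cre (w 0)) * creProd b Λp Λm fun i => w i.succ := by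
  rw [creProd, List.ofFn_succ, List.prod_cons]; rfl

theorem der_creProd {m : ℕ} (u : 𝒱) : ∀ (w : Fin m → 𝒱) (p : MvPolynomial (ι ⊕ ι) ℂ),
    der (creCoeff b Λm u) (creProd b Λp Λm w p) =
      creProd b Λp Λm w (der (creCoeff b Λm u) p) := by
  induction m with
  | zero => exact fun w p => rfl
  | succ m ih =>
    intro w p
    rw [creProd_succ, Module.End.mul_apply, Module.End.mul_apply, ← ih, genOp, fieldOp_apply,
      fieldOp_apply, map_add, Derivation.leibniz, der_creCoeff_linVar, smul_zero, add_zero,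
      smul_eq_mul, der_comm]

/-- The multiplication part of the leftmost ψ* has no constant term, so only its derivation
contributes; that derivation passes the other ψ*, whose multiplication parts involve only the first
variables. -/
theorem constantCoeff_creProd_succ {m : ℕ} (w : Fin (m + 1) → 𝒱) (p : MvPolynomial (ι ⊕ ι) ℂ) :
    constantCoeff (creProd b Λp Λm w p) =
      constantCoeff (creProd b Λp Λm (fun i => w i.succ) (der (creCoeff b Λm (w 0)) p)) := by
  rw [creProd_succ, Module.End.mul_apply, genOp, fieldOp_apply, map_add, map_mul,
    constantCoeff_linVar, zero_mul, add_zero, der_creProd]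

theorem constantCoeff_creProd_prod_succ {m k : ℕ} (w : Fin (m + 1) → 𝒱) (v : Fin (k + 1) → 𝒱) :
    constantCoeff (creProd b Λp Λm w (∏ j, conjVar b (v j))) = ∑ i, Λm (v i) (w 0) *
      constantCoeff (creProd b Λp Λm (fun i => w i.succ)
        (∏ j : Fin k, conjVar b (v (Equiv.swap 0 i j.succ)))) := by
  rw [constantCoeff_creProd_succ, der_prod_fin _ (fun j => conjVar b (v j)) (fun i => Λm (v i) (w 0))
    (fun i => der_creCoeff_conjVar b Λm (w 0) (v i)), map_sum, map_sum]
  refine Finset.sum_congr rfl fun i _ => ?_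
  rw [← smul_eq_C_mul, map_smul, smul_eq_C_mul, map_mul, constantCoeff_C]

theorem constantCoeff_creProd_prod_of_ne {m : ℕ} : ∀ {k : ℕ} (w : Fin m → 𝒱) (v : Fin k → 𝒱),
    m ≠ k → constantCoeff (creProd b Λp Λm w (∏ j, conjVar b (v j))) = 0 := by
  induction m with
  | zero =>
    intro k w v h
    obtain ⟨k, rfl⟩ := Nat.exists_eq_succ_of_ne_zero h.symm
    rw [creProd_zero, Module.End.one_apply, map_prod]
    exact Finset.prod_eq_zero (Finset.mem_univ 0) (constantCoeff_conjVar b _)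
  | succ m ih =>
    intro k w v h
    cases k with
    | zero =>
      rw [constantCoeff_creProd_succ, Finset.univ_eq_empty, Finset.prod_empty,
        Derivation.map_one_eq_zero, map_zero, map_zero]
    | succ k =>
      rw [constantCoeff_creProd_prod_succ]
      refine Finset.sum_eq_zero fun i _ => ?_
      rw [ih _ (fun j => v (Equiv.swap 0 i j.succ)) (fun e => h (by rw [e])), mul_zero]

theorem constantCoeff_creProd_prod {m : ℕ} : ∀ w v : Fin m → 𝒱,
    constantCoeff (creProd b Λp Λm w (∏ j, conjVar b (v j))) =
      ∑ σ : Equiv.Perm (Fin m), ∏ i, Λm (v (σ i)) (w i) := by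
  induction m with
  | zero => intro w v; simp [creProd_zero]
  | succ m ih =>
    intro w v
    -- A permutation of `Fin (m + 1)` is the partner i of index 0 together with a permutation of the
    -- remaining m indices.
    rw [constantCoeff_creProd_prod_succ, ← Equiv.Perm.decomposeFin.symm.sum_comp,
      Fintype.sum_prod_type]
    refine Finset.sum_congr rfl fun i _ => ?_
    rw [ih _ fun j => v (Equiv.swap 0 i j.succ), Finset.mul_sum]
    refine Finset.sum_congr rfl fun σ _ => ?_
    rw [Fin.prod_univ_succ, Equiv.Perm.decomposeFin_symm_apply_zero]
    simp only [Equiv.Perm.decomposeFin_symm_apply_succ]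

/-- The derivation in ψ(v) acts on the first variables, while the product built up so far contains
only the second ones. -/
theorem annProd_one {k : ℕ} : ∀ v : Fin k → 𝒱,
    (List.ofFn fun i => genOp b Λp Λm (.ann (v i))).prod 1 = ∏ j, conjVar b (v j) := by
  induction k with
  | zero => intro v; simp
  | succ k ih =>
    intro v
    rw [List.ofFn_succ, List.prod_cons, Module.End.mul_apply, ih fun j => v j.succ, genOp,
      fieldOp_apply, Fin.prod_univ_succ]
    classical
    have h := der_prod (annCoeff b Λp (v 0)) Finset.univ (fun j => conjVar b (v (Fin.succ j)))
      (fun _ => 0) fun j => by rw [der_annCoeff_conjVar, C_0]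
    rw [h]
    simp

variable (hsp : ∀ v w, star (Λp v w) = Λp w v) (hsm : ∀ v w, star (Λm v w) = Λm w v)
  (hp : ∀ v, 0 ≤ Λp v v) (hm : ∀ v, 0 ≤ Λm v v)

theorem quasiFreeState_normal {m k : ℕ} (w : Fin m → 𝒱) (v : Fin k → 𝒱) :
    (quasiFreeState b hq hsp hsm hp hm).toLin ((List.ofFn fun i => CCR.cre q (w i)).prod *
      (List.ofFn fun i => CCR.ann q (v i)).prod) =
    constantCoeff (creProd b Λp Λm w (∏ j, conjVar b (v j))) := by
  have h (g : CCRGen 𝒱) : ccrRep b hq (CCR.mk q (FreeAlgebra.ι ℂ g)) = genOp b Λp Λm g := by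
    rw [ccrRep_mk, freeRep_ι]
  change constantCoeff (ccrRep b hq _ 1) = _
  rw [map_mul, map_list_prod, map_list_prod, List.map_ofFn, List.map_ofFn, Module.End.mul_apply,
    ← annProd_one b (Λp := Λp) (Λm := Λm), creProd]
  simp only [Function.comp_def, CCR.cre, CCR.ann, h]

theorem quasiFreeState_cre_ann (w v : 𝒱) :
    (quasiFreeState b hq hsp hsm hp hm).toLin (CCR.cre q w * CCR.ann q v) = Λm v w := by
  have h := quasiFreeState_normal b hq hsp hsm hp hm (fun _ : Fin 1 => w) (fun _ : Fin 1 => v)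
  rw [constantCoeff_creProd_prod] at h
  simpa using h

theorem quasiFreeState_ann_cre (v w : 𝒱) :
    (quasiFreeState b hq hsp hsm hp hm).toLin (CCR.ann q v * CCR.cre q w) = Λp v w := by
  have h : CCR.ann q v * CCR.cre q w = CCR.cre q w * CCR.ann q v + q.form v w • 1 := by
    have := CCR.mk_rel q (.ccr v w)
    rwa [map_mul, map_add, map_mul, AlgHom.commutes, Algebra.algebraMap_eq_smul_one] at this
  rw [h, map_add, quasiFreeState_cre_ann, map_smul, State.map_one, hq, smul_eq_mul]
  ring

theorem quasiFreeState_isQuasiFree : (quasiFreeState b hq hsp hsm hp hm).IsQuasiFree := by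
  refine ⟨fun m k w v h => ?_, fun m w v => ?_⟩
  · rw [quasiFreeState_normal, constantCoeff_creProd_prod_of_ne b w v h]
  -- The expansion permutes v whereas the definition permutes w: pass to the inverse permutation and
  -- reindex the product.
  · rw [quasiFreeState_normal, constantCoeff_creProd_prod, ← Equiv.sum_comp (Equiv.inv _)]
    refine Finset.sum_congr rfl fun σ _ => ?_
    simp only [quasiFreeState_cre_ann]
    rw [← Equiv.prod_comp σ]
    simp

end QuasiFree

end

/-! ### Sesquilinear forms on quotients. -/

section Descent

variable {X : Type*} [AddCommGroup X] [Module ℂ X] (N : Submodule ℂ X) (B : X →ₗ⋆[ℂ] X →ₗ[ℂ] ℂ)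

/-- The form induced on a quotient space. -/
def quotForm (h : ∀ s, ∀ t ∈ N, B s t = 0) (h' : ∀ t ∈ N, ∀ s, B t s = 0) :
    X ⧸ N →ₗ⋆[ℂ] X ⧸ N →ₗ[ℂ] ℂ :=
  N.liftQ
    { toFun := fun s => N.liftQ (B s) fun t ht => h s t ht
      map_add' := fun s s' => Submodule.linearMap_qext _ (LinearMap.ext fun t =>
        LinearMap.map_add₂ B s s' t)
      map_smul' := fun c s => Submodule.linearMap_qext _ (LinearMap.ext fun t =>
        LinearMap.map_smulₛₗ₂ B c s t) }
    fun t ht => Submodule.linearMap_qext _ (LinearMap.ext fun s => h' t ht s)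

theorem quotForm_mk (h : ∀ s, ∀ t ∈ N, B s t = 0) (h' : ∀ t ∈ N, ∀ s, B t s = 0) (s t : X) :
    quotForm N B h h' (Submodule.Quotient.mk s) (Submodule.Quotient.mk t) = B s t := rfl

end Descent

/-! ### Covariances on the BRST phase space. -/

section PhaseSpace

variable {n : ℕ} {M : Type u} [TopologicalSpace M] [ChartedSpace (EuclideanSpace ℝ (Fin n)) M]
  [IsManifold (𝓡 n) ∞ M] [MeasurableSpace M] [T2Space M] [SigmaCompactSpace M] [BorelSpace M]
  {S : Spacetime n M} {V₁ : HermBundle.{u, v₁} n M} {V₀ : HermBundle.{u, v₂} n M}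
  {P : DiffOp V₁ V₁} {K : DiffOp V₀ V₁}

theorem adj_brstGamma_eq (h : IsSubsidiary S P K K) :
    adj S (brstGamma (V₁ := V₁) K) = brstGammaAdj S K := (adj_brstGamma h.adjK).adj_eq

/-- Degree 0 removes both ghost components, and the c-component of γ*s is K*a; the b-component
remains free. -/
theorem mem_physKer (h : IsSubsidiary S P K K) {s : SecC (totalBundle V₁ V₀)}
    (hs : s ∈ physKer S (ghostGrading V₁ V₀) (brstGamma K)) :
    (adj S K).onC ((projA V₁ V₀).onC s) = 0 ∧ (projC V₁ V₀).onC s = 0 ∧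
      (projD V₁ V₀).onC s = 0 := by
  obtain ⟨h1, h2⟩ := hs
  obtain ⟨-, -, hc, hd⟩ := (hasDegree_onC_iff 0 s).1 h2
  have h3 : (brstGammaAdj S K).toLin (toSec _ s) = 0 := by
    rw [← DiffOp.toSec_onC, ← adj_brstGamma_eq h]
    exact toSec_eq_zero.2 h1
  rw [brstGammaAdj_eq, ← mk4_zero] at h3
  refine ⟨?_, hc zero_ne_one, hd (by norm_num)⟩
  exact toSec_eq_zero.1 (mk4_inj h3).2.2.1

/-- The term (a | K lR b') equals (K*a | lR b') = 0, and the ghost components of s vanish, so ε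
disappears. -/
theorem pair_brstTwoPoint (h : IsSubsidiary S P K K) {s : SecC (totalBundle V₁ V₀)}
    (hs : s ∈ physKer S (ghostGrading V₁ V₀) (brstGamma K)) (ε : ℂ) (lD : SecC V₁ →ₗ[ℂ] Sec V₁)
    (lR : SecC V₀ →ₗ[ℂ] Sec V₀) (t : SecC (totalBundle V₁ V₀)) :
    pair S _ s.1 (brstTwoPoint S K ε lD lR t).1 =
      pair S V₁ ((projA V₁ V₀).onC s).1 (lD ((projA V₁ V₀).onC t)).1 +
      pair S V₀ ((projB V₁ V₀).onC s).1 (lR ((adj S K).onC ((projA V₁ V₀).onC t))).1 := by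
  obtain ⟨ha, hc, hd⟩ := mem_physKer h hs
  have h0 (w : Sec V₀) : pair S V₀ (0 : SecC V₀).1 w.1 = 0 := pair_eq_zero S fun x => Or.inl rfl
  rw [brstTwoPoint_eq, pair_mk4, hc, hd, h0, h0, add_zero, add_zero, pair_add_right,
    ← h.adjK.symm.pair_left, ha, h0, add_zero]

theorem pair_brstTwoPoint_phys (h : IsSubsidiary S P K K) {s t : SecC (totalBundle V₁ V₀)}
    (hs : s ∈ physKer S (ghostGrading V₁ V₀) (brstGamma K))
    (ht : t ∈ physKer S (ghostGrading V₁ V₀) (brstGamma K)) (ε : ℂ) (lD : SecC V₁ →ₗ[ℂ] Sec V₁)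
    (lR : SecC V₀ →ₗ[ℂ] Sec V₀) :
    pair S _ s.1 (brstTwoPoint S K ε lD lR t).1 =
      pair S V₁ ((projA V₁ V₀).onC s).1 (lD ((projA V₁ V₀).onC t)).1 := by
  rw [pair_brstTwoPoint h hs, (mem_physKer h ht).1, map_zero,
    pair_eq_zero S (t := (0 : Sec V₀).1) fun x => Or.inr rfl, add_zero]

/-- Ran L is annihilated by the equation of motion. Elements of Ran γ* have no a-component, and that
is the only component of t seen by the pairing with a physical section. -/
theorem pair_brstTwoPoint_gauge (h : IsSubsidiary S P K K) {s t : SecC (totalBundle V₁ V₀)}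
    (hs : s ∈ physKer S (ghostGrading V₁ V₀) (brstGamma K))
    (ht : t ∈ gaugeRan S (ghostGrading V₁ V₀) (brstL S P K 1) (brstGamma K)) {ε : ℂ}
    {lD : SecC V₁ →ₗ[ℂ] Sec V₁} {lR : SecC V₀ →ₗ[ℂ] Sec V₀}
    (heom : ∀ z, brstTwoPoint S K ε lD lR ((brstL S P K 1).onC z) = 0) :
    pair S _ s.1 (brstTwoPoint S K ε lD lR t).1 = 0 := by
  obtain ⟨_, ⟨w, rfl⟩, _, ⟨⟨z, rfl⟩, -⟩, rfl⟩ := Submodule.mem_sup.1 ht.1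
  have h1 : (projA V₁ V₀).onC ((adj S (brstGamma K)).onC w) = 0 := by
    rw [← toSec_eq_zero, DiffOp.toSec_onC, DiffOp.toSec_onC, adj_brstGamma_eq h, brstGammaAdj_eq,
      projA_mk4]
  rw [map_add, heom, add_zero, pair_brstTwoPoint h hs, h1, map_zero, map_zero, map_zero,
    pair_eq_zero S (t := (0 : Sec V₁).1) fun x => Or.inr rfl,
    pair_eq_zero S (t := (0 : Sec V₀).1) fun x => Or.inr rfl, add_zero]

/-- The sesquilinear form `(s|l t)` on the space of physical test sections. -/
def physForm (S : Spacetime n M) (K : DiffOp V₀ V₁)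
    (l : SecC (totalBundle V₁ V₀) →ₗ[ℂ] Sec (totalBundle V₁ V₀)) :
    physKer S (ghostGrading V₁ V₀) (brstGamma K) →ₗ⋆[ℂ]
      physKer S (ghostGrading V₁ V₀) (brstGamma K) →ₗ[ℂ] ℂ where
  toFun s := pairL S _ s.1 ∘ₗ l ∘ₗ (physKer S (ghostGrading V₁ V₀) (brstGamma K)).subtype
  map_add' s s' := LinearMap.ext fun t => LinearMap.map_add₂ (pairL S _) s.1 s'.1 (l t.1)
  map_smul' c s := LinearMap.ext fun t => LinearMap.map_smulₛₗ₂ (pairL S _) c s.1 (l t.1)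

theorem physForm_apply (l : SecC (totalBundle V₁ V₀) →ₗ[ℂ] Sec (totalBundle V₁ V₀))
    (s t : physKer S (ghostGrading V₁ V₀) (brstGamma K)) :
    physForm S K l s t = pair S _ s.1.1 (l t.1).1 := rfl

/-- The covariance on the phase space defined by a two-point function. -/
theorem exists_covariance (h : IsSubsidiary S P K K) {ε : ℂ}
    {lD : SecC V₁ →ₗ[ℂ] Sec V₁} {lR : SecC V₀ →ₗ[ℂ] Sec V₀}
    (hl : IsTwoPointPart S (ghostGrading V₁ V₀) (brstL S P K 1) (brstTwoPoint S K ε lD lR))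
    (hpos : ∀ s : SecC V₁, (adj S K).onC s = 0 → 0 ≤ pair S V₁ s.1 (lD s).1) :
    ∃ Λ : PhaseSpace S (ghostGrading V₁ V₀) (brstL S P K 1) (brstGamma K) →ₗ⋆[ℂ]
        PhaseSpace S (ghostGrading V₁ V₀) (brstL S P K 1) (brstGamma K) →ₗ[ℂ] ℂ,
      (∀ v w, star (Λ v w) = Λ w v) ∧ (∀ v, 0 ≤ Λ v v) ∧
      ∀ s t : physKer S (ghostGrading V₁ V₀) (brstGamma K),
        Λ (Submodule.Quotient.mk s) (Submodule.Quotient.mk t) =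
          pair S _ s.1.1 (brstTwoPoint S K ε lD lR t.1).1 := by
  have hsymm (s t : physKer S (ghostGrading V₁ V₀) (brstGamma K)) :
      star (physForm S K (brstTwoPoint S K ε lD lR) s t) =
        physForm S K (brstTwoPoint S K ε lD lR) t s := by
    rw [physForm_apply, physForm_apply, hl.herm t.1 s.1]
    exact pair_conj S _ _
  have h0 (s : physKer S (ghostGrading V₁ V₀) (brstGamma K))
      (t : physKer S (ghostGrading V₁ V₀) (brstGamma K))
      (ht : t ∈ (gaugeRan S (ghostGrading V₁ V₀) (brstL S P K 1) (brstGamma K)).comap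
        (physKer S (ghostGrading V₁ V₀) (brstGamma K)).subtype) :
      physForm S K (brstTwoPoint S K ε lD lR) s t = 0 :=
    pair_brstTwoPoint_gauge h s.2 ht hl.eom
  refine ⟨quotForm _ (physForm S K (brstTwoPoint S K ε lD lR)) h0 fun t ht s => ?_,
    fun v w => ?_, fun v => ?_, fun s t => rfl⟩
  · rw [← hsymm, h0 s t ht, star_zero]
  · induction v using Submodule.Quotient.induction_on with | _ s
    induction w using Submodule.Quotient.induction_on with | _ t
    exact hsymm s t
  · induction v using Submodule.Quotient.induction_on with | _ s
    rw [quotForm_mk, physForm_apply, pair_brstTwoPoint_phys h s.2 s.2]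
    exact hpos _ (mem_physKer h s.2).1

end PhaseSpace

end BRST

end

theorem mainTheorem5 {n : ℕ} {M : Type u} [TopologicalSpace M]
    [ChartedSpace (EuclideanSpace ℝ (Fin n)) M] [IsManifold (𝓡 n) ∞ M]
    [T2Space M] [SigmaCompactSpace M] [MeasurableSpace M] [BorelSpace M]
    (S : Spacetime n M) (hS : S.GloballyHyperbolic)
    (V₀ : HermBundle.{u, v₂} n M) (V₁ : HermBundle.{u, v₁} n M)
    (P : DiffOp V₁ V₁) (K : DiffOp V₀ V₁) (hPK : IsSubsidiary S P K K)
    (lDp lDm : SecC V₁ →ₗ[ℂ] Sec V₁) (lRp lRm : SecC V₀ →ₗ[ℂ] Sec V₀)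
    (hD : IsBosonicTwoPoint S (Grading.single V₁ 0) (P + K.comp (adj S K)) lDp lDm)
    (hDhad : IsHadamard S (P + K.comp (adj S K)) lDp lDm)
    (hR : IsBosonicTwoPoint S (Grading.single V₀ 0) ((adj S K).comp K) lRp lRm)
    (hRhad : IsHadamard S ((adj S K).comp K) lRp lRm)
    (hKp : ∀ s : SecC V₀, K.toLin (lRp s) = lDp (K.onC s))
    (hKm : ∀ s : SecC V₀, K.toLin (lRm s) = lDm (K.onC s))
    (hposp : ∀ s : SecC V₁, (adj S K).onC s = 0 → 0 ≤ pair S V₁ s.1 (lDp s).1)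
    (hposm : ∀ s : SecC V₁, (adj S K).onC s = 0 → 0 ≤ pair S V₁ s.1 (lDm s).1) :
    IsBRST S (ghostGrading V₁ V₀) (brstL S P K 1) (brstGamma K) ∧
    IsBosonicTwoPoint S (ghostGrading V₁ V₀) (brstL S P K 1)
      (brstTwoPoint S K 1 lDp lRp) (brstTwoPoint S K (-1) lDm lRm) ∧
    ∃ q : HermForm (PhaseSpace S (ghostGrading V₁ V₀) (brstL S P K 1) (brstGamma K)),
      IsPhaseSpaceForm S (ghostGrading V₁ V₀) (brstL S P K 1) (brstGamma K) q ∧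
      ∃ φ : State q,
        IsHadamardState S (ghostGrading V₁ V₀) (brstL S P K 1) (brstGamma K) q φ
          (brstTwoPoint S K 1 lDp lRp) (brstTwoPoint S K (-1) lDm lRm) := by
  have hL := isBosonicTwoPoint_brst hS hPK hD hR hKp hKm
  refine ⟨isBRST hS hPK, hL, ?_⟩
  obtain ⟨Λp, hsp, hpp, hp⟩ := exists_covariance hPK hL.pos hposp
  obtain ⟨Λm, hsm, hpm, hm⟩ := exists_covariance hPK hL.neg hposm
  -- Taking q as Λ⁺ - Λ⁻ makes it well defined on the quotient and compatible with the covariances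
  -- by construction; the formula with G_L is checked at the end.
  let q : HermForm (PhaseSpace S (ghostGrading V₁ V₀) (brstL S P K 1) (brstGamma K)) :=
    { form := Λp - Λm
      symm := fun v w => by
        rw [LinearMap.sub_apply, LinearMap.sub_apply, LinearMap.sub_apply, LinearMap.sub_apply,
          star_sub, hsp, hsm] }
  have hq (v w : PhaseSpace S (ghostGrading V₁ V₀) (brstL S P K 1) (brstGamma K)) :
      q.form v w = Λp v w - Λm v w := rfl
  refine ⟨q, fun s t => ?_, quasiFreeState (Module.Basis.ofVectorSpace ℂ _) hq hsp hsm hpp hpm,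
    quasiFreeState_isQuasiFree _ hq hsp hsm hpp hpm, hL, isHadamard_brst hS hPK hDhad hRhad,
    fun s t => (quasiFreeState_ann_cre _ hq hsp hsm hpp hpm _ _).trans (hp s t),
    fun s t => (quasiFreeState_cre_ann _ hq hsp hsm hpp hpm _ _).trans (hm s t)⟩
  -- On physical sections all three pairings involve only the a-components, where the claim is the
  -- relation λ_D⁺ - λ_D⁻ = i⁻¹ G_D.
  rw [hq, hp, hm, causalPropagator_brstL hS hPK, pair_brstTwoPoint_phys hPK s.2 t.2,
    pair_brstTwoPoint_phys hPK s.2 t.2, pair_brstTwoPoint_phys hPK s.2 t.2, ← pair_sub_right]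
  have h1 := hD.single_ccr ((projA V₁ V₀).onC t.1)
  rw [← pair_smul_right, ← h1]
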